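/- Let $d\ge 2$, let $\Omega\subset\mathbb R^d$ be open and bounded, $I=[0,T]$ with $T>0$, $N\ge 1$, and let $-\alpha=\alpha_{-1}<\alpha_0=0<\alpha_1<\dots<\alpha_N$ with $\alpha\in(0,1)$. Put $s=\alpha_N+2$, $s^*=s/(s-1)$, $Q=L^2(\Omega)$, $V=\{\mathbf v\in (L^s(\Omega))^d:\nabla\cdot\mathbf v\in L^2(\Omega)\}$, and write $(\cdot,\cdot)$ for the integral over $\Omega$ of the product. Let $$F(z)=a_{-1}(x,t)z^{-\alpha}+a_0(x,t)+a_1(x,t)z^{\alpha_1}+\dots+a_N(x,t)z^{\alpha_N},$$ where $a_{-1},\dots,a_N\in W^{1,\infty}(I,L^\infty(\Omega))$ satisfy $0<a_*<a_{-1},a_0,a_N<a^*$, $0\le a_i\le a^*$ for $1\le i\le N-1$, and $|\partial_t a_i|<b^*$ almost everywhere (and $F(|\mathbf m|)\mathbf m=0$ where $\mathbf m=0$). Let $\phi$ be measurable with $0<\phi_*\le\phi(x)\le\phi^*<\infty$, let $f\in L^\infty(I,L^2(\Omega))$, and let $\Psi$ be a function on $\Omega\times I$ (the extension of the boundary data)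 with time derivative $\Psi_t$ and weak spatial gradient $\nabla\Psi$. Let $(\mathbf m,\bar\rho):I\to V\times Q$, with $\bar\rho_t\in L^1(I,L^2(\Omega))$, be a solution of the weak problem: for almost every $t\in I$, $$(F(|\mathbf m|)\mathbf m,\mathbf v)-(\bar\rho,\nabla\cdot\mathbf v)=-(\nabla\Psi,\mathbf v)\quad\forall\,\mathbf v\in V,$$ $$(\phi\bar\rho_t,q)+(\nabla\cdot\mathbf m,q)=(f,q)-(\phi\Psi_t,q)\quad\forall\, q\in Q,$$ and let $\bar\rho_0=\bar\rho(\cdot,0)$. Then there is a constant $C>0$, depending only on $d,\Omega,T,N$, the exponents $\alpha_i$ and the bounds $a_*,a^*,b^*,\phi_*,\phi^*$ (and not on $f$, $\Psi$, the initial data or the solution), such that $$\|\bar\rho\|_{L^\infty(I,L^2(\Omega))}^2+\|\mathbf m\|_{L^s(I,L^s(\Omega))}^s\le C\big(\|\bar\rho_0\|_{L^2(\Omega)}^2+\mathscr A\big),$$ $$\mathscr A=\|f\|_{L^2(I,L^2(\Omega))}^2+\|\Psi_t\|_{L^2(I,L^2(\Omega))}^2+\|\nabla\Psi\|_{L^{s^*}(I,L^{s^*}(\Omega))}^{s^*}.$$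 If moreover the time derivatives $f_t,\Psi_{tt},\nabla\Psi_t,\mathbf m_t$ exist, and $\bar\rho_t(0)=\lim_{h\to0^+}(\bar\rho(h)-\bar\rho(0))/h$ exists in $L^2(\Omega)$, then $$\|\bar\rho_t\|_{L^\infty(I,L^2(\Omega))}^2+\|\mathbf m_t\|_{L^2(I,L^2(\Omega))}^2+\|\nabla\cdot\mathbf m\|_{L^\infty(I,L^2(\Omega))}^2\le C(\mathscr B_0+\mathscr B),$$ $$\mathscr B_0=\|\bar\rho_0\|_{L^2(\Omega)}^2+\|\bar\rho_t(0)\|_{L^2(\Omega)}^2,\qquad \mathscr B=\mathscr A+\|f_t\|_{L^2(I,L^2(\Omega))}^2+\|\Psi_{tt}\|_{L^2(I,L^2(\Omega))}^2+\|\nabla\Psi_t\|_{L^2(I,L^2(\Omega))}^2 .$$ Here norms may take the value $+\infty$, and time derivatives are taken in the weak (absolutely continuous) sense. -/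

import Mathlib

open MeasureTheory Set Filter Topology
open scoped ENNReal ContDiff

namespace MixedRegimeFlow

noncomputable section

/-- The space `ℝ^d` with the Euclidean norm. -/
abbrev Space (d : ℕ) : Type := EuclideanSpace ℝ (Fin d)

/-- The norm of `L^p(I, L^q(Ω))`, `I = [0, T]`, with values in `[0, ∞]`; the function is written
`u t x` with `t ∈ I`, `x ∈ Ω`. For `p = ∞` the outer norm is the essential supremum over `I`. -/
def bochnerNorm {d : ℕ} {X : Type*} [NormedAddCommGroup X] (Ω : Set (Space d)) (T : ℝ)
    (p q : ℝ≥0∞) (u : ℝ → Space d → X) : ℝ≥0∞ :=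
  eLpNorm (fun t : ℝ => eLpNorm (u t) q (volume.restrict Ω)) p (volume.restrict (Icc 0 T))

/-- The norm of `L^2(Ω)`, with values in `[0, ∞]`. -/
def normL2 {d : ℕ} (Ω : Set (Space d)) (w : Space d → ℝ) : ℝ≥0∞ :=
  eLpNorm w 2 (volume.restrict Ω)

/-- Smooth test functions with compact support in `Ω`. -/
def IsTestFunction {d : ℕ} (Ω : Set (Space d)) (η : Space d → ℝ) : Prop :=
  ContDiff ℝ ∞ η ∧ HasCompactSupport η ∧ tsupport η ⊆ Ω

/-- `g` is the weak (distributional) divergence of the vector field `v` in `Ω`. -/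
def HasWeakDiv {d : ℕ} (Ω : Set (Space d)) (v : Space d → Space d) (g : Space d → ℝ) : Prop :=
  LocallyIntegrableOn v Ω ∧ LocallyIntegrableOn g Ω ∧
    ∀ η : Space d → ℝ, IsTestFunction Ω η →
      ∫ x in Ω, inner ℝ (v x) (gradient η x) = -∫ x in Ω, g x * η x

/-- `G` is the weak (distributional) gradient of `w` in `Ω`. -/
def HasWeakGrad {d : ℕ} (Ω : Set (Space d)) (w : Space d → ℝ) (G : Space d → Space d) : Prop :=
  LocallyIntegrableOn w Ω ∧ LocallyIntegrableOn G Ω ∧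
    ∀ η : Space d → ℝ, IsTestFunction Ω η →
      ∫ x in Ω, w x • gradient η x = -∫ x in Ω, η x • G x

/-- `u'` is the (weak) time derivative of `u` on `Ω × [0, T]`: for almost every `x ∈ Ω` the function
`t ↦ u t x` is absolutely continuous on `[0, T]` with derivative `u' t x`. (Every function with a
weak time derivative in a Bochner space `L^1(I, L^q(Ω))` has a representative of this kind.) -/
def HasTimeDeriv {d : ℕ} {X : Type*} [NormedAddCommGroup X] [NormedSpace ℝ X]
    (Ω : Set (Space d)) (T : ℝ) (u u' : ℝ → Space d → X) : Prop :=
  ∀ᵐ x ∂(volume.restrict Ω),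
    IntervalIntegrable (fun t => u' t x) volume 0 T ∧
      ∀ t ∈ Icc (0 : ℝ) T, u t x = u 0 x + ∫ τ in (0 : ℝ)..t, u' τ x

/-- The powers `α_{-1} = -α < α_0 = 0 < α_1 < … < α_N` with `α ∈ (0, 1)`. They are indexed by
`Fin (N + 2)`: the index `i` stands for `i - 1`, so `0` is `-1` and `Fin.last (N + 1)` is `N`. -/
def IsPowerVector (N : ℕ) (α : Fin (N + 2) → ℝ) : Prop :=
  StrictMono α ∧ -1 < α 0 ∧ α 1 = 0

/-- The exponent `s = α_N + 2`. -/
def sExp {N : ℕ} (α : Fin (N + 2) → ℝ) : ℝ := α (Fin.last (N + 1)) + 2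

/-- The conjugate exponent `s^* = s / (s - 1)`. -/
def sConj {N : ℕ} (α : Fin (N + 2) → ℝ) : ℝ := sExp α / (sExp α - 1)

/-- The generalized polynomial `F(z) = a_{-1} z^{-α} + a_0 + a_1 z^{α_1} + … + a_N z^{α_N}` with
coefficients `a`. At `z = 0` the singular term takes the value `0`; `F` is only used in the
product `F(|m|) m`, which vanishes (as its continuous extension does) where `m = 0`. -/
def genPoly {N : ℕ} (α a : Fin (N + 2) → ℝ) (z : ℝ) : ℝ := ∑ i, a i * z ^ α i

/-- The hypotheses on the coefficients `a_{-1}, …, a_N ∈ W^{1,∞}(I, L^∞(Ω))`. -/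
structure IsAdmissibleCoeff {d : ℕ} (Ω : Set (Space d)) (T : ℝ) {N : ℕ} (aLo aHi bHi : ℝ)
    (a : Fin (N + 2) → ℝ → Space d → ℝ) : Prop where
  measurable : ∀ i, Measurable (Function.uncurry (a i))
  nonneg_le : ∀ i, ∀ᵐ t ∂(volume.restrict (Icc 0 T)), ∀ᵐ x ∂(volume.restrict Ω),
    0 ≤ a i t x ∧ a i t x ≤ aHi
  lt_lt : ∀ i, i = 0 ∨ i = 1 ∨ i = Fin.last (N + 1) →
    ∀ᵐ t ∂(volume.restrict (Icc 0 T)), ∀ᵐ x ∂(volume.restrict Ω), aLo < a i t x ∧ a i t x < aHi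
  timeDeriv : ∀ i, ∃ a' : ℝ → Space d → ℝ, Measurable (Function.uncurry a') ∧
    HasTimeDeriv Ω T (a i) a' ∧
    ∀ᵐ t ∂(volume.restrict (Icc 0 T)), ∀ᵐ x ∂(volume.restrict Ω), |a' t x| < bHi

/-- The hypotheses on the porosity `φ`. -/
structure IsAdmissiblePorosity {d : ℕ} (Ω : Set (Space d)) (φLo φHi : ℝ)
    (φ : Space d → ℝ) : Prop where
  measurable : Measurable φ
  bounds : ∀ᵐ x ∂(volume.restrict Ω), φLo ≤ φ x ∧ φ x ≤ φHi

/-- The source `f ∈ L^∞(I, L^2(Ω))` and the function `Ψ` extending the boundary data, with its time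
derivative `Ψ_t = Ψt` and its spatial gradient `∇Ψ = gΨ`. -/
structure IsAdmissibleData {d : ℕ} (Ω : Set (Space d)) (T : ℝ) (f Ψ Ψt : ℝ → Space d → ℝ)
    (gΨ : ℝ → Space d → Space d) : Prop where
  measurable_f : Measurable (Function.uncurry f)
  f_bounded : bochnerNorm Ω T ∞ 2 f < (∞ : ℝ≥0∞)
  measurable_Ψ : Measurable (Function.uncurry Ψ)
  measurable_Ψt : Measurable (Function.uncurry Ψt)
  measurable_gΨ : Measurable (Function.uncurry gΨ)
  timeDeriv_Ψ : HasTimeDeriv Ω T Ψ Ψt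
  grad_Ψ : ∀ᵐ t ∂(volume.restrict (Icc 0 T)), HasWeakGrad Ω (Ψ t) (gΨ t)

/-- `(m, ρ) : I → V × Q` solves the mixed weak problem
`(F(|m|) m, v) - (ρ, ∇·v) = -(∇Ψ, v)` for all `v ∈ V`,
`(φ ρ_t, q) + (∇·m, q) = (f, q) - (φ Ψ_t, q)` for all `q ∈ Q`,
for almost every `t ∈ I`, where `Q = L^2(Ω)` and `V = {v ∈ L^s(Ω)^d : ∇·v ∈ L^2(Ω)}`.
Here `ρt` is the time derivative of `ρ`, integrable in time with values in `L^2(Ω)`, and `dm` is the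
divergence of `m`. -/
structure IsWeakSolution {d : ℕ} (Ω : Set (Space d)) (T : ℝ) {N : ℕ} (α : Fin (N + 2) → ℝ)
    (a : Fin (N + 2) → ℝ → Space d → ℝ) (φ : Space d → ℝ) (f Ψt : ℝ → Space d → ℝ)
    (gΨ : ℝ → Space d → Space d)
    (m : ℝ → Space d → Space d) (dm ρ ρt : ℝ → Space d → ℝ) : Prop where
  measurable_m : Measurable (Function.uncurry m)
  measurable_dm : Measurable (Function.uncurry dm)
  measurable_ρ : Measurable (Function.uncurry ρ)
  measurable_ρt : Measurable (Function.uncurry ρt)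
  m_mem : ∀ᵐ t ∂(volume.restrict (Icc 0 T)),
    MemLp (m t) (ENNReal.ofReal (sExp α)) (volume.restrict Ω) ∧
      MemLp (dm t) 2 (volume.restrict Ω) ∧ HasWeakDiv Ω (m t) (dm t)
  ρ_mem : ∀ t ∈ Icc (0 : ℝ) T, MemLp (ρ t) 2 (volume.restrict Ω)
  timeDeriv_ρ : HasTimeDeriv Ω T ρ ρt
  ρt_integrable : bochnerNorm Ω T 1 2 ρt < (∞ : ℝ≥0∞)
  momentum : ∀ᵐ t ∂(volume.restrict (Icc 0 T)), ∀ (v : Space d → Space d) (dv : Space d → ℝ),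
    MemLp v (ENNReal.ofReal (sExp α)) (volume.restrict Ω) → MemLp dv 2 (volume.restrict Ω) →
    HasWeakDiv Ω v dv →
      (∫ x in Ω, inner ℝ (genPoly α (fun i => a i t x) ‖m t x‖ • m t x) (v x)) -
        (∫ x in Ω, ρ t x * dv x) = -∫ x in Ω, inner ℝ (gΨ t x) (v x)
  continuity : ∀ᵐ t ∂(volume.restrict (Icc 0 T)), ∀ q : Space d → ℝ,
    MemLp q 2 (volume.restrict Ω) →
      (∫ x in Ω, φ x * ρt t x * q x) + (∫ x in Ω, dm t x * q x) =
        (∫ x in Ω, f t x * q x) - ∫ x in Ω, φ x * Ψt t x * q x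

/-- `w` is the value at `t = 0` of the time derivative of `ρ`, in `L^2(Ω)`. -/
def IsInitialTimeDeriv {d : ℕ} (Ω : Set (Space d)) (ρ : ℝ → Space d → ℝ)
    (w : Space d → ℝ) : Prop :=
  MemLp w 2 (volume.restrict Ω) ∧
    Tendsto (fun h : ℝ => normL2 Ω (fun x => h⁻¹ * (ρ h x - ρ 0 x) - w x)) (𝓝[>] 0) (𝓝 0)

/-- `𝒜 = ‖f‖²_{L²(I,L²)} + ‖Ψ_t‖²_{L²(I,L²)} + ‖∇Ψ‖^{s^*}_{L^{s^*}(I,L^{s^*})}`. -/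
def dataA {d : ℕ} (Ω : Set (Space d)) (T : ℝ) {N : ℕ} (α : Fin (N + 2) → ℝ)
    (f Ψt : ℝ → Space d → ℝ) (gΨ : ℝ → Space d → Space d) : ℝ≥0∞ :=
  bochnerNorm Ω T 2 2 f ^ 2 + bochnerNorm Ω T 2 2 Ψt ^ 2 +
    bochnerNorm Ω T (ENNReal.ofReal (sConj α)) (ENNReal.ofReal (sConj α)) gΨ ^ sConj α

/-- `ℬ₀ = ‖ρ₀‖²_{L²} + ‖ρ_t(0)‖²_{L²}`. -/
def dataB₀ {d : ℕ} (Ω : Set (Space d)) (ρ₀ ρt₀ : Space d → ℝ) : ℝ≥0∞ :=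
  normL2 Ω ρ₀ ^ 2 + normL2 Ω ρt₀ ^ 2

/-- `ℬ = 𝒜 + ‖f_t‖²_{L²(I,L²)} + ‖Ψ_tt‖²_{L²(I,L²)} + ‖∇Ψ_t‖²_{L²(I,L²)}`. -/
def dataB {d : ℕ} (Ω : Set (Space d)) (T : ℝ) {N : ℕ} (α : Fin (N + 2) → ℝ)
    (f ft Ψt Ψtt : ℝ → Space d → ℝ) (gΨ gΨt : ℝ → Space d → Space d) : ℝ≥0∞ :=
  dataA Ω T α f Ψt gΨ + bochnerNorm Ω T 2 2 ft ^ 2 + bochnerNorm Ω T 2 2 Ψtt ^ 2 +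
    bochnerNorm Ω T 2 2 gΨt ^ 2

end

end MixedRegimeFlow

open MixedRegimeFlow

namespace MixedRegimeFlow

/-! ### Pointwise inequalities for the flux `F(|m|) m` -/

section Pointwise

variable {E : Type*} [NormedAddCommGroup E] [InnerProductSpace ℝ E]

/-! First bound. Testing the momentum equation with `m` and the continuity equation with `ρ` cancels
the two divergence terms. What is left is (F(|m|)m, m) + (φ ρt, ρ) = (f - φΨt, ρ) - (∇Ψ, m). The
flux term is at least `aLo` times the integral of `energyDensity`, which dominates |m|^s; Young's
inequality absorbs (∇Ψ, m) into half of it. The term (φ ρt, ρ) is half the time derivative of the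
weighted energy ∫ φ ρ², and the source is absorbed into the supremum in time of that energy, so no
Gronwall argument is needed (`exists_energy_bound`).

Second bound. The equations are not differentiated in time. They are subtracted at times t + k and t
and tested with the increments of `m` and `ρ`. The powers |u|^β u with β > -1 are strongly monotone
(`rpow_smul_strongMono`), and the constant term a₀ of F makes the flux strongly monotone with the
unweighted square |u - v|² (`exists_flux_mono`). Since the coefficients depend on time, an error
appears: k² times the energy densities at both times. The first bound controls its integral, which
is why that bound is kept for the full `energyDensity` and not only for |m|^s. The same
`exists_energy_bound`, applied to increments on [0, T - k], then gives an estimate of order k²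
(`exists_increment_estimate`).

Dividing by k² and letting k tend to 0, Fatou's lemma yields the bounds for ρt and mt
(`exists_timeDeriv_estimate`); the initial quotient converges to ρt(0) in L² by hypothesis. Finally
the continuity equation expresses the divergence through f, Ψt and ρt. The first two are bounded in
time with values in L² because their time derivatives are square integrable. -/

/-- For β ≤ 0 this is Bernoulli's inequality for the concave power 1 + β; for β ≥ 0 it is τ^(1+β) ≤
τ. -/
theorem one_sub_rpow_ge {β τ : ℝ} (hβ : -1 < β) (h0 : 0 ≤ τ) (h1 : τ ≤ 1) :
    min 1 (1 + β) * (1 - τ) ≤ 1 - τ ^ (1 + β) := by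
  rcases le_total β 0 with hb | hb
  · rw [min_eq_right (by linarith)]
    have := rpow_one_add_le_one_add_mul_self (s := τ - 1) (by linarith)
      (p := 1 + β) (by linarith) (by linarith)
    rw [add_sub_cancel] at this
    linarith
  · rw [min_eq_left (by linarith)]
    have := Real.rpow_le_rpow_of_exponent_ge_of_imp h0 h1 (by linarith : (1 : ℝ) ≤ 1 + β)
      (fun _ h => by linarith)
    rw [Real.rpow_one] at this
    linarith

/-- Strong monotonicity of `u ↦ |u|^β u` for `β > -1`. -/
theorem rpow_smul_strongMono {β : ℝ} (hβ : -1 < β) (u v : E) :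
    min 1 (1 + β) / 2 * max ‖u‖ ‖v‖ ^ β * ‖u - v‖ ^ 2 ≤
      inner ℝ (‖u‖ ^ β • u - ‖v‖ ^ β • v) (u - v) := by
  wlog h : ‖v‖ ≤ ‖u‖ generalizing u v
  · have := this v u (not_le.1 h).le
    rw [max_comm, norm_sub_rev]
    refine this.trans_eq ?_
    rw [← neg_sub u v, inner_neg_right, ← inner_neg_left, neg_sub]
  rcases eq_or_ne u 0 with rfl | hu
  · have : v = 0 := by simpa using h
    simp [this]
  have hr : 0 < ‖u‖ := norm_pos_iff.2 hu
  rw [max_eq_left h, norm_sub_sq_real, inner_sub_left, inner_sub_right, inner_sub_right,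
    real_inner_smul_left, real_inner_smul_left, real_inner_smul_left, real_inner_smul_left,
    real_inner_self_eq_norm_sq, real_inner_self_eq_norm_sq, real_inner_comm u v]
  have hp : inner ℝ u v ≤ ‖u‖ * ‖v‖ := real_inner_le_norm u v
  have hq : 0 ≤ ‖v‖ := norm_nonneg v
  have hA : 0 < ‖u‖ ^ β := Real.rpow_pos_of_pos hr β
  have hB : 0 ≤ ‖v‖ ^ β := Real.rpow_nonneg hq β
  have hc1 : min 1 (1 + β) ≤ 1 := min_le_left _ _
  have hc0 : 0 < min 1 (1 + β) := lt_min one_pos (by linarith)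
  -- The radial case: `one_sub_rpow_ge` at τ = ‖v‖/‖u‖, rescaled by ‖u‖^(1+β).
  have key : min 1 (1 + β) * (‖u‖ ^ β * (‖u‖ - ‖v‖)) ≤ ‖u‖ ^ β * ‖u‖ - ‖v‖ ^ β * ‖v‖ := by
    have h2 := one_sub_rpow_ge hβ (div_nonneg hq hr.le) ((div_le_one hr).2 h)
    have hvv : ‖v‖ ^ β * ‖v‖ = ‖v‖ ^ (1 + β) := by
      rw [add_comm, Real.rpow_add_one' hq (by linarith)]
    have huu : ‖u‖ ^ β * ‖u‖ = ‖u‖ ^ (1 + β) := by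
      rw [add_comm, Real.rpow_add_one' hr.le (by linarith)]
    rw [Real.div_rpow hq hr.le, ← hvv, ← huu] at h2
    have h3 := mul_le_mul_of_nonneg_left h2 (mul_pos hA hr).le
    field_simp at h3
    linarith
  generalize min 1 (1 + β) = c at *
  generalize ‖u‖ ^ β = A at *
  generalize ‖v‖ ^ β = B at *
  generalize ‖u‖ = r at *
  generalize ‖v‖ = q at *
  generalize inner ℝ u v = p at *
  -- The inner product equals (Ar - Bq)(r - q) + (A + B)(rq - p), and ‖u - v‖² = (r - q)² + 2(rq -
  -- p). The radial parts are compared by `key`, the angular parts by c ≤ 1 and Cauchy–Schwarz.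
  have e1 : 0 ≤ (A + B - c * A) * (r * q - p) :=
    mul_nonneg (by nlinarith) (by linarith)
  have e2 := mul_le_mul_of_nonneg_right key (sub_nonneg.2 h)
  have e3 : 0 ≤ c * A * (r - q) ^ 2 := by positivity
  nlinarith

/-- For β < 0 the factor ‖v‖^β alone is decreasing, but the product is the power 1 + β > 0. -/
theorem norm_rpow_mul_norm_le {E : Type*} [NormedAddCommGroup E] {β R : ℝ} (hβ : -1 < β) {v : E} (h : ‖v‖ ≤ R) :
    ‖v‖ ^ β * ‖v‖ ≤ R ^ β * R := by
  rw [← Real.rpow_add_one' (norm_nonneg v) (by linarith),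
    ← Real.rpow_add_one' ((norm_nonneg v).trans h) (by linarith)]
  exact Real.rpow_le_rpow (norm_nonneg v) h (by linarith)

theorem exists_young (s : ℝ) (hs : 1 < s) {ε : ℝ} (hε : 0 < ε) :
    ∃ C : ℝ, 0 < C ∧ ∀ x y : ℝ, 0 ≤ x → 0 ≤ y → x * y ≤ ε * y ^ s + C * x ^ (s / (s - 1)) := by
  have hpq : s.HolderConjugate (s / (s - 1)) := Real.HolderConjugate.conjExponent hs
  have hs0 : 0 < s := by linarith
  have ht0 : 0 < s / (s - 1) := hpq.symm.pos
  -- With this δ, the term (δy)^s / s in Young's inequality for δy and x/δ is exactly ε y^s.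
  obtain ⟨δ, hδ, hδs⟩ : ∃ δ : ℝ, 0 < δ ∧ δ ^ s = ε * s :=
    ⟨(ε * s) ^ s⁻¹, Real.rpow_pos_of_pos (by positivity) _,
      Real.rpow_inv_rpow (by positivity) hs0.ne'⟩
  refine ⟨(δ⁻¹) ^ (s / (s - 1)) / (s / (s - 1)), by positivity, fun x y hx hy => ?_⟩
  have h := Real.young_inequality_of_nonneg (a := δ * y) (b := δ⁻¹ * x) (by positivity)
    (by positivity) hpq
  rw [Real.mul_rpow hδ.le hy, Real.mul_rpow (by positivity) hx, hδs] at h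
  calc x * y = δ * y * (δ⁻¹ * x) := by field_simp
    _ ≤ _ := h
    _ = _ := by field_simp

variable {N : ℕ} {α : Fin (N + 2) → ℝ}

theorem IsPowerVector.neg_one_lt (hα : IsPowerVector N α) (i : Fin (N + 2)) : -1 < α i :=
  hα.2.1.trans_le (hα.1.monotone (Fin.zero_le i))

theorem IsPowerVector.last_pos (hN : 1 ≤ N) (hα : IsPowerVector N α) :
    0 < α (Fin.last (N + 1)) := by
  rw [← hα.2.2]
  refine hα.1 ?_
  rw [Fin.lt_def]
  simp
  omega

theorem IsPowerVector.two_lt_sExp (hN : 1 ≤ N) (hα : IsPowerVector N α) : 2 < sExp α := by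
  have := hα.last_pos hN
  unfold sExp
  linarith

theorem IsPowerVector.rpow_le (hα : IsPowerVector N α) {R : ℝ} (hR : 0 < R) (i : Fin (N + 2)) :
    R ^ α i ≤ R ^ α 0 + 1 + R ^ α (Fin.last (N + 1)) := by
  have h0 := Real.rpow_nonneg hR.le (α 0)
  have h2 := Real.rpow_nonneg hR.le (α (Fin.last (N + 1)))
  rcases le_total R 1 with h | h
  · have : R ^ α i ≤ R ^ α 0 :=
      Real.rpow_le_rpow_of_exponent_ge hR h (hα.1.monotone (Fin.zero_le i))
    linarith
  · have : R ^ α i ≤ R ^ α (Fin.last (N + 1)) :=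
      Real.rpow_le_rpow_of_exponent_le h (hα.1.monotone (Fin.le_last i))
    linarith

/-- The growth of `F(z) z²`. -/
@[irreducible]
noncomputable def energyDensity (α : Fin (N + 2) → ℝ) (z : ℝ) : ℝ :=
  z ^ (α 0 + 2) + z ^ 2 + z ^ sExp α

theorem energyDensity_nonneg {z : ℝ} (hz : 0 ≤ z) : 0 ≤ energyDensity α z := by
  unfold energyDensity
  positivity

theorem rpow_sExp_le_energyDensity {z : ℝ} (hz : 0 ≤ z) : z ^ sExp α ≤ energyDensity α z := by
  have := Real.rpow_nonneg hz (α 0 + 2)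
  unfold energyDensity
  nlinarith [sq_nonneg z]

theorem measurable_energyDensity : Measurable (energyDensity α) := by
  unfold energyDensity
  fun_prop

/-- Valid at z = 0 as well, since the exponents α 0 + 2 and `sExp α` are nonzero. -/
theorem energyDensity_eq (hα : IsPowerVector N α) (hN : 1 ≤ N) {z : ℝ} (hz : 0 ≤ z) :
    energyDensity α z = (z ^ α 0 + 1 + z ^ α (Fin.last (N + 1))) * z ^ 2 := by
  have h0 := hα.neg_one_lt 0
  have h1 := hα.last_pos hN
  have e1 : z ^ (α 0 + 2) = z ^ α 0 * z ^ 2 := by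
    rw [Real.rpow_add' hz (by linarith)]; norm_num
  have e2 : z ^ sExp α = z ^ α (Fin.last (N + 1)) * z ^ 2 := by
    unfold sExp
    rw [Real.rpow_add' hz (by linarith)]; norm_num
  rw [energyDensity, e1, e2]
  ring

theorem rpow_le_one_add_rpow {x p q : ℝ} (hx : 0 ≤ x) (hp : 0 < p) (hpq : p ≤ q) :
    x ^ p ≤ 1 + x ^ q := by
  have := Real.rpow_nonneg hx q
  rcases le_total x 1 with h | h
  · linarith [Real.rpow_le_one hx h hp.le]
  · linarith [Real.rpow_le_rpow_of_exponent_le h hpq]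

theorem energyDensity_le (hα : IsPowerVector N α) {z : ℝ} (hz : 0 ≤ z) :
    energyDensity α z ≤ 3 * (1 + z ^ sExp α) := by
  have h0 := hα.neg_one_lt 0
  have hl0 := hα.1.monotone (Fin.zero_le (Fin.last (N + 1)))
  have hl1 := hα.1.monotone (Fin.le_last 1)
  rw [hα.2.2] at hl1
  have e1 := rpow_le_one_add_rpow hz (p := α 0 + 2) (q := sExp α) (by linarith)
    (by unfold sExp; linarith)
  have e2 := rpow_le_one_add_rpow hz (p := 2) (q := sExp α) (by norm_num)
    (by unfold sExp; linarith)
  rw [Real.rpow_two] at e2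
  unfold energyDensity
  linarith

/-- The condition 1 ≤ N makes the three indices distinct, so no term is counted twice. -/
theorem sum_special_le (hN : 1 ≤ N) {g : Fin (N + 2) → ℝ} (hg : ∀ i, 0 ≤ g i) :
    g 0 + g 1 + g (Fin.last (N + 1)) ≤ ∑ i, g i := by
  have h01 : (0 : Fin (N + 2)) ≠ 1 := by simp
  have h0l : (0 : Fin (N + 2)) ≠ Fin.last (N + 1) := by
    rw [Ne, Fin.ext_iff]; simp
  have h1l : (1 : Fin (N + 2)) ≠ Fin.last (N + 1) := by
    rw [Ne, Fin.ext_iff]; simp; omega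
  calc g 0 + g 1 + g (Fin.last (N + 1))
      = ∑ i ∈ ({0, 1, Fin.last (N + 1)} : Finset (Fin (N + 2))), g i := by
        rw [Finset.sum_insert (by simp [h0l]), Finset.sum_insert (by simp [h1l]),
          Finset.sum_singleton, add_assoc]
    _ ≤ _ := Finset.sum_le_sum_of_subset_of_nonneg (Finset.subset_univ _) fun i _ _ => hg i

/-- The bounds on the values of the coefficients at one point. -/
structure CoeffBound (aLo aHi : ℝ) (a : Fin (N + 2) → ℝ) : Prop where
  nonneg : ∀ i, 0 ≤ a i
  le_hi : ∀ i, a i ≤ aHi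
  lo_le : ∀ i, i = 0 ∨ i = 1 ∨ i = Fin.last (N + 1) → aLo ≤ a i

variable {aLo aHi : ℝ}

/-- The three terms whose coefficients are bounded below reproduce the three terms of
`energyDensity`; the others are nonnegative. -/
theorem CoeffBound.coercive (hα : IsPowerVector N α) (hN : 1 ≤ N) {a : Fin (N + 2) → ℝ}
    (ha : CoeffBound aLo aHi a) (v : E) :
    aLo * energyDensity α ‖v‖ ≤ inner ℝ (genPoly α a ‖v‖ • v) v := by
  have hz := norm_nonneg v
  rw [real_inner_smul_left, real_inner_self_eq_norm_sq, energyDensity_eq hα hN hz, ← mul_assoc]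
  refine mul_le_mul_of_nonneg_right ?_ (sq_nonneg _)
  have h := sum_special_le hN (g := fun i => a i * ‖v‖ ^ α i)
    fun i => mul_nonneg (ha.nonneg i) (Real.rpow_nonneg hz _)
  have e0 := mul_le_mul_of_nonneg_right (ha.lo_le 0 (by simp)) (Real.rpow_nonneg hz (α 0))
  have e1 := ha.lo_le 1 (by simp)
  have e2 := mul_le_mul_of_nonneg_right (ha.lo_le (Fin.last (N + 1)) (by simp))
    (Real.rpow_nonneg hz (α (Fin.last (N + 1))))
  simp only [hα.2.2, Real.rpow_zero, mul_one] at h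
  unfold genPoly
  linarith

/-- Supplies an integrable majorant for the flux tested with a field in L^s. -/
theorem CoeffBound.norm_inner_le (hα : IsPowerVector N α) {a : Fin (N + 2) → ℝ}
    (ha : CoeffBound aLo aHi a) (u w : E) :
    ‖inner ℝ (genPoly α a ‖u‖ • u) w‖ ≤
      (N + 2) * aHi * (1 + ‖u‖ ^ sExp α + ‖w‖ ^ sExp α) := by
  have hu := norm_nonneg u
  have hw := norm_nonneg w
  refine (norm_inner_le_norm _ _).trans ?_
  have hterm : ∀ i, a i * ‖u‖ ^ α i * ‖u‖ * ‖w‖ ≤ aHi * (1 + ‖u‖ ^ sExp α + ‖w‖ ^ sExp α) := by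
    intro i
    have hi := hα.neg_one_lt i
    have hs : α i + 2 ≤ sExp α := by
      have := hα.1.monotone (Fin.le_last i)
      unfold sExp; linarith
    set R := max ‖u‖ ‖w‖ with hR
    have hR0 : 0 ≤ R := hu.trans (le_max_left _ _)
    have h1 : ‖u‖ ^ α i * ‖u‖ * ‖w‖ ≤ R ^ (α i + 2) := by
      calc ‖u‖ ^ α i * ‖u‖ * ‖w‖ ≤ R ^ α i * R * R :=
            mul_le_mul (norm_rpow_mul_norm_le hi (le_max_left _ _)) (le_max_right _ _) hw
              (by positivity)
        _ = R ^ (α i + 2) := by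
            rw [Real.rpow_add' hR0 (by linarith), Real.rpow_two]; ring
    have h2 : R ^ (α i + 2) ≤ 1 + ‖u‖ ^ sExp α + ‖w‖ ^ sExp α := by
      refine (rpow_le_one_add_rpow hR0 (by linarith) hs).trans ?_
      have := Real.rpow_nonneg hu (sExp α)
      have := Real.rpow_nonneg hw (sExp α)
      rcases max_cases ‖u‖ ‖w‖ with ⟨h, _⟩ | ⟨h, _⟩ <;> rw [hR, h] <;> linarith
    calc a i * ‖u‖ ^ α i * ‖u‖ * ‖w‖ = a i * (‖u‖ ^ α i * ‖u‖ * ‖w‖) := by ring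
      _ ≤ aHi * (1 + ‖u‖ ^ sExp α + ‖w‖ ^ sExp α) :=
        mul_le_mul (ha.le_hi i) (h1.trans h2) (by positivity) ((ha.nonneg i).trans (ha.le_hi i))
  have hF : 0 ≤ genPoly α a ‖u‖ :=
    Finset.sum_nonneg fun i _ => mul_nonneg (ha.nonneg i) (Real.rpow_nonneg hu _)
  rw [norm_smul, Real.norm_of_nonneg hF, genPoly, Finset.sum_mul, Finset.sum_mul]
  refine (Finset.sum_le_sum fun i _ => hterm i).trans_eq ?_
  simp
  ring

/-- Strong monotonicity of the flux, with an error controlled by the variation of the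
coefficients. -/
theorem exists_flux_mono (hα : IsPowerVector N α) (hN : 1 ≤ N) (haLo : 0 < aLo) {b : ℝ}
    (hb : 0 ≤ b) :
    ∃ c C : ℝ, 0 < c ∧ 0 < C ∧ ∀ (h : ℝ) (a a' : Fin (N + 2) → ℝ), 0 ≤ h →
      CoeffBound aLo aHi a' → (∀ i, |a' i - a i| ≤ b * h) → ∀ u v : E,
      c * ‖u - v‖ ^ 2 ≤ inner ℝ (genPoly α a' ‖u‖ • u - genPoly α a ‖v‖ • v) (u - v) +
        C * h ^ 2 * (energyDensity α ‖u‖ + energyDensity α ‖v‖) := by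
  set c₀ := aLo * (min 1 (1 + α 0) / 2) with hc₀
  have hmin : 0 < min 1 (1 + α 0) := lt_min one_pos (by linarith [hα.2.1])
  have hc₀pos : 0 < c₀ := by positivity
  set K := (N + 2 : ℝ) * b with hK
  -- Half of c₀ is spent on the coefficient error; the + 1 keeps the second constant positive when b
  -- = 0.
  refine ⟨c₀ / 2, K ^ 2 / (2 * c₀) + 1, by positivity, by positivity,
    fun h a a' hh ha' hab u v => ?_⟩
  set R := max ‖u‖ ‖v‖ with hR
  have hE : 0 ≤ energyDensity α ‖u‖ + energyDensity α ‖v‖ :=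
    add_nonneg (energyDensity_nonneg (norm_nonneg _)) (energyDensity_nonneg (norm_nonneg _))
  -- The weight R ^ α 0 has a negative exponent, so R = 0 is treated apart.
  rcases (le_max_of_le_left (norm_nonneg u) : 0 ≤ R).eq_or_lt with hR0 | hR0
  · have hu : u = 0 := by
      rw [← norm_le_zero_iff, hR0]; exact le_max_left _ _
    have hv : v = 0 := by
      rw [← norm_le_zero_iff, hR0]; exact le_max_right _ _
    rw [hu, hv]
    simp only [norm_zero, sub_self, smul_zero, inner_zero_left, zero_add]
    rw [hu, hv, norm_zero] at hE
    have : 0 ≤ (K ^ 2 / (2 * c₀) + 1) * h ^ 2 := by positivity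
    simpa using mul_nonneg this hE
  set W := R ^ α 0 + 1 + R ^ α (Fin.last (N + 1)) with hW
  set X := ‖u - v‖ with hX
  have hX0 : 0 ≤ X := norm_nonneg _
  have hW1 : 1 ≤ W := by
    have := Real.rpow_nonneg hR0.le (α 0)
    have := Real.rpow_nonneg hR0.le (α (Fin.last (N + 1)))
    linarith
  -- The coefficients a' carry the monotone part, so only they need bounds; a' - a multiplies the
  -- powers of v.
  have hsplit : genPoly α a' ‖u‖ • u - genPoly α a ‖v‖ • v =
      ∑ i, (a' i • (‖u‖ ^ α i • u - ‖v‖ ^ α i • v) + (a' i - a i) • (‖v‖ ^ α i • v)) := by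
    simp only [genPoly, Finset.sum_smul]
    rw [← Finset.sum_sub_distrib]
    refine Finset.sum_congr rfl fun i _ => ?_
    module
  -- The smallest exponent α 0 has the worst monotonicity constant, which therefore serves for all
  -- i.
  have hmono : ∀ i, min 1 (1 + α 0) / 2 * R ^ α i * X ^ 2 ≤
      inner ℝ (‖u‖ ^ α i • u - ‖v‖ ^ α i • v) (u - v) := fun i =>
    le_trans (by
      have := hα.1.monotone (Fin.zero_le i)
      gcongr) (rpow_smul_strongMono (hα.neg_one_lt i) u v)
  have hmono0 : ∀ i, 0 ≤ inner ℝ (‖u‖ ^ α i • u - ‖v‖ ^ α i • v) (u - v) := fun i =>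
    le_trans (by positivity) (hmono i)
  have hgood : c₀ * W * X ^ 2 ≤
      ∑ i, a' i * inner ℝ (‖u‖ ^ α i • u - ‖v‖ ^ α i • v) (u - v) := by
    refine le_trans ?_ (sum_special_le hN fun i => mul_nonneg (ha'.nonneg i) (hmono0 i))
    have e : ∀ i, i = 0 ∨ i = 1 ∨ i = Fin.last (N + 1) →
        aLo * (min 1 (1 + α 0) / 2 * R ^ α i * X ^ 2) ≤
          a' i * inner ℝ (‖u‖ ^ α i • u - ‖v‖ ^ α i • v) (u - v) := fun i hi =>
      mul_le_mul (ha'.lo_le i hi) (hmono i) (by positivity) (ha'.nonneg i)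
    have e0 := e 0 (by simp)
    have e1 := e 1 (by simp)
    have e2 := e (Fin.last (N + 1)) (by simp)
    have h1 : R ^ α 1 = 1 := by rw [hα.2.2, Real.rpow_zero]
    rw [h1] at e1
    rw [hW, hc₀]
    linarith
  have hbad : -(K * h * W * R * X) ≤ ∑ i, (a' i - a i) * inner ℝ (‖v‖ ^ α i • v) (u - v) := by
    have e : ∀ i, -(b * h * (W * R) * X) ≤
        (a' i - a i) * inner ℝ (‖v‖ ^ α i • v) (u - v) := by
      intro i
      refine neg_le_of_neg_le ?_
      refine (neg_le_abs _).trans ?_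
      rw [abs_mul, mul_assoc (b * h)]
      refine mul_le_mul (hab i) ?_ (abs_nonneg _) (by positivity)
      refine (abs_real_inner_le_norm _ _).trans (mul_le_mul_of_nonneg_right ?_ hX0)
      rw [norm_smul, Real.norm_of_nonneg (Real.rpow_nonneg (norm_nonneg v) _)]
      refine (norm_rpow_mul_norm_le (hα.neg_one_lt i) (le_max_right _ _ : ‖v‖ ≤ R)).trans ?_
      exact mul_le_mul_of_nonneg_right (hα.rpow_le hR0 i) hR0.le
    refine le_trans (le_of_eq ?_) (Finset.sum_le_sum fun i _ => e i)
    simp [hK]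
    ring
  have hWR : W * R ^ 2 ≤ energyDensity α ‖u‖ + energyDensity α ‖v‖ := by
    rw [hW, ← energyDensity_eq hα hN hR0.le]
    have h1 := energyDensity_nonneg (α := α) (norm_nonneg u)
    have h2 := energyDensity_nonneg (α := α) (norm_nonneg v)
    rcases max_cases ‖u‖ ‖v‖ with ⟨h, _⟩ | ⟨h, _⟩ <;> rw [h] <;> linarith
  rw [hsplit, sum_inner]
  simp only [inner_add_left, real_inner_smul_left _ _ (a' _),
    real_inner_smul_left _ _ (a' _ - a _), Finset.sum_add_distrib]
  -- The error carries the same weight W as the monotone part, so a weighted Young inequality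
  -- absorbs it; the remainder W R² is an energy density at R. The summand 1 of W, due to a₀, then
  -- leaves the unweighted square X².
  have hyoung : K * h * W * R * X ≤ c₀ / 2 * W * X ^ 2 + K ^ 2 / (2 * c₀) * h ^ 2 * (W * R ^ 2) := by
    have : c₀ / 2 * W * X ^ 2 + K ^ 2 / (2 * c₀) * h ^ 2 * (W * R ^ 2) - K * h * W * R * X =
        W / (2 * c₀) * (c₀ * X - K * h * R) ^ 2 := by
      field_simp
      ring
    have : 0 ≤ W / (2 * c₀) * (c₀ * X - K * h * R) ^ 2 := by positivity
    linarith
  have h1 : c₀ / 2 * X ^ 2 ≤ c₀ / 2 * W * X ^ 2 := by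
    nlinarith [mul_nonneg hc₀pos.le (mul_nonneg (sub_nonneg.2 hW1) (sq_nonneg X))]
  have h2 : K ^ 2 / (2 * c₀) * h ^ 2 * (W * R ^ 2) ≤ (K ^ 2 / (2 * c₀) + 1) * h ^ 2 *
      (energyDensity α ‖u‖ + energyDensity α ‖v‖) := by
    refine mul_le_mul ?_ hWR (by positivity) (by positivity)
    nlinarith [sq_nonneg h]
  linarith

end Pointwise


/-! ### The energy identity for functions that are absolutely continuous in time -/

section Energy

variable {X : Type*} [MeasurableSpace X] {μ : Measure X}

/-- For almost every `x` the path `t ↦ u t x` is absolutely continuous on `[0, S]` with derivative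
`u' t x`. -/
def HasPathDeriv {E : Type*} [NormedAddCommGroup E] [NormedSpace ℝ E] (μ : Measure X) (S : ℝ)
    (u u' : ℝ → X → E) : Prop :=
  ∀ᵐ x ∂μ, IntervalIntegrable (fun t => u' t x) volume 0 S ∧
    ∀ t ∈ Icc (0 : ℝ) S, u t x = u 0 x + ∫ τ in (0 : ℝ)..t, u' τ x

theorem enorm_sq_eq_ofReal (x : ℝ) : ‖x‖ₑ ^ 2 = ENNReal.ofReal (x ^ 2) := by
  rw [← ofReal_norm, ← ENNReal.ofReal_pow (norm_nonneg x), Real.norm_eq_abs, sq_abs]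

theorem add_sq_le_ennreal (a b : ℝ≥0∞) : (a + b) ^ 2 ≤ 2 * (a ^ 2 + b ^ 2) := by
  have h := ENNReal.rpow_add_le_mul_rpow_add_rpow a b (p := 2) (by norm_num)
  norm_num at h
  simpa using h

/-- Minkowski's integral inequality in `L²`. -/
theorem lintegral_sq_lintegral_le {Y : Type*} [MeasurableSpace Y] {ν : Measure Y} [SFinite μ]
    [SFinite ν] {g : Y → X → ℝ≥0∞} (hg : Measurable (Function.uncurry g)) :
    ∫⁻ x, (∫⁻ t, g t x ∂ν) ^ 2 ∂μ ≤ (∫⁻ t, (∫⁻ x, g t x ^ 2 ∂μ) ^ (1 / 2 : ℝ) ∂ν) ^ 2 := by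
  have hgt : ∀ t, Measurable (g t) := fun t => hg.of_uncurry_left
  have hgx : ∀ x, Measurable fun t => g t x := fun x => hg.of_uncurry_right
  -- The square becomes a double time integral; Tonelli moves the x-integral inside, where
  -- Cauchy–Schwarz separates t and r.
  have e1 : ∀ x, (∫⁻ t, g t x ∂ν) ^ 2 = ∫⁻ t, ∫⁻ r, g t x * g r x ∂ν ∂ν := by
    intro x
    simp_rw [lintegral_const_mul _ (hgx x)]
    rw [lintegral_mul_const _ (hgx x), sq]
  have hm : Measurable fun t => (∫⁻ x, g t x ^ 2 ∂μ) ^ (1 / 2 : ℝ) :=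
    ((hg.pow_const 2).lintegral_prod_right').pow_const _
  have m3 : Measurable fun p : (X × Y) × Y => g p.1.2 p.1.1 * g p.2 p.1.1 :=
    (hg.comp ((measurable_snd.comp measurable_fst).prodMk (measurable_fst.comp measurable_fst))).mul
      (hg.comp (measurable_snd.prodMk (measurable_fst.comp measurable_fst)))
  have m4 : ∀ t, Measurable (Function.uncurry fun x r => g t x * g r x) := fun t =>
    (hg.comp (measurable_const.prodMk measurable_fst)).mul
      (hg.comp (measurable_snd.prodMk measurable_fst))
  calc ∫⁻ x, (∫⁻ t, g t x ∂ν) ^ 2 ∂μ = ∫⁻ x, ∫⁻ t, ∫⁻ r, g t x * g r x ∂ν ∂ν ∂μ :=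
        lintegral_congr e1
    _ = ∫⁻ t, ∫⁻ x, ∫⁻ r, g t x * g r x ∂ν ∂μ ∂ν :=
        lintegral_lintegral_swap m3.lintegral_prod_right'.aemeasurable
    _ = ∫⁻ t, ∫⁻ r, ∫⁻ x, g t x * g r x ∂μ ∂ν ∂ν :=
        lintegral_congr fun t => lintegral_lintegral_swap (m4 t).aemeasurable
    _ ≤ ∫⁻ t, ∫⁻ r, (∫⁻ x, g t x ^ 2 ∂μ) ^ (1 / 2 : ℝ) *
          (∫⁻ x, g r x ^ 2 ∂μ) ^ (1 / 2 : ℝ) ∂ν ∂ν := by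
        refine lintegral_mono fun t => lintegral_mono fun r => ?_
        have := ENNReal.lintegral_mul_le_Lp_mul_Lq μ Real.HolderConjugate.two_two
          (hgt t).aemeasurable (hgt r).aemeasurable
        simpa using this
    _ = _ := by
        simp_rw [lintegral_const_mul _ hm]
        rw [lintegral_mul_const _ hm, sq]

variable {w wt : ℝ → X → ℝ} {S : ℝ}

/-- A bound for `w` on `[0, S]` that is uniform in time. -/
noncomputable def pathBound (S : ℝ) (w wt : ℝ → X → ℝ) (x : X) : ℝ≥0∞ :=
  ‖w 0 x‖ₑ + ∫⁻ t in Icc 0 S, ‖wt t x‖ₑ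

theorem enorm_le_pathBound (h : HasPathDeriv μ S w wt) :
    ∀ᵐ x ∂μ, ∀ t ∈ Icc (0 : ℝ) S, ‖w t x‖ₑ ≤ pathBound S w wt x := by
  filter_upwards [h] with x hx t ht
  rw [hx.2 t ht, intervalIntegral.integral_of_le ht.1]
  refine (enorm_add_le _ _).trans (add_le_add le_rfl ?_)
  refine (enorm_integral_le_lintegral_enorm _).trans (lintegral_mono_set ?_)
  exact fun τ hτ => ⟨hτ.1.le, hτ.2.trans ht.2⟩

theorem lintegral_pathBound_sq_lt_top (hw : Measurable (Function.uncurry w))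
    (h0 : ∫⁻ x, ‖w 0 x‖ₑ ^ 2 ∂μ < ⊤) (h1 : ∫⁻ x, (∫⁻ t in Icc 0 S, ‖wt t x‖ₑ) ^ 2 ∂μ < ⊤) :
    ∫⁻ x, pathBound S w wt x ^ 2 ∂μ < ⊤ := by
  refine (lintegral_mono fun x => add_sq_le_ennreal _ _).trans_lt ?_
  rw [lintegral_const_mul' _ _ (by simp),
    lintegral_add_left (hw.of_uncurry_left.enorm.pow_const 2)]
  exact ENNReal.mul_lt_top (by simp) (ENNReal.add_lt_top.2 ⟨h0, h1⟩)

theorem lintegral_enorm_sq_le_pathBound (h : HasPathDeriv μ S w wt) {t : ℝ}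
    (ht : t ∈ Icc 0 S) : ∫⁻ x, ‖w t x‖ₑ ^ 2 ∂μ ≤ ∫⁻ x, pathBound S w wt x ^ 2 ∂μ := by
  refine lintegral_mono_ae ?_
  filter_upwards [enorm_le_pathBound h] with x hx
  gcongr
  exact hx t ht

/-- Integration by parts for an absolutely continuous function against itself. -/
theorem sq_eq_of_timeDeriv {u u' : ℝ → ℝ} {S : ℝ} (hi : IntervalIntegrable u' volume 0 S)
    (hu : ∀ t ∈ Icc (0 : ℝ) S, u t = u 0 + ∫ τ in (0 : ℝ)..t, u' τ) {t : ℝ} (ht : t ∈ Icc 0 S) :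
    u t ^ 2 = u 0 ^ 2 + 2 * ∫ τ in (0 : ℝ)..t, u' τ * u τ := by
  have hit : IntervalIntegrable u' volume 0 t :=
    hi.mono_set (by rw [uIcc_of_le ht.1, uIcc_of_le (ht.1.trans ht.2)]; exact Icc_subset_Icc_right ht.2)
  -- The primitive v agrees with u on [0, t] but is defined on all of ℝ; u is unconstrained outside
  -- [0, S].
  set v : ℝ → ℝ := fun r => u 0 + ∫ τ in (0 : ℝ)..r, u' τ with hv
  have hac0 := hit.absolutelyContinuousOnInterval_intervalIntegral (c := 0) (by simp)
  have hac : AbsolutelyContinuousOnInterval v 0 t := by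
    have hc : AbsolutelyContinuousOnInterval (fun _ : ℝ => u 0) 0 t :=
      ((LipschitzWith.const (u 0)).lipschitzOnWith (s := uIcc 0 t)).absolutelyContinuousOnInterval
    exact hc.add hac0
  have h := hac.integral_deriv_mul_eq_sub hac
  have hd : ∀ᵐ r, r ∈ uIoc 0 t → deriv v r * v r + v r * deriv v r = 2 * (u' r * u r) := by
    filter_upwards [hit.ae_hasDerivAt_integral] with r hr hrt
    have hr1 : HasDerivAt v (u' r) r :=
      (hr (uIoc_subset_uIcc hrt) 0 (by simp)).const_add _
    rw [uIoc_of_le ht.1] at hrt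
    rw [hr1.deriv, hu r ⟨hrt.1.le, hrt.2.trans ht.2⟩]
    simp only [hv]
    ring
  rw [intervalIntegral.integral_congr_ae hd, intervalIntegral.integral_const_mul] at h
  have h0 : v 0 = u 0 := by simp [hv]
  have h1 : v t = u t := (hu t ht).symm
  rw [h, h0, h1]
  ring

theorem memLp_two_of_lintegral {u : X → ℝ} (hu : Measurable u) (h : ∫⁻ x, ‖u x‖ₑ ^ 2 ∂μ < ⊤) :
    MemLp u 2 μ := by
  refine ⟨hu.aestronglyMeasurable, ?_⟩
  rw [eLpNorm_lt_top_iff_lintegral_rpow_enorm_lt_top (by norm_num) (by norm_num)]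
  simpa using h

theorem ofReal_integral_sq {u : X → ℝ} (hu : Measurable u) (h : ∫⁻ x, ‖u x‖ₑ ^ 2 ∂μ < ⊤) :
    ENNReal.ofReal (∫ x, u x ^ 2 ∂μ) = ∫⁻ x, ‖u x‖ₑ ^ 2 ∂μ := by
  rw [ofReal_integral_eq_lintegral_ofReal (memLp_two_of_lintegral hu h).integrable_sq
    (ae_of_all _ fun x => sq_nonneg _)]
  simp_rw [enorm_sq_eq_ofReal]

variable [SFinite μ] {φ : X → ℝ} {φLo φHi : ℝ}

/-- For fixed x the time integral is at most φHi times the square of `pathBound`. Thus wt need only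
lie in L²(X; L¹) and not in L² in time. -/
theorem integrable_weight_deriv_mul (hw : Measurable (Function.uncurry w))
    (hwt : Measurable (Function.uncurry wt)) (hφ : Measurable φ) (hφb : ∀ᵐ x ∂μ, |φ x| ≤ φHi)
    (h : HasPathDeriv μ S w wt)
    (h0 : ∫⁻ x, ‖w 0 x‖ₑ ^ 2 ∂μ < ⊤) (h1 : ∫⁻ x, (∫⁻ t in Icc 0 S, ‖wt t x‖ₑ) ^ 2 ∂μ < ⊤) :
    Integrable (Function.uncurry fun t x => φ x * wt t x * w t x)
      ((volume.restrict (Icc 0 S)).prod μ) := by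
  have hm : Measurable (Function.uncurry fun t x => φ x * wt t x * w t x) :=
    ((hφ.comp measurable_snd).mul hwt).mul hw
  refine ⟨hm.aestronglyMeasurable, ?_⟩
  rw [hasFiniteIntegral_iff_enorm, lintegral_prod_symm _ hm.enorm.aemeasurable]
  calc ∫⁻ x, (∫⁻ t in Icc 0 S, ‖φ x * wt t x * w t x‖ₑ) ∂μ
      ≤ ∫⁻ x, ENNReal.ofReal φHi * pathBound S w wt x ^ 2 ∂μ := by
        refine lintegral_mono_ae ?_
        filter_upwards [enorm_le_pathBound h, hφb] with x hx hφx
        calc ∫⁻ t in Icc 0 S, ‖φ x * wt t x * w t x‖ₑ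
            ≤ ∫⁻ t in Icc 0 S, ENNReal.ofReal φHi * pathBound S w wt x * ‖wt t x‖ₑ := by
              refine setLIntegral_mono' measurableSet_Icc fun t ht => ?_
              rw [enorm_mul, enorm_mul, mul_right_comm]
              gcongr
              · rw [← ofReal_norm]
                exact ENNReal.ofReal_le_ofReal hφx
              · exact hx t ht
          _ = ENNReal.ofReal φHi * pathBound S w wt x * ∫⁻ t in Icc 0 S, ‖wt t x‖ₑ :=
              lintegral_const_mul _ hwt.of_uncurry_right.enorm
          _ ≤ _ := by
              rw [sq, mul_assoc]
              gcongr
              exact le_add_self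
    _ < ⊤ := by
        rw [lintegral_const_mul' _ _ (by simp)]
        exact ENNReal.mul_lt_top (by simp) (lintegral_pathBound_sq_lt_top hw h0 h1)

/-- The pathwise identity `sq_eq_of_timeDeriv`, integrated over x with Fubini. -/
theorem integral_weight_sq_eq (hw : Measurable (Function.uncurry w))
    (hwt : Measurable (Function.uncurry wt)) (hφ : Measurable φ) (hφb : ∀ᵐ x ∂μ, |φ x| ≤ φHi)
    (h : HasPathDeriv μ S w wt)
    (h0 : ∫⁻ x, ‖w 0 x‖ₑ ^ 2 ∂μ < ⊤) (h1 : ∫⁻ x, (∫⁻ t in Icc 0 S, ‖wt t x‖ₑ) ^ 2 ∂μ < ⊤)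
    {t : ℝ} (ht : t ∈ Icc 0 S) :
    ∫ x, φ x * w t x ^ 2 ∂μ = ∫ x, φ x * w 0 x ^ 2 ∂μ +
      2 * ∫ τ in Icc 0 t, ∫ x, φ x * wt τ x * w τ x ∂μ := by
  have hint := integrable_weight_deriv_mul hw hwt hφ hφb h h0 h1
  have hint' : Integrable (Function.uncurry fun t x => φ x * wt t x * w t x)
      ((volume.restrict (Icc 0 t)).prod μ) := by
    refine hint.mono_measure ?_
    exact Measure.prod_mono (Measure.restrict_mono (Icc_subset_Icc_right ht.2) le_rfl) le_rfl
  rw [integral_integral_swap hint', ← integral_const_mul, ← integral_add]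
  · refine integral_congr_ae ?_
    filter_upwards [h] with x hx
    rw [sq_eq_of_timeDeriv hx.1 hx.2 ht, intervalIntegral.integral_of_le ht.1,
      ← integral_Icc_eq_integral_Ioc]
    simp_rw [mul_assoc (φ x)]
    rw [integral_const_mul]
    ring
  · refine ⟨(hφ.mul (hw.of_uncurry_left.pow_const 2)).aestronglyMeasurable, ?_⟩
    rw [hasFiniteIntegral_iff_enorm]
    refine lt_of_le_of_lt (b := ∫⁻ x, ENNReal.ofReal φHi * ‖w 0 x‖ₑ ^ 2 ∂μ)
      (lintegral_mono_ae ?_) ?_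
    · filter_upwards [hφb] with x hφx
      rw [enorm_mul, enorm_pow]
      gcongr
      rw [← ofReal_norm]
      exact ENNReal.ofReal_le_ofReal hφx
    · rw [lintegral_const_mul' _ _ (by simp)]
      exact ENNReal.mul_lt_top (by simp) h0
  · exact (hint'.integral_prod_right).const_mul 2

/-- The energy estimate. The bound of the source term uses the supremum in time of the energy
itself, which the left-hand side absorbs. -/
theorem exists_energy_bound (hφLo : 0 < φLo) (φHi : ℝ) {T : ℝ} (hT : 0 < T) :
    ∃ C : ℝ, 0 < C ∧ ∀ (φ : X → ℝ) (S : ℝ) (w wt g : ℝ → X → ℝ) (e p : ℝ → ℝ), 0 ≤ S → S ≤ T →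
      Measurable φ → (∀ᵐ x ∂μ, φLo ≤ φ x ∧ φ x ≤ φHi) →
      Measurable (Function.uncurry w) → Measurable (Function.uncurry wt) →
      Measurable (Function.uncurry g) → HasPathDeriv μ S w wt →
      ∫⁻ x, ‖w 0 x‖ₑ ^ 2 ∂μ < ⊤ → ∫⁻ x, (∫⁻ t in Icc 0 S, ‖wt t x‖ₑ) ^ 2 ∂μ < ⊤ →
      ∫⁻ t in Icc 0 S, ∫⁻ x, ‖g t x‖ₑ ^ 2 ∂μ < ⊤ →
      (∀ t, 0 ≤ e t) → (∀ t, 0 ≤ p t) → Integrable p (volume.restrict (Icc 0 S)) →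
      (∀ᵐ t ∂(volume.restrict (Icc 0 S)), e t + ∫ x, φ x * wt t x * w t x ∂μ ≤
        ∫ x, g t x * w t x ∂μ + p t) →
      (∀ t ∈ Icc 0 S, ∫⁻ x, ‖w t x‖ₑ ^ 2 ∂μ ≤ ENNReal.ofReal C *
        (∫⁻ x, ‖w 0 x‖ₑ ^ 2 ∂μ + (∫⁻ t in Icc 0 S, ∫⁻ x, ‖g t x‖ₑ ^ 2 ∂μ) +
          ∫⁻ t in Icc 0 S, ENNReal.ofReal (p t))) ∧
      ∫⁻ t in Icc 0 S, ENNReal.ofReal (e t) ≤ ENNReal.ofReal C *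
        (∫⁻ x, ‖w 0 x‖ₑ ^ 2 ∂μ + (∫⁻ t in Icc 0 S, ∫⁻ x, ‖g t x‖ₑ ^ 2 ∂μ) +
          ∫⁻ t in Icc 0 S, ENNReal.ofReal (p t)) := by
  -- The summands pay for the initial energy, the source and p. K does not depend on S, so the
  -- estimate is uniform over the shortened intervals [0, T - k].
  set K := |φHi| + 2 * T / φLo + 2 with hK
  have hK0 : 0 < K := by positivity
  refine ⟨2 / φLo * K + K, by positivity, ?_⟩
  intro φ S w wt g e p hS hST hφ hφb hw hwt hg hder h0 h1 hg2 he hp hpi hineq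
  have hφabs : ∀ᵐ x ∂μ, |φ x| ≤ |φHi| := by
    filter_upwards [hφb] with x hx
    rw [abs_of_pos (hφLo.trans_le hx.1)]
    exact hx.2.trans (le_abs_self _)
  have hwm : ∀ t, Measurable (w t) := fun t => hw.of_uncurry_left
  have hR := lintegral_pathBound_sq_lt_top hw h0 h1
  have hwfin : ∀ t ∈ Icc 0 S, ∫⁻ x, ‖w t x‖ₑ ^ 2 ∂μ < ⊤ := fun t ht =>
    (lintegral_enorm_sq_le_pathBound hder ht).trans_lt hR
  set y : ℝ → ℝ := fun t => ∫ x, w t x ^ 2 ∂μ with hy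
  have hy0 : ∀ t, 0 ≤ y t := fun t => integral_nonneg fun x => sq_nonneg _
  have hyR : ∀ t ∈ Icc 0 S, y t ≤ (∫⁻ x, pathBound S w wt x ^ 2 ∂μ).toReal := by
    intro t ht
    rw [← ENNReal.ofReal_le_iff_le_toReal hR.ne, ofReal_integral_sq (hwm t) (hwfin t ht)]
    exact lintegral_enorm_sq_le_pathBound hder ht
  have hbdd : BddAbove (y '' Icc 0 S) := ⟨_, by rintro _ ⟨t, ht, rfl⟩; exact hyR t ht⟩
  -- The supremum is finite by `pathBound`, so it may be absorbed.
  set M := sSup (y '' Icc 0 S) with hM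
  have hyM : ∀ t ∈ Icc 0 S, y t ≤ M := fun t ht => le_csSup hbdd (mem_image_of_mem _ ht)
  have h0S : (0 : ℝ) ∈ Icc 0 S := ⟨le_rfl, hS⟩
  have hM0 : 0 ≤ M := (hy0 0).trans (hyM 0 h0S)
  set k : ℝ → ℝ := fun t => ∫ x, φ x * wt t x * w t x ∂μ with hk
  have hki : Integrable k (volume.restrict (Icc 0 S)) :=
    (integrable_weight_deriv_mul hw hwt hφ hφabs hder h0 h1).integral_prod_left
  have hid : ∀ t ∈ Icc 0 S, ∫ x, φ x * w t x ^ 2 ∂μ = ∫ x, φ x * w 0 x ^ 2 ∂μ +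
      2 * ∫ τ in Icc 0 t, k τ := fun t ht =>
    integral_weight_sq_eq hw hwt hφ hφabs hder h0 h1 ht
  have hwsq : ∀ t ∈ Icc 0 S, Integrable (fun x => w t x ^ 2) μ := fun t ht =>
    (memLp_two_of_lintegral (hwm t) (hwfin t ht)).integrable_sq
  have hφw : ∀ t ∈ Icc 0 S, Integrable (fun x => φ x * w t x ^ 2) μ := fun t ht =>
    (hwsq t ht).bdd_mul hφ.aestronglyMeasurable
      (by filter_upwards [hφabs] with x hx using hx)
  have hlow : ∀ t ∈ Icc 0 S, φLo * y t ≤ ∫ x, φ x * w t x ^ 2 ∂μ := by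
    intro t ht
    rw [hy, ← integral_const_mul]
    refine integral_mono_ae ((hwsq t ht).const_mul _) (hφw t ht) ?_
    filter_upwards [hφb] with x hx
    exact mul_le_mul_of_nonneg_right hx.1 (sq_nonneg _)
  have hup : ∫ x, φ x * w 0 x ^ 2 ∂μ ≤ |φHi| * y 0 := by
    rw [hy, ← integral_const_mul]
    refine integral_mono_ae (hφw 0 h0S) ((hwsq 0 h0S).const_mul _) ?_
    filter_upwards [hφb] with x hx
    exact mul_le_mul_of_nonneg_right (hx.2.trans (le_abs_self _)) (sq_nonneg _)
  set γ : ℝ → ℝ := fun t => ∫ x, g t x ^ 2 ∂μ with hγ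
  have hgm : Measurable fun t => ∫⁻ x, ‖g t x‖ₑ ^ 2 ∂μ :=
    (hg.enorm.pow_const 2).lintegral_prod_right'
  have hgfin := ae_lt_top hgm hg2.ne
  have hγe : ∀ᵐ t ∂(volume.restrict (Icc 0 S)),
      ENNReal.ofReal (γ t) = ∫⁻ x, ‖g t x‖ₑ ^ 2 ∂μ := by
    filter_upwards [hgfin] with t ht using ofReal_integral_sq hg.of_uncurry_left ht
  have hγ0 : ∀ t, 0 ≤ γ t := fun t => integral_nonneg fun x => sq_nonneg _
  have hγi : Integrable γ (volume.restrict (Icc 0 S)) := by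
    refine ⟨((hg.pow_const 2).stronglyMeasurable.integral_prod_right').aestronglyMeasurable, ?_⟩
    rw [hasFiniteIntegral_iff_ofReal (ae_of_all _ hγ0), lintegral_congr_ae hγe]
    exact hg2
  set Γ := ∫ t in Icc 0 S, γ t with hΓ
  set P := ∫ t in Icc 0 S, p t with hP
  have hΓ0 : 0 ≤ Γ := integral_nonneg hγ0
  have hP0 : 0 ≤ P := integral_nonneg hp
  -- Integrated over [0, S], ε M costs at most φLo M / 4. The energy identity doubles this, and half
  -- of φLo M survives on the left.
  set ε := φLo / (4 * T) with hε
  have hε0 : 0 < ε := by positivity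
  have hsrc : ∀ᵐ t ∂(volume.restrict (Icc 0 S)),
      ∫ x, g t x * w t x ∂μ ≤ ε * M + (4 * ε)⁻¹ * γ t := by
    filter_upwards [hgfin, ae_restrict_mem measurableSet_Icc] with t ht htS
    have hg1 := (memLp_two_of_lintegral hg.of_uncurry_left ht)
    have hw1 := memLp_two_of_lintegral (hwm t) (hwfin t htS)
    calc ∫ x, g t x * w t x ∂μ ≤ ∫ x, (ε * w t x ^ 2 + (4 * ε)⁻¹ * g t x ^ 2) ∂μ := by
          refine integral_mono (hg1.integrable_mul hw1)
            ((hw1.integrable_sq.const_mul _).add (hg1.integrable_sq.const_mul _)) fun x => ?_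
          have : ε * w t x ^ 2 + (4 * ε)⁻¹ * g t x ^ 2 - g t x * w t x =
              ε * (w t x - (2 * ε)⁻¹ * g t x) ^ 2 := by
            field_simp
            ring
          have h2 : 0 ≤ ε * (w t x - (2 * ε)⁻¹ * g t x) ^ 2 := by positivity
          simp only
          linarith
      _ = ε * y t + (4 * ε)⁻¹ * γ t := by
          rw [integral_add (hw1.integrable_sq.const_mul _) (hg1.integrable_sq.const_mul _),
            integral_const_mul, integral_const_mul]
      _ ≤ _ := by
          gcongr
          exact hyM t htS
  set H : ℝ → ℝ := fun t => ε * M + (4 * ε)⁻¹ * γ t + p t with hH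
  have hHi : Integrable H (volume.restrict (Icc 0 S)) :=
    ((integrable_const _).add (hγi.const_mul _)).add hpi
  have hH0 : ∀ t, 0 ≤ H t := fun t => by
    have := hγ0 t
    have := hp t
    positivity
  have hHint : ∫ t in Icc 0 S, H t ≤ φLo * M / 4 + T / φLo * Γ + P := by
    have : ∫ t in Icc 0 S, H t = S * (ε * M) + (4 * ε)⁻¹ * Γ + P := by
      have e1 : ∫ t in Icc 0 S, H t = (∫ t in Icc 0 S, (ε * M + (4 * ε)⁻¹ * γ t)) + P :=
        integral_add ((integrable_const _).add (hγi.const_mul _)) hpi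
      rw [e1, integral_add (integrable_const _) (hγi.const_mul _),
        integral_const_mul (4 * ε)⁻¹, setIntegral_const, Real.volume_real_Icc_of_le hS, sub_zero,
        smul_eq_mul]
    rw [this, hε]
    have e1 : S * (φLo / (4 * T) * M) ≤ φLo * M / 4 := by
      rw [show φLo * M / 4 = T * (φLo / (4 * T) * M) by field_simp]
      gcongr
    have e2 : (4 * (φLo / (4 * T)))⁻¹ = T / φLo := by field_simp
    rw [e2]
    linarith
  have hkH : ∀ᵐ t ∂(volume.restrict (Icc 0 S)), e t ≤ H t - k t := by
    filter_upwards [hineq, hsrc] with t h1 h2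
    simp only [hH, hk]
    linarith
  have hMle : φLo * M ≤ |φHi| * y 0 + 2 * (φLo * M / 4 + T / φLo * Γ + P) := by
    have : M ≤ (|φHi| * y 0 + 2 * (φLo * M / 4 + T / φLo * Γ + P)) / φLo := by
      refine csSup_le ⟨_, mem_image_of_mem _ h0S⟩ ?_
      rintro _ ⟨t, ht, rfl⟩
      rw [le_div_iff₀' hφLo]
      -- Since e ≥ 0, k ≤ H almost everywhere; since H ≥ 0, its integral over [0, t] may be extended
      -- to [0, S].
      have hsub : Icc 0 t ⊆ Icc 0 S := Icc_subset_Icc_right ht.2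
      have hkt : ∫ τ in Icc 0 t, k τ ≤ ∫ τ in Icc 0 S, H τ := by
        refine (setIntegral_mono_ae_restrict (IntegrableOn.mono_set hki hsub)
          (IntegrableOn.mono_set hHi hsub) ?_).trans
          (setIntegral_mono_set hHi (ae_of_all _ hH0) hsub.eventuallyLE)
        refine ae_restrict_of_ae_restrict_of_subset hsub ?_
        filter_upwards [hkH] with τ hτ
        linarith [he τ]
      linarith [hlow t ht, hid t ht, hup]
    rwa [le_div_iff₀' hφLo] at this
  set B := K * (y 0 + Γ + P) with hB
  have hB0 : 0 ≤ B := mul_nonneg hK0.le (by linarith [hy0 0])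
  have hbase : |φHi| * y 0 + 2 * (T / φLo * Γ + P) ≤ B := by
    have a1 : 0 ≤ 2 * T / φLo := by positivity
    have a2 := abs_nonneg φHi
    have e1 : |φHi| * y 0 ≤ K * y 0 := mul_le_mul_of_nonneg_right (by linarith) (hy0 0)
    have e2 : 2 * T / φLo * Γ ≤ K * Γ := mul_le_mul_of_nonneg_right (by linarith) hΓ0
    have e3 : 2 * P ≤ K * P := mul_le_mul_of_nonneg_right (by linarith) hP0
    have e4 : 2 * (T / φLo * Γ) = 2 * T / φLo * Γ := by ring
    rw [hB, mul_add, mul_add]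
    linarith
  have hMB : M ≤ 2 / φLo * B := by
    rw [div_mul_eq_mul_div, le_div_iff₀' hφLo]
    linarith
  have hdata : ENNReal.ofReal (y 0 + Γ + P) = ∫⁻ x, ‖w 0 x‖ₑ ^ 2 ∂μ +
      (∫⁻ t in Icc 0 S, ∫⁻ x, ‖g t x‖ₑ ^ 2 ∂μ) + ∫⁻ t in Icc 0 S, ENNReal.ofReal (p t) := by
    rw [ENNReal.ofReal_add (by linarith [hy0 0]) hP0, ENNReal.ofReal_add (hy0 0) hΓ0,
      ofReal_integral_sq (hwm 0) h0, ofReal_integral_eq_lintegral_ofReal hγi (ae_of_all _ hγ0),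
      ofReal_integral_eq_lintegral_ofReal hpi (ae_of_all _ hp), lintegral_congr_ae hγe]
  rw [← hdata, ← ENNReal.ofReal_mul (by positivity)]
  have hfinal : (2 / φLo * K + K) * (y 0 + Γ + P) = 2 / φLo * B + B := by rw [hB]; ring
  have h2B : 0 ≤ 2 / φLo * B := by positivity
  constructor
  · intro t ht
    rw [← ofReal_integral_sq (hwm t) (hwfin t ht)]
    refine ENNReal.ofReal_le_ofReal ?_
    rw [hfinal]
    have := hyM t ht
    simp only [hy] at this
    linarith
  · have hSS : S ∈ Icc 0 S := ⟨hS, le_rfl⟩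
    calc ∫⁻ t in Icc 0 S, ENNReal.ofReal (e t)
        ≤ ∫⁻ t in Icc 0 S, ENNReal.ofReal (H t - k t) := by
          refine lintegral_mono_ae ?_
          filter_upwards [hkH] with t ht using ENNReal.ofReal_le_ofReal ht
      _ = ENNReal.ofReal (∫ t in Icc 0 S, (H t - k t)) := by
          refine (ofReal_integral_eq_lintegral_ofReal (hHi.sub hki) ?_).symm
          filter_upwards [hkH] with t ht using (he t).trans ht
      _ ≤ _ := by
          refine ENNReal.ofReal_le_ofReal ?_
          rw [hfinal, integral_sub hHi hki]
          -- As the final energy is nonnegative, -∫ k is at most half the initial weighted energy.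
          have hS1 := hid S hSS
          have hS2 := hlow S hSS
          have hS3 : 0 ≤ φLo * y S := mul_nonneg hφLo.le (hy0 S)
          have hS4 : φLo * M ≤ 2 * B := by linarith
          linarith [abs_nonneg φHi, mul_nonneg (abs_nonneg φHi) (hy0 0)]

end Energy


/-! ### Difference quotients in time -/

section Path

variable {X : Type*} [MeasurableSpace X] {μ : Measure X}
  {E : Type*} [NormedAddCommGroup E]

/-- The increment `u(t + h) - u(t)`. -/
def timeIncrement (h : ℝ) (u : ℝ → X → E) : ℝ → X → E := fun t x => u (t + h) x - u t x

theorem measurable_timeIncrement [MeasurableSpace E] [BorelSpace E] [SecondCountableTopology E]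
    (h : ℝ) {u : ℝ → X → E} (hu : Measurable (Function.uncurry u)) :
    Measurable (Function.uncurry (timeIncrement h u)) :=
  (hu.comp ((measurable_fst.add_const h).prodMk measurable_snd)).sub hu

theorem sq_setLIntegral_le {Y : Type*} [MeasurableSpace Y] {ν : Measure Y} {g : Y → ℝ≥0∞}
    (hg : Measurable g) : (∫⁻ t, g t ∂ν) ^ 2 ≤ ν univ * ∫⁻ t, g t ^ 2 ∂ν := by
  have h := ENNReal.lintegral_mul_le_Lp_mul_Lq ν Real.HolderConjugate.two_two
    (f := fun _ => 1) aemeasurable_const hg.aemeasurable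
  simp only [Pi.mul_apply, one_mul, one_pow, lintegral_one, ENNReal.rpow_two] at h
  calc (∫⁻ t, g t ∂ν) ^ 2
      ≤ (ν univ ^ (1 / 2 : ℝ) * (∫⁻ t, g t ^ 2 ∂ν) ^ (1 / 2 : ℝ)) ^ 2 := by gcongr
    _ = _ := by
      rw [mul_pow, ← ENNReal.rpow_natCast, ← ENNReal.rpow_natCast, ← ENNReal.rpow_mul,
        ← ENNReal.rpow_mul]
      norm_num

/-- Allows the equations at t and at t + h to be used together. -/
theorem ae_restrict_Icc_shift {p : ℝ → Prop} {T h : ℝ} (hh : 0 ≤ h)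
    (hp : ∀ᵐ t ∂(volume.restrict (Icc 0 T)), p t) :
    ∀ᵐ t ∂(volume.restrict (Icc 0 (T - h))), p t ∧ p (t + h) := by
  rw [ae_restrict_iff' measurableSet_Icc] at hp ⊢
  have hp' := (measurePreserving_add_right volume h).quasiMeasurePreserving.ae hp
  filter_upwards [hp, hp'] with t h1 h2 ht
  exact ⟨h1 ⟨ht.1, by linarith [ht.2]⟩, h2 ⟨by linarith [ht.1], by linarith [ht.2]⟩⟩

theorem setLIntegral_Icc_shift_le (g : ℝ → ℝ≥0∞) {T S σ : ℝ} (hσ : 0 ≤ σ) (h : S + σ ≤ T) :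
    ∫⁻ t in Icc 0 S, g (t + σ) ≤ ∫⁻ t in Icc 0 T, g t := by
  calc ∫⁻ t in Icc 0 S, g (t + σ) ≤ ∫⁻ t in (fun t => t + σ) ⁻¹' Icc 0 T, g (t + σ) :=
        lintegral_mono_set fun t ht => ⟨by linarith [ht.1], by linarith [ht.2]⟩
    _ = _ := (measurePreserving_add_right volume σ).setLIntegral_comp_preimage_emb
        (measurableEmbedding_addRight σ) g (Icc 0 T)

variable [NormedSpace ℝ E] {u u' : ℝ → X → E} {T : ℝ}

theorem HasPathDeriv.sub_eq (h : HasPathDeriv μ T u u') :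
    ∀ᵐ x ∂μ, ∀ s ∈ Icc 0 T, ∀ t ∈ Icc 0 T, u t x - u s x = ∫ τ in s..t, u' τ x := by
  filter_upwards [h] with x hx s hs t ht
  have hi : ∀ r ∈ Icc 0 T, IntervalIntegrable (fun t => u' t x) volume 0 r := fun r hr =>
    hx.1.mono_set (by
      rw [uIcc_of_le hr.1, uIcc_of_le (hr.1.trans hr.2)]; exact Icc_subset_Icc_right hr.2)
  rw [hx.2 s hs, hx.2 t ht, add_sub_add_left_eq_sub,
    intervalIntegral.integral_interval_sub_left (hi t ht) (hi s hs)]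

theorem HasPathDeriv.enorm_sub_le (h : HasPathDeriv μ T u u') :
    ∀ᵐ x ∂μ, ∀ s ∈ Icc 0 T, ∀ t ∈ Icc 0 T, s ≤ t →
      ‖u t x - u s x‖ₑ ≤ ∫⁻ τ in Icc s t, ‖u' τ x‖ₑ := by
  filter_upwards [h.sub_eq] with x hx s hs t ht hst
  rw [hx s hs t ht, intervalIntegral.integral_of_le hst, ← integral_Icc_eq_integral_Ioc]
  exact enorm_integral_le_lintegral_enorm _

theorem HasPathDeriv.norm_sub_le {b : ℝ} (h : HasPathDeriv μ T u u')
    (hb : ∀ᵐ x ∂μ, ∀ᵐ t ∂(volume.restrict (Icc 0 T)), ‖u' t x‖ ≤ b) :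
    ∀ᵐ x ∂μ, ∀ s ∈ Icc 0 T, ∀ t ∈ Icc 0 T, s ≤ t → ‖u t x - u s x‖ ≤ b * (t - s) := by
  filter_upwards [h.sub_eq, hb] with x hx hbx s hs t ht hst
  rw [hx s hs t ht, ← abs_of_nonneg (sub_nonneg.2 hst)]
  refine intervalIntegral.norm_integral_le_of_norm_le_const_ae ?_
  rw [ae_restrict_iff' measurableSet_Icc] at hbx
  filter_upwards [hbx] with τ hτ hmem
  rw [uIoc_of_le hst] at hmem
  exact hτ ⟨hs.1.trans hmem.1.le, hmem.2.trans ht.2⟩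

theorem HasPathDeriv.increment {h : ℝ} (hh : 0 ≤ h) (hhT : h ≤ T) (hu : HasPathDeriv μ T u u') :
    HasPathDeriv μ (T - h) (timeIncrement h u) (timeIncrement h u') := by
  filter_upwards [hu, hu.sub_eq] with x hx hx'
  have hT : 0 ≤ T := hh.trans hhT
  have hi : IntervalIntegrable (fun t => u' t x) volume 0 (T - h) :=
    hx.1.mono_set (by
      rw [uIcc_of_le (by linarith), uIcc_of_le hT]; exact Icc_subset_Icc_right (by linarith))
  have hi' : IntervalIntegrable (fun t => u' (t + h) x) volume 0 (T - h) := by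
    have h1 : IntervalIntegrable (fun t => u' t x) volume h T :=
      hx.1.mono_set (by rw [uIcc_of_le hhT, uIcc_of_le hT]; exact Icc_subset_Icc_left hh)
    simpa using h1.comp_add_right h
  refine ⟨hi'.sub hi, fun t ht => ?_⟩
  have hsub : uIcc 0 t ⊆ uIcc 0 (T - h) := by
    rw [uIcc_of_le ht.1, uIcc_of_le (by linarith)]; exact Icc_subset_Icc_right ht.2
  have h1 := hx' h ⟨hh, hhT⟩ (t + h) ⟨by linarith [ht.1], by linarith [ht.2]⟩
  have h2 := hx' 0 ⟨le_rfl, hT⟩ t ⟨ht.1, by linarith [ht.2]⟩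
  simp only [timeIncrement]
  rw [intervalIntegral.integral_sub (hi'.mono_set hsub) (hi.mono_set hsub),
    intervalIntegral.integral_comp_add_right (fun t => u' t x), zero_add, ← h1, ← h2]
  abel

variable [MeasurableSpace E] [BorelSpace E]

/-- The difference quotients are bounded in `L²` by the derivative. -/
theorem HasPathDeriv.lintegral_increment_sq_le [SecondCountableTopology E] [SFinite μ] {h : ℝ} (hh : 0 ≤ h)
    (hu : HasPathDeriv μ T u u') (hum : Measurable (Function.uncurry u))
    (hum' : Measurable (Function.uncurry u')) :
    ∫⁻ t in Icc 0 (T - h), ∫⁻ x, ‖timeIncrement h u t x‖ₑ ^ 2 ∂μ ≤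
      ENNReal.ofReal (h ^ 2) * ∫⁻ t in Icc 0 T, ∫⁻ x, ‖u' t x‖ₑ ^ 2 ∂μ := by
  rw [lintegral_lintegral_swap
      ((measurable_timeIncrement h hum).enorm.pow_const 2).aemeasurable,
    lintegral_lintegral_swap (f := fun t x => ‖u' t x‖ₑ ^ 2)
      (hum'.enorm.pow_const 2).aemeasurable,
    ← lintegral_const_mul' _ _ (by simp)]
  refine lintegral_mono_ae ?_
  filter_upwards [hu.enorm_sub_le] with x hx
  have hmx : Measurable fun t => u' t x := hum'.of_uncurry_right
  have hvol : volume.restrict (Icc 0 h) univ = ENNReal.ofReal h := by simp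
  -- Cauchy–Schwarz on a window of length h gives one factor h; integrating over the shifts σ in [0,
  -- h] gives the other.
  have hpt : ∀ t ∈ Icc 0 (T - h), ‖timeIncrement h u t x‖ₑ ^ 2 ≤
      ENNReal.ofReal h * ∫⁻ σ in Icc 0 h, ‖u' (t + σ) x‖ₑ ^ 2 := by
    intro t ht
    have h1 := hx t ⟨ht.1, by linarith [ht.2]⟩ (t + h)
      ⟨by linarith [ht.1], by linarith [ht.2]⟩ (by linarith)
    have h2 : ∫⁻ τ in Icc t (t + h), ‖u' τ x‖ₑ = ∫⁻ σ in Icc 0 h, ‖u' (t + σ) x‖ₑ := by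
      rw [← (measurePreserving_add_left volume t).setLIntegral_comp_preimage_emb
        (measurableEmbedding_addLeft t)]
      simp
    rw [h2] at h1
    refine (pow_le_pow_left' h1 2).trans ((sq_setLIntegral_le ?_).trans_eq ?_)
    · exact (hmx.comp (measurable_const_add t)).enorm
    · rw [hvol]
  calc ∫⁻ t in Icc 0 (T - h), ‖timeIncrement h u t x‖ₑ ^ 2
      ≤ ∫⁻ t in Icc 0 (T - h), ENNReal.ofReal h * ∫⁻ σ in Icc 0 h, ‖u' (t + σ) x‖ₑ ^ 2 :=
        setLIntegral_mono' measurableSet_Icc hpt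
    _ = ENNReal.ofReal h *
          ∫⁻ σ in Icc 0 h, ∫⁻ t in Icc 0 (T - h), ‖u' (t + σ) x‖ₑ ^ 2 := by
        rw [lintegral_const_mul' _ _ (by simp), lintegral_lintegral_swap]
        exact ((hmx.comp (measurable_fst.add measurable_snd)).enorm.pow_const 2).aemeasurable
    _ ≤ ENNReal.ofReal h * ∫⁻ _ in Icc 0 h, ∫⁻ t in Icc 0 T, ‖u' t x‖ₑ ^ 2 := by
        refine mul_le_mul' le_rfl (setLIntegral_mono' measurableSet_Icc fun σ hσ => ?_)
        exact setLIntegral_Icc_shift_le (fun t => ‖u' t x‖ₑ ^ 2) hσ.1 (by linarith [hσ.2])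
    _ = _ := by
        rw [lintegral_const, hvol, sq h, ENNReal.ofReal_mul hh]
        ring

/-- A function with a time derivative in `L²` is bounded in time with values in `L²`. -/
theorem HasPathDeriv.lintegral_sq_le [SFinite μ] (hT : 0 < T)
    (hu : HasPathDeriv μ T u u') (hum : Measurable (Function.uncurry u))
    (hum' : Measurable (Function.uncurry u')) {t : ℝ} (ht : t ∈ Icc 0 T) :
    ∫⁻ x, ‖u t x‖ₑ ^ 2 ∂μ ≤ ENNReal.ofReal (2 / T + 2 * T) *
      ((∫⁻ t in Icc 0 T, ∫⁻ x, ‖u t x‖ₑ ^ 2 ∂μ) + ∫⁻ t in Icc 0 T, ∫⁻ x, ‖u' t x‖ₑ ^ 2 ∂μ) := by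
  rw [lintegral_lintegral_swap (hum.enorm.pow_const 2).aemeasurable,
    lintegral_lintegral_swap (f := fun t x => ‖u' t x‖ₑ ^ 2)
      (hum'.enorm.pow_const 2).aemeasurable,
    ← lintegral_add_left (f := fun x => ∫⁻ t in Icc 0 T, ‖u t x‖ₑ ^ 2)
      (hum.enorm.pow_const 2).lintegral_prod_left',
    ← lintegral_const_mul' _ _ (by simp)]
  refine lintegral_mono_ae ?_
  filter_upwards [hu.enorm_sub_le] with x hx
  have hmx : Measurable fun t => u' t x := hum'.of_uncurry_right
  have hmx0 : Measurable fun t => u t x := hum.of_uncurry_right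
  have hvol : volume.restrict (Icc 0 T) univ = ENNReal.ofReal T := by simp
  set A := ∫⁻ t in Icc 0 T, ‖u t x‖ₑ ^ 2 with hA
  set B := ∫⁻ t in Icc 0 T, ‖u' t x‖ₑ ^ 2 with hB
  -- The value at t is compared with the value at σ and averaged over σ in [0, T]; this produces the
  -- constants 2 / T and 2 T.
  have hpt : ∀ σ ∈ Icc 0 T, ‖u t x‖ₑ ^ 2 ≤ 2 * (‖u σ x‖ₑ ^ 2 + ENNReal.ofReal T * B) := by
    intro σ hσ
    have h1 : ‖u t x - u σ x‖ₑ ≤ ∫⁻ τ in Icc 0 T, ‖u' τ x‖ₑ := by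
      rcases le_total σ t with h | h
      · exact (hx σ hσ t ht h).trans (lintegral_mono_set (Icc_subset_Icc hσ.1 ht.2))
      · rw [← enorm_neg, neg_sub]
        exact (hx t ht σ hσ h).trans (lintegral_mono_set (Icc_subset_Icc ht.1 hσ.2))
    calc ‖u t x‖ₑ ^ 2 = ‖u σ x + (u t x - u σ x)‖ₑ ^ 2 := by rw [add_sub_cancel]
      _ ≤ (‖u σ x‖ₑ + ∫⁻ τ in Icc 0 T, ‖u' τ x‖ₑ) ^ 2 :=
        pow_le_pow_left' ((enorm_add_le _ _).trans (add_le_add le_rfl h1)) 2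
      _ ≤ 2 * (‖u σ x‖ₑ ^ 2 + (∫⁻ τ in Icc 0 T, ‖u' τ x‖ₑ) ^ 2) := add_sq_le_ennreal _ _
      _ ≤ _ := by
        gcongr
        exact (sq_setLIntegral_le hmx.enorm).trans_eq (by rw [hvol])
  have hint : ENNReal.ofReal T * ‖u t x‖ₑ ^ 2 ≤
      2 * A + 2 * (ENNReal.ofReal T * ENNReal.ofReal T) * B := by
    calc ENNReal.ofReal T * ‖u t x‖ₑ ^ 2 = ∫⁻ _ in Icc 0 T, ‖u t x‖ₑ ^ 2 := by
          rw [lintegral_const, hvol, mul_comm]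
      _ ≤ ∫⁻ σ in Icc 0 T, 2 * (‖u σ x‖ₑ ^ 2 + ENNReal.ofReal T * B) :=
          setLIntegral_mono' measurableSet_Icc hpt
      _ = _ := by
          rw [lintegral_const_mul' _ _ (by simp), lintegral_add_left (hmx0.enorm.pow_const 2),
            lintegral_const, hvol]
          ring
  have hTinv : ENNReal.ofReal T⁻¹ * ENNReal.ofReal T = 1 := by
    rw [← ENNReal.ofReal_mul (by positivity), inv_mul_cancel₀ hT.ne', ENNReal.ofReal_one]
  calc ‖u t x‖ₑ ^ 2 = ENNReal.ofReal T⁻¹ * (ENNReal.ofReal T * ‖u t x‖ₑ ^ 2) := by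
        rw [← mul_assoc, hTinv, one_mul]
    _ ≤ ENNReal.ofReal T⁻¹ * (2 * A + 2 * (ENNReal.ofReal T * ENNReal.ofReal T) * B) := by gcongr
    _ = 2 * ENNReal.ofReal T⁻¹ * A +
          ENNReal.ofReal T⁻¹ * ENNReal.ofReal T * (2 * ENNReal.ofReal T) * B := by ring
    _ = ENNReal.ofReal (2 / T) * A + ENNReal.ofReal (2 * T) * B := by
        rw [hTinv, one_mul, div_eq_mul_inv, ENNReal.ofReal_mul (by norm_num),
          ENNReal.ofReal_mul (by norm_num)]
        simp
    _ ≤ ENNReal.ofReal (2 / T + 2 * T) * A + ENNReal.ofReal (2 / T + 2 * T) * B := by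
        gcongr
        · linarith
        · have : 0 ≤ 2 / T := by positivity
          linarith
    _ = _ := by rw [mul_add]

/-- Convergence of the difference quotients. -/
theorem HasPathDeriv.ae_tendsto [CompleteSpace E] [SecondCountableTopology E] [SFinite μ] (hT : 0 < T)
    (hu : HasPathDeriv μ T u u') (hum : Measurable (Function.uncurry u))
    (hum' : Measurable (Function.uncurry u')) {h : ℕ → ℝ} (hpos : ∀ n, 0 < h n)
    (hlim : Tendsto h atTop (𝓝 0)) :
    ∀ᵐ t ∂(volume.restrict (Icc 0 T)), ∀ᵐ x ∂μ,
      Tendsto (fun n => (h n)⁻¹ • timeIncrement (h n) u t x) atTop (𝓝 (u' t x)) := by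
  have hmeas : MeasurableSet {p : ℝ × X | Tendsto
      (fun n => (h n)⁻¹ • timeIncrement (h n) u p.1 p.2) atTop (𝓝 (u' p.1 p.2))} :=
    measurableSet_tendsto_fun
      (fun n => (measurable_timeIncrement (h n) hum).const_smul ((h n)⁻¹)) hum'
  -- Differentiability is known at almost every t for fixed x; measurability of the convergence set
  -- lets the two quantifiers be exchanged.
  rw [Measure.ae_ae_comm hmeas]
  filter_upwards [hu] with x hx
  rw [ae_restrict_iff' measurableSet_Icc]
  have h0 : ∀ᵐ t : ℝ, t ≠ 0 := by simp [ae_iff, measure_singleton]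
  have h1 : ∀ᵐ t : ℝ, t ≠ T := by simp [ae_iff, measure_singleton]
  filter_upwards [hx.1.ae_hasDerivAt_integral, h0, h1] with t ht ht0 ht1 htT
  have hd := ht (by rwa [uIcc_of_le hT.le]) 0 (by simp)
  have hlt : t < T := lt_of_le_of_ne htT.2 ht1
  have hh : Tendsto h atTop (𝓝[≠] 0) :=
    tendsto_nhdsWithin_iff.2 ⟨hlim, Eventually.of_forall fun n => (hpos n).ne'⟩
  have hs := (hasDerivAt_iff_tendsto_slope_zero.1 hd).comp hh
  refine hs.congr' ?_
  -- For t < T the points t + h n eventually stay in [0, T], where the path is known to be the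
  -- primitive.
  have hev : ∀ᶠ n in atTop, h n < T - t := hlim.eventually_lt_const (by linarith)
  filter_upwards [hev] with n hn
  simp only [Function.comp, timeIncrement]
  rw [hx.2 t htT, hx.2 (t + h n) ⟨by linarith [htT.1, hpos n], by linarith⟩]
  congr 1
  abel

end Path


/-! ### The norms as iterated integrals -/

section Norms

variable {d : ℕ} {X : Type*} [NormedAddCommGroup X] {Ω : Set (Space d)} {T : ℝ}

theorem bochnerNorm_rpow {p : ℝ} (hp : 0 < p) (u : ℝ → Space d → X) :
    bochnerNorm Ω T (ENNReal.ofReal p) (ENNReal.ofReal p) u ^ p =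
      ∫⁻ t in Icc 0 T, ∫⁻ x in Ω, ‖u t x‖ₑ ^ p := by
  have h0 : ENNReal.ofReal p ≠ 0 := by simpa using hp
  unfold bochnerNorm
  simp only [eLpNorm_eq_lintegral_rpow_enorm_toReal h0 ENNReal.ofReal_ne_top, enorm_eq_self,
    ENNReal.toReal_ofReal hp.le, ← ENNReal.rpow_mul, one_div, inv_mul_cancel₀ hp.ne',
    ENNReal.rpow_one]

theorem eLpNorm_two_sq {Y : Type*} [MeasurableSpace Y] {ν : Measure Y} (w : Y → X) :
    eLpNorm w 2 ν ^ 2 = ∫⁻ x, ‖w x‖ₑ ^ 2 ∂ν := by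
  rw [eLpNorm_eq_lintegral_rpow_enorm_toReal (by norm_num) (by norm_num), ← ENNReal.rpow_natCast,
    ← ENNReal.rpow_mul]
  norm_num

theorem normL2_sq (w : Space d → ℝ) : normL2 Ω w ^ 2 = ∫⁻ x in Ω, ‖w x‖ₑ ^ 2 := eLpNorm_two_sq w

theorem bochnerNorm_two_sq (u : ℝ → Space d → X) :
    bochnerNorm Ω T 2 2 u ^ 2 = ∫⁻ t in Icc 0 T, ∫⁻ x in Ω, ‖u t x‖ₑ ^ 2 := by
  have h := bochnerNorm_rpow (Ω := Ω) (T := T) (p := 2) (by norm_num) u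
  simpa using h

theorem bochnerNorm_top_sq_le {u : ℝ → Space d → X} {K : ℝ≥0∞}
    (h : ∀ᵐ t ∂(volume.restrict (Icc 0 T)), ∫⁻ x in Ω, ‖u t x‖ₑ ^ 2 ≤ K) :
    bochnerNorm Ω T ⊤ 2 u ^ 2 ≤ K := by
  have h1 : bochnerNorm Ω T ⊤ 2 u ≤ K ^ (1 / 2 : ℝ) := by
    unfold bochnerNorm
    rw [eLpNorm_exponent_top]
    refine essSup_le_of_ae_le _ ?_
    filter_upwards [h] with t ht
    rw [enorm_eq_self, one_div, ENNReal.le_rpow_inv_iff (by norm_num), ENNReal.rpow_two,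
      eLpNorm_two_sq]
    exact ht
  calc bochnerNorm Ω T ⊤ 2 u ^ 2 ≤ (K ^ (1 / 2 : ℝ)) ^ 2 := by gcongr
    _ = K := by
      rw [← ENNReal.rpow_natCast, ← ENNReal.rpow_mul]
      norm_num

theorem bochnerNorm_one_two (u : ℝ → Space d → X) :
    bochnerNorm Ω T 1 2 u = ∫⁻ t in Icc 0 T, (∫⁻ x in Ω, ‖u t x‖ₑ ^ 2) ^ (1 / 2 : ℝ) := by
  unfold bochnerNorm
  rw [eLpNorm_one_eq_lintegral_enorm]
  refine lintegral_congr fun t => ?_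
  rw [enorm_eq_self, eLpNorm_eq_lintegral_rpow_enorm_toReal (by norm_num) (by norm_num)]
  simp

end Norms

/-! ### The equations at a fixed time -/

section Slice

variable {d : ℕ} {Ω : Set (Space d)}

theorem exists_norm_gradient_le {η : Space d → ℝ} (hη : IsTestFunction Ω η) :
    Continuous (gradient η) ∧ ∃ C, ∀ x, ‖gradient η x‖ ≤ C := by
  have hc : Continuous (gradient η) := by
    unfold gradient
    exact (InnerProductSpace.toDual ℝ (Space d)).symm.continuous.comp
      (hη.1.continuous_fderiv (by simp))
  refine ⟨hc, ?_⟩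
  obtain ⟨C, hC⟩ := (hη.2.1.fderiv ℝ).exists_bound_of_continuous
    (hη.1.continuous_fderiv (by simp))
  refine ⟨C, fun x => ?_⟩
  simpa [gradient] using hC x

/-- Makes the increment of the flux an admissible test field. Integrability on all of Ω, with η and
its gradient bounded, lets the integrals be split. -/
theorem HasWeakDiv.sub {v w : Space d → Space d} {g k : Space d → ℝ}
    (hv : HasWeakDiv Ω v g) (hw : HasWeakDiv Ω w k) (hvi : IntegrableOn v Ω)
    (hwi : IntegrableOn w Ω) (hgi : IntegrableOn g Ω) (hki : IntegrableOn k Ω) :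
    HasWeakDiv Ω (fun x => v x - w x) (fun x => g x - k x) := by
  refine ⟨(hvi.sub hwi).locallyIntegrableOn, (hgi.sub hki).locallyIntegrableOn, fun η hη => ?_⟩
  obtain ⟨hc, C, hC⟩ := exists_norm_gradient_le hη
  obtain ⟨B, hB⟩ := hη.2.1.exists_bound_of_continuous hη.1.continuous
  have h1 : ∀ u : Space d → Space d, IntegrableOn u Ω →
      IntegrableOn (fun x => inner ℝ (u x) (gradient η x)) Ω := fun u hu =>
    Integrable.mono' (hu.norm.mul_const C)
      (hu.aestronglyMeasurable.inner hc.aestronglyMeasurable) (ae_of_all _ fun x =>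
        (norm_inner_le_norm _ _).trans (mul_le_mul_of_nonneg_left (hC x) (norm_nonneg _)))
  have h2 : ∀ u : Space d → ℝ, IntegrableOn u Ω → IntegrableOn (fun x => u x * η x) Ω :=
    fun u hu => Integrable.mul_bdd (c := B) hu hη.1.continuous.aestronglyMeasurable
      (ae_of_all _ hB)
  simp only [inner_sub_left, sub_mul]
  rw [integral_sub (h1 v hvi) (h1 w hwi), integral_sub (h2 g hgi) (h2 k hki), hv.2.2 η hη,
    hw.2.2 η hη]
  ring

variable {N : ℕ} {α : Fin (N + 2) → ℝ} {aLo aHi : ℝ}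

/-- The hypotheses and the two equations at a fixed time. -/
structure IsSlice (Ω : Set (Space d)) (α : Fin (N + 2) → ℝ) (aLo aHi : ℝ) (φ : Space d → ℝ)
    (b : Fin (N + 2) → Space d → ℝ) (f ψ : Space d → ℝ) (g m : Space d → Space d)
    (dm r rt : Space d → ℝ) : Prop where
  measurable_b : ∀ i, Measurable (b i)
  coeff : ∀ᵐ x ∂(volume.restrict Ω), CoeffBound aLo aHi fun i => b i x
  measurable_m : Measurable m
  m_mem : MemLp m (ENNReal.ofReal (sExp α)) (volume.restrict Ω)
  dm_mem : MemLp dm 2 (volume.restrict Ω)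
  weakDiv : HasWeakDiv Ω m dm
  r_mem : MemLp r 2 (volume.restrict Ω)
  rt_mem : MemLp rt 2 (volume.restrict Ω)
  f_mem : MemLp f 2 (volume.restrict Ω)
  ψ_mem : MemLp ψ 2 (volume.restrict Ω)
  measurable_g : Measurable g
  g_integrable : Integrable (fun x => ‖g x‖ ^ sConj α) (volume.restrict Ω)
  momentum : ∀ (v : Space d → Space d) (dv : Space d → ℝ),
    MemLp v (ENNReal.ofReal (sExp α)) (volume.restrict Ω) → MemLp dv 2 (volume.restrict Ω) →
    HasWeakDiv Ω v dv →
      (∫ x in Ω, inner ℝ (genPoly α (fun i => b i x) ‖m x‖ • m x) (v x)) -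
        (∫ x in Ω, r x * dv x) = -∫ x in Ω, inner ℝ (g x) (v x)
  continuity : ∀ q : Space d → ℝ, MemLp q 2 (volume.restrict Ω) →
      (∫ x in Ω, φ x * rt x * q x) + (∫ x in Ω, dm x * q x) =
        (∫ x in Ω, f x * q x) - ∫ x in Ω, φ x * ψ x * q x

theorem integrable_norm_rpow_sExp (hs : 0 < sExp α) {X : Type*} [MeasurableSpace X]
    {μ : Measure X} {E : Type*} [NormedAddCommGroup E] {u : X → E}
    (hu : MemLp u (ENNReal.ofReal (sExp α)) μ) : Integrable (fun x => ‖u x‖ ^ sExp α) μ := by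
  have := hu.integrable_norm_rpow (by simpa using hs) ENNReal.ofReal_ne_top
  rwa [ENNReal.toReal_ofReal hs.le] at this

theorem integrable_energyDensity (hα : IsPowerVector N α) (hs : 0 < sExp α) {X : Type*}
    [MeasurableSpace X] {μ : Measure X} [IsFiniteMeasure μ] {E : Type*} [NormedAddCommGroup E]
    {u : X → E} (hu : MemLp u (ENNReal.ofReal (sExp α)) μ) :
    Integrable (fun x => energyDensity α ‖u x‖) μ := by
  refine Integrable.mono'
    (((integrable_const 1).add (integrable_norm_rpow_sExp hs hu)).const_mul 3)
    (measurable_energyDensity.comp_aemeasurable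
      hu.aestronglyMeasurable.norm.aemeasurable).aestronglyMeasurable (ae_of_all _ fun x => ?_)
  rw [Real.norm_of_nonneg (energyDensity_nonneg (norm_nonneg _))]
  exact energyDensity_le hα (norm_nonneg _)

theorem integrable_inner_of_conj (hs : 1 < sExp α) {X : Type*} [MeasurableSpace X]
    {μ : Measure X} {E : Type*} [NormedAddCommGroup E] [InnerProductSpace ℝ E] {g v : X → E}
    (hg : AEStronglyMeasurable g μ) (hgi : Integrable (fun x => ‖g x‖ ^ sConj α) μ)
    (hv : MemLp v (ENNReal.ofReal (sExp α)) μ) : Integrable (fun x => inner ℝ (g x) (v x)) μ := by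
  obtain ⟨C, -, hC⟩ := exists_young (sExp α) hs one_pos
  refine Integrable.mono'
    (((integrable_norm_rpow_sExp (by linarith) hv).const_mul 1).add (hgi.const_mul C))
    (hg.inner hv.aestronglyMeasurable) (ae_of_all _ fun x => ?_)
  exact (norm_inner_le_norm _ _).trans (hC _ _ (norm_nonneg _) (norm_nonneg _))

theorem integrable_flux_inner (hα : IsPowerVector N α) (hs : 0 < sExp α) {X : Type*}
    [MeasurableSpace X] {μ : Measure X} [IsFiniteMeasure μ] {u v : X → Space d}
    {b : Fin (N + 2) → X → ℝ} (hb : ∀ i, Measurable (b i))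
    (hbb : ∀ᵐ x ∂μ, CoeffBound aLo aHi fun i => b i x) (hum : Measurable u)
    (hu : MemLp u (ENNReal.ofReal (sExp α)) μ) (hv : MemLp v (ENNReal.ofReal (sExp α)) μ) :
    Integrable (fun x => inner ℝ (genPoly α (fun i => b i x) ‖u x‖ • u x) (v x)) μ := by
  have hF : Measurable fun x => genPoly α (fun i => b i x) ‖u x‖ := by
    unfold genPoly
    exact Finset.measurable_sum _ fun i _ => (hb i).mul (hum.norm.pow_const _)
  refine Integrable.mono' ((((integrable_const 1).add (integrable_norm_rpow_sExp hs hu)).add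
    (integrable_norm_rpow_sExp hs hv)).const_mul ((N + 2) * aHi))
    ((hF.smul hum).aestronglyMeasurable.inner hv.aestronglyMeasurable) ?_
  filter_upwards [hbb] with x hx
  exact hx.norm_inner_le hα _ _

variable {φ : Space d → ℝ} {b b' : Fin (N + 2) → Space d → ℝ} {f ψ f' ψ' : Space d → ℝ}
  {g m g' m' : Space d → Space d} {dm r rt dm' r' rt' : Space d → ℝ} {K : ℝ}

theorem integrable_weight_mul {μ : Measure (Space d)} {u v : Space d → ℝ} (hφ : Measurable φ)
    (hφb : ∀ᵐ x ∂μ, |φ x| ≤ K) (hu : MemLp u 2 μ) (hv : MemLp v 2 μ) :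
    Integrable (fun x => φ x * u x * v x) μ := by
  simp_rw [mul_assoc]
  exact (hu.integrable_mul hv).bdd_mul hφ.aestronglyMeasurable hφb

theorem memLp_weight_mul {μ : Measure (Space d)} {u : Space d → ℝ} (hφ : Measurable φ)
    (hφb : ∀ᵐ x ∂μ, |φ x| ≤ K) (hu : MemLp u 2 μ) : MemLp (fun x => φ x * u x) 2 μ := by
  refine hu.of_le_mul (c := K) (hφ.aestronglyMeasurable.mul hu.aestronglyMeasurable) ?_
  filter_upwards [hφb] with x hx
  rw [norm_mul]
  exact mul_le_mul_of_nonneg_right hx (norm_nonneg _)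

/-- Test with v = m and q = r; the two terms containing the divergence cancel. -/
theorem IsSlice.energy_eq (h : IsSlice Ω α aLo aHi φ b f ψ g m dm r rt) (hφ : Measurable φ)
    (hφb : ∀ᵐ x ∂(volume.restrict Ω), |φ x| ≤ K) :
    (∫ x in Ω, inner ℝ (genPoly α (fun i => b i x) ‖m x‖ • m x) (m x)) +
        ∫ x in Ω, φ x * rt x * r x =
      (∫ x in Ω, (f x - φ x * ψ x) * r x) - ∫ x in Ω, inner ℝ (g x) (m x) := by
  have h1 := h.momentum m dm h.m_mem h.dm_mem h.weakDiv
  have h2 := h.continuity r h.r_mem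
  have h3 : ∫ x in Ω, dm x * r x = ∫ x in Ω, r x * dm x := by simp_rw [mul_comm]
  have h4 : ∫ x in Ω, (f x - φ x * ψ x) * r x =
      (∫ x in Ω, f x * r x) - ∫ x in Ω, φ x * ψ x * r x := by
    simp_rw [sub_mul]
    exact integral_sub (h.f_mem.integrable_mul h.r_mem)
      (integrable_weight_mul hφ hφb h.ψ_mem h.r_mem)
  rw [h4]
  linarith

/-- The continuity equation bounds the divergence. -/
theorem IsSlice.lintegral_div_le (h : IsSlice Ω α aLo aHi φ b f ψ g m dm r rt)
    (hφ : Measurable φ) (hφb : ∀ᵐ x ∂(volume.restrict Ω), |φ x| ≤ K) :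
    ∫⁻ x in Ω, ‖dm x‖ₑ ^ 2 ≤ ∫⁻ x in Ω, ‖f x - φ x * ψ x - φ x * rt x‖ₑ ^ 2 := by
  have hφψ : MemLp (fun x => φ x * ψ x) 2 (volume.restrict Ω) :=
    memLp_weight_mul hφ hφb h.ψ_mem
  have hφrt : MemLp (fun x => φ x * rt x) 2 (volume.restrict Ω) :=
    memLp_weight_mul hφ hφb h.rt_mem
  have hk : MemLp (fun x => f x - φ x * ψ x - φ x * rt x) 2 (volume.restrict Ω) :=
    (h.f_mem.sub hφψ).sub hφrt
  have hc := h.continuity dm h.dm_mem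
  have j1 := h.f_mem.integrable_mul h.dm_mem
  have j2 := integrable_weight_mul hφ hφb h.ψ_mem h.dm_mem
  have j3 := integrable_weight_mul hφ hφb h.rt_mem h.dm_mem
  simp only [Pi.mul_def] at j1
  -- The continuity equation tested with the divergence itself.
  have e1 : ∫ x in Ω, dm x ^ 2 = ∫ x in Ω, (f x - φ x * ψ x - φ x * rt x) * dm x := by
    have : ∫ x in Ω, (f x - φ x * ψ x - φ x * rt x) * dm x =
        (∫ x in Ω, f x * dm x) - (∫ x in Ω, φ x * ψ x * dm x) - ∫ x in Ω, φ x * rt x * dm x := by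
      rw [← integral_sub' j1 j2, ← integral_sub' (j1.sub j2) j3]
      refine integral_congr_ae (ae_of_all _ fun x => ?_)
      simp only [Pi.sub_apply]
      ring
    rw [this]
    simp_rw [sq]
    linarith
  have e2 : ∫ x in Ω, (f x - φ x * ψ x - φ x * rt x) * dm x ≤
      ∫ x in Ω, (1 / 2 * (f x - φ x * ψ x - φ x * rt x) ^ 2 + 1 / 2 * dm x ^ 2) := by
    refine integral_mono (hk.integrable_mul h.dm_mem)
      ((hk.integrable_sq.const_mul _).add (h.dm_mem.integrable_sq.const_mul _)) fun x => ?_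
    simp only
    nlinarith [sq_nonneg ((f x - φ x * ψ x - φ x * rt x) - dm x)]
  rw [integral_add (hk.integrable_sq.const_mul _) (h.dm_mem.integrable_sq.const_mul _),
    integral_const_mul, integral_const_mul] at e2
  simp_rw [enorm_sq_eq_ofReal]
  rw [← ofReal_integral_eq_lintegral_ofReal h.dm_mem.integrable_sq
      (ae_of_all _ fun x => sq_nonneg _),
    ← ofReal_integral_eq_lintegral_ofReal hk.integrable_sq (ae_of_all _ fun x => sq_nonneg _)]
  exact ENNReal.ofReal_le_ofReal (by linarith)

variable [IsFiniteMeasure (volume.restrict Ω)]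

/-- The two equations at different times, subtracted and tested with the differences of the
solutions. -/
theorem IsSlice.energy_sub_eq (hα : IsPowerVector N α) (hs : 2 < sExp α)
    (h : IsSlice Ω α aLo aHi φ b f ψ g m dm r rt)
    (h' : IsSlice Ω α aLo aHi φ b' f' ψ' g' m' dm' r' rt') (hφ : Measurable φ)
    (hφb : ∀ᵐ x ∂(volume.restrict Ω), |φ x| ≤ K) :
    (∫ x in Ω, inner ℝ (genPoly α (fun i => b' i x) ‖m' x‖ • m' x -
        genPoly α (fun i => b i x) ‖m x‖ • m x) (m' x - m x)) +
        ∫ x in Ω, φ x * (rt' x - rt x) * (r' x - r x) =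
      (∫ x in Ω, ((f' x - f x) - φ x * (ψ' x - ψ x)) * (r' x - r x)) -
        ∫ x in Ω, inner ℝ (g' x - g x) (m' x - m x) := by
  have hs1 : (1 : ℝ≥0∞) ≤ ENNReal.ofReal (sExp α) := by
    rw [← ENNReal.ofReal_one]; exact ENNReal.ofReal_le_ofReal (by linarith)
  have hv : MemLp (fun x => m' x - m x) (ENNReal.ofReal (sExp α)) (volume.restrict Ω) :=
    h'.m_mem.sub h.m_mem
  have hdv : MemLp (fun x => dm' x - dm x) 2 (volume.restrict Ω) := h'.dm_mem.sub h.dm_mem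
  have hq : MemLp (fun x => r' x - r x) 2 (volume.restrict Ω) := h'.r_mem.sub h.r_mem
  have hdiv : HasWeakDiv Ω (fun x => m' x - m x) (fun x => dm' x - dm x) :=
    h'.weakDiv.sub h.weakDiv (h'.m_mem.integrable hs1) (h.m_mem.integrable hs1)
      (h'.dm_mem.integrable (by norm_num)) (h.dm_mem.integrable (by norm_num))
  -- All four equations are tested with the increments; `i3` and `i4` show that the pressure and
  -- divergence terms cancel.
  have m1 := h.momentum _ _ hv hdv hdiv
  have m2 := h'.momentum _ _ hv hdv hdiv
  have c1 := h.continuity _ hq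
  have c2 := h'.continuity _ hq
  have i1 : ∫ x in Ω, inner ℝ (genPoly α (fun i => b' i x) ‖m' x‖ • m' x -
        genPoly α (fun i => b i x) ‖m x‖ • m x) (m' x - m x) =
      (∫ x in Ω, inner ℝ (genPoly α (fun i => b' i x) ‖m' x‖ • m' x) (m' x - m x)) -
        ∫ x in Ω, inner ℝ (genPoly α (fun i => b i x) ‖m x‖ • m x) (m' x - m x) := by
    simp_rw [inner_sub_left]
    exact integral_sub
      (integrable_flux_inner hα (by linarith) h'.measurable_b h'.coeff h'.measurable_m h'.m_mem hv)
      (integrable_flux_inner hα (by linarith) h.measurable_b h.coeff h.measurable_m h.m_mem hv)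
  have i2 : ∫ x in Ω, inner ℝ (g' x - g x) (m' x - m x) =
      (∫ x in Ω, inner ℝ (g' x) (m' x - m x)) - ∫ x in Ω, inner ℝ (g x) (m' x - m x) := by
    simp_rw [inner_sub_left]
    exact integral_sub
      (integrable_inner_of_conj (by linarith) h'.measurable_g.aestronglyMeasurable
        h'.g_integrable hv)
      (integrable_inner_of_conj (by linarith) h.measurable_g.aestronglyMeasurable
        h.g_integrable hv)
  have i3 : ∫ x in Ω, (r' x - r x) * (dm' x - dm x) =
      (∫ x in Ω, r' x * (dm' x - dm x)) - ∫ x in Ω, r x * (dm' x - dm x) := by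
    simp_rw [sub_mul]
    exact integral_sub (h'.r_mem.integrable_mul hdv) (h.r_mem.integrable_mul hdv)
  have i4 : ∫ x in Ω, (r' x - r x) * (dm' x - dm x) =
      (∫ x in Ω, dm' x * (r' x - r x)) - ∫ x in Ω, dm x * (r' x - r x) := by
    simp_rw [mul_comm (r' _ - r _), sub_mul]
    exact integral_sub (h'.dm_mem.integrable_mul hq) (h.dm_mem.integrable_mul hq)
  have i5 : ∫ x in Ω, φ x * (rt' x - rt x) * (r' x - r x) =
      (∫ x in Ω, φ x * rt' x * (r' x - r x)) - ∫ x in Ω, φ x * rt x * (r' x - r x) := by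
    rw [← integral_sub (integrable_weight_mul hφ hφb h'.rt_mem hq)
      (integrable_weight_mul hφ hφb h.rt_mem hq)]
    refine integral_congr_ae (ae_of_all _ fun x => ?_)
    simp only
    ring
  have i6 : ∫ x in Ω, ((f' x - f x) - φ x * (ψ' x - ψ x)) * (r' x - r x) =
      ((∫ x in Ω, f' x * (r' x - r x)) - ∫ x in Ω, f x * (r' x - r x)) -
        ((∫ x in Ω, φ x * ψ' x * (r' x - r x)) - ∫ x in Ω, φ x * ψ x * (r' x - r x)) := by
    have j1 := h'.f_mem.integrable_mul hq
    have j2 := h.f_mem.integrable_mul hq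
    have j3 := integrable_weight_mul hφ hφb h'.ψ_mem hq
    have j4 := integrable_weight_mul hφ hφb h.ψ_mem hq
    simp only [Pi.mul_def] at j1 j2
    rw [← integral_sub' j1 j2, ← integral_sub' j3 j4, ← integral_sub' (j1.sub j2) (j3.sub j4)]
    refine integral_congr_ae (ae_of_all _ fun x => ?_)
    simp only [Pi.sub_apply]
    ring
  rw [i1, i2, i5, i6]
  linarith

/-- The energy inequality at a fixed time. -/
theorem IsSlice.energy_le (hα : IsPowerVector N α) (hN : 1 ≤ N) {C : ℝ}
    (hC : ∀ x y : ℝ, 0 ≤ x → 0 ≤ y → x * y ≤ aLo / 2 * y ^ sExp α + C * x ^ sConj α)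
    (haLo : 0 ≤ aLo)
    (h : IsSlice Ω α aLo aHi φ b f ψ g m dm r rt) (hφ : Measurable φ)
    (hφb : ∀ᵐ x ∂(volume.restrict Ω), |φ x| ≤ K) :
    (∫ x in Ω, aLo / 2 * energyDensity α ‖m x‖) + ∫ x in Ω, φ x * rt x * r x ≤
      (∫ x in Ω, (f x - φ x * ψ x) * r x) + ∫ x in Ω, C * ‖g x‖ ^ sConj α := by
  have hs := hα.two_lt_sExp hN
  have he := integrable_energyDensity hα (by linarith) h.m_mem
  have hF := integrable_flux_inner hα (by linarith) h.measurable_b h.coeff h.measurable_m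
    h.m_mem h.m_mem
  have hg := integrable_inner_of_conj (by linarith) h.measurable_g.aestronglyMeasurable
    h.g_integrable h.m_mem
  -- Half of the coercivity pays for (g, m) through the Young inequality `hC`.
  have key : ∫ x in Ω, aLo / 2 * energyDensity α ‖m x‖ ≤
      (∫ x in Ω, inner ℝ (genPoly α (fun i => b i x) ‖m x‖ • m x) (m x)) +
        (∫ x in Ω, inner ℝ (g x) (m x)) + ∫ x in Ω, C * ‖g x‖ ^ sConj α := by
    rw [← integral_add' hF hg, ← integral_add' (hF.add hg) (h.g_integrable.const_mul C)]
    refine integral_mono_ae (he.const_mul _) ((hF.add hg).add (h.g_integrable.const_mul C)) ?_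
    filter_upwards [h.coeff] with x hx
    have h1 := hx.coercive hα hN (m x)
    have h2 := hC ‖g x‖ ‖m x‖ (norm_nonneg _) (norm_nonneg _)
    have h3 := neg_le_of_abs_le (abs_real_inner_le_norm (g x) (m x))
    have h4 := mul_le_mul_of_nonneg_left (rpow_sExp_le_energyDensity (α := α) (norm_nonneg (m x)))
      (div_nonneg haLo zero_le_two)
    simp only [Pi.add_apply]
    linarith
  have := h.energy_eq hφ hφb
  linarith

/-- The energy inequality for the difference of the solutions at two times. -/
theorem IsSlice.energy_sub_le (hα : IsPowerVector N α) (hN : 1 ≤ N) {c C B k : ℝ} (hc : 0 < c)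
    (hC : ∀ (h : ℝ) (a a' : Fin (N + 2) → ℝ), 0 ≤ h →
      CoeffBound aLo aHi a' → (∀ i, |a' i - a i| ≤ B * h) → ∀ u v : Space d,
      c * ‖u - v‖ ^ 2 ≤ inner ℝ (genPoly α a' ‖u‖ • u - genPoly α a ‖v‖ • v) (u - v) +
        C * h ^ 2 * (energyDensity α ‖u‖ + energyDensity α ‖v‖))
    (hk : 0 ≤ k) (hbb : ∀ᵐ x ∂(volume.restrict Ω), ∀ i, |b' i x - b i x| ≤ B * k)
    (h : IsSlice Ω α aLo aHi φ b f ψ g m dm r rt)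
    (h' : IsSlice Ω α aLo aHi φ b' f' ψ' g' m' dm' r' rt') (hφ : Measurable φ)
    (hφb : ∀ᵐ x ∂(volume.restrict Ω), |φ x| ≤ K)
    (hg2 : MemLp (fun x => g' x - g x) 2 (volume.restrict Ω)) :
    (∫ x in Ω, c / 2 * ‖m' x - m x‖ ^ 2) + ∫ x in Ω, φ x * (rt' x - rt x) * (r' x - r x) ≤
      (∫ x in Ω, ((f' x - f x) - φ x * (ψ' x - ψ x)) * (r' x - r x)) +
        ∫ x in Ω, (C * k ^ 2 * (energyDensity α ‖m' x‖ + energyDensity α ‖m x‖) +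
          (2 * c)⁻¹ * ‖g' x - g x‖ ^ 2) := by
  have hs := hα.two_lt_sExp hN
  have hv : MemLp (fun x => m' x - m x) (ENNReal.ofReal (sExp α)) (volume.restrict Ω) :=
    h'.m_mem.sub h.m_mem
  -- On a domain of finite measure s ≥ 2 gives L^s ⊆ L², so the increment of m is square integrable.
  have hs2 : (2 : ℝ≥0∞) ≤ ENNReal.ofReal (sExp α) := by
    rw [← ENNReal.ofReal_ofNat]; exact ENNReal.ofReal_le_ofReal hs.le
  have hv2 := (hv.mono_exponent hs2).integrable_norm_pow (by norm_num)
  have hg2' := hg2.integrable_norm_pow (by norm_num)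
  have hE := ((integrable_energyDensity hα (by linarith) h'.m_mem).add
    (integrable_energyDensity hα (by linarith) h.m_mem)).const_mul (C * k ^ 2)
  have hF := (integrable_flux_inner hα (by linarith) h'.measurable_b h'.coeff h'.measurable_m
    h'.m_mem hv).sub (integrable_flux_inner hα (by linarith) h.measurable_b h.coeff
    h.measurable_m h.m_mem hv)
  have hG := (integrable_inner_of_conj (by linarith) h'.measurable_g.aestronglyMeasurable
    h'.g_integrable hv).sub (integrable_inner_of_conj (by linarith)
    h.measurable_g.aestronglyMeasurable h.g_integrable hv)
  simp only [Pi.sub_def, ← inner_sub_left] at hF hG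
  simp only [Pi.add_def] at hE
  have hR := hE.add (hg2'.const_mul (2 * c)⁻¹)
  simp only [Pi.add_def] at hR
  have key : ∫ x in Ω, c / 2 * ‖m' x - m x‖ ^ 2 ≤
      (∫ x in Ω, inner ℝ (genPoly α (fun i => b' i x) ‖m' x‖ • m' x -
        genPoly α (fun i => b i x) ‖m x‖ • m x) (m' x - m x)) +
        (∫ x in Ω, inner ℝ (g' x - g x) (m' x - m x)) +
        ∫ x in Ω, (C * k ^ 2 * (energyDensity α ‖m' x‖ + energyDensity α ‖m x‖) +
          (2 * c)⁻¹ * ‖g' x - g x‖ ^ 2) := by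
    rw [← integral_add' hF hG, ← integral_add' (hF.add hG) hR]
    refine integral_mono_ae (hv2.const_mul _) ((hF.add hG).add hR) ?_
    filter_upwards [h'.coeff, hbb] with x hx hbx
    have h1 := hC k _ _ hk hx hbx (m' x) (m x)
    have h3 := neg_le_of_abs_le (abs_real_inner_le_norm (g' x - g x) (m' x - m x))
    -- Half of the monotonicity constant c absorbs the increment of the gradient.
    have h4 : ‖g' x - g x‖ * ‖m' x - m x‖ ≤
        c / 2 * ‖m' x - m x‖ ^ 2 + (2 * c)⁻¹ * ‖g' x - g x‖ ^ 2 := by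
      have e : c / 2 * ‖m' x - m x‖ ^ 2 + (2 * c)⁻¹ * ‖g' x - g x‖ ^ 2 -
          ‖g' x - g x‖ * ‖m' x - m x‖ =
          c / 2 * (‖m' x - m x‖ - c⁻¹ * ‖g' x - g x‖) ^ 2 := by
        field_simp
        ring
      have : 0 ≤ c / 2 * (‖m' x - m x‖ - c⁻¹ * ‖g' x - g x‖) ^ 2 := by positivity
      linarith
    simp only [Pi.add_apply]
    linarith
  have := h.energy_sub_eq hα hs h' hφ hφb
  linarith

end Slice


/-! ### Auxiliary facts on iterated integrals -/

section Aux

variable {X : Type*} [MeasurableSpace X] {μ : Measure X}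

/-- No integrability is required, because the Bochner integral of a nonintegrable function is 0. -/
theorem ofReal_integral_le_lintegral {u : X → ℝ} (hu : ∀ x, 0 ≤ u x) :
    ENNReal.ofReal (∫ x, u x ∂μ) ≤ ∫⁻ x, ENNReal.ofReal (u x) ∂μ := by
  by_cases hi : Integrable u μ
  · exact (ofReal_integral_eq_lintegral_ofReal hi (ae_of_all _ hu)).le
  · simp [integral_undef hi]

theorem integrable_integral_of_lintegral [SFinite μ] {Y : Type*} [MeasurableSpace Y]
    {ν : Measure Y} {u : Y → X → ℝ} (hu : Measurable (Function.uncurry u))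
    (h0 : ∀ t x, 0 ≤ u t x) (h : ∫⁻ t, ∫⁻ x, ENNReal.ofReal (u t x) ∂μ ∂ν < ⊤) :
    Integrable (fun t => ∫ x, u t x ∂μ) ν := by
  refine ⟨hu.stronglyMeasurable.integral_prod_right'.aestronglyMeasurable, ?_⟩
  rw [hasFiniteIntegral_iff_ofReal (ae_of_all _ fun t => integral_nonneg (h0 t))]
  exact (lintegral_mono fun t => ofReal_integral_le_lintegral (h0 t)).trans_lt h

/-- Fatou's lemma, in the form that carries bounds on difference quotients over to derivatives. -/
theorem lintegral_le_of_le_liminf {F : X → ℝ≥0∞} {G : ℕ → X → ℝ≥0∞} {K : ℕ → ℝ≥0∞} {K₀ : ℝ≥0∞}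
    (hG : ∀ n, Measurable (G n)) (hF : ∀ᵐ x ∂μ, F x ≤ liminf (fun n => G n x) atTop)
    (hK : ∀ᶠ n in atTop, ∫⁻ x, G n x ∂μ ≤ K n) (hlim : Tendsto K atTop (𝓝 K₀)) :
    ∫⁻ x, F x ∂μ ≤ K₀ :=
  calc ∫⁻ x, F x ∂μ ≤ ∫⁻ x, liminf (fun n => G n x) atTop ∂μ := lintegral_mono_ae hF
    _ ≤ liminf (fun n => ∫⁻ x, G n x ∂μ) atTop := lintegral_liminf_le hG
    _ ≤ liminf K atTop := liminf_le_liminf hK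
    _ = K₀ := hlim.liminf_eq

theorem enorm_sub_sq_le {E : Type*} [NormedAddCommGroup E] (x y : E) :
    ‖x - y‖ₑ ^ 2 ≤ 2 * (‖x‖ₑ ^ 2 + ‖y‖ₑ ^ 2) :=
  (pow_le_pow_left' enorm_sub_le 2).trans (add_sq_le_ennreal _ _)

theorem enorm_weight_mul_sq_le {φ K : ℝ} (h : |φ| ≤ K) (y : ℝ) :
    ‖φ * y‖ₑ ^ 2 ≤ ENNReal.ofReal (K ^ 2) * ‖y‖ₑ ^ 2 := by
  rw [enorm_mul, mul_pow, enorm_sq_eq_ofReal φ]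
  gcongr ENNReal.ofReal ?_ * _
  rw [← sq_abs]
  gcongr

theorem lintegral_source_le {φ : X → ℝ} {K : ℝ} (hφb : ∀ᵐ x ∂μ, |φ x| ≤ K) {f ψ : X → ℝ}
    (hf : Measurable f) :
    ∫⁻ x, ‖f x - φ x * ψ x‖ₑ ^ 2 ∂μ ≤
      2 * (∫⁻ x, ‖f x‖ₑ ^ 2 ∂μ + ENNReal.ofReal (K ^ 2) * ∫⁻ x, ‖ψ x‖ₑ ^ 2 ∂μ) := by
  rw [← lintegral_const_mul' _ _ (by simp), ← lintegral_add_left (hf.enorm.pow_const 2),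
    ← lintegral_const_mul' _ _ (by simp)]
  refine lintegral_mono_ae ?_
  filter_upwards [hφb] with x hx
  exact (enorm_sub_sq_le _ _).trans (by gcongr; exact enorm_weight_mul_sq_le hx _)

theorem lintegral_lintegral_source_le [SFinite μ] {φ : X → ℝ} {K S : ℝ}
    (hφb : ∀ᵐ x ∂μ, |φ x| ≤ K) {f ψ : ℝ → X → ℝ} (hf : Measurable (Function.uncurry f)) :
    ∫⁻ t in Icc 0 S, ∫⁻ x, ‖f t x - φ x * ψ t x‖ₑ ^ 2 ∂μ ≤
      2 * ((∫⁻ t in Icc 0 S, ∫⁻ x, ‖f t x‖ₑ ^ 2 ∂μ) +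
        ENNReal.ofReal (K ^ 2) * ∫⁻ t in Icc 0 S, ∫⁻ x, ‖ψ t x‖ₑ ^ 2 ∂μ) := by
  rw [← lintegral_const_mul' _ _ (by simp),
    ← lintegral_add_left (f := fun t => ∫⁻ x, ‖f t x‖ₑ ^ 2 ∂μ)
      (hf.enorm.pow_const 2).lintegral_prod_right',
    ← lintegral_const_mul' _ _ (by simp)]
  exact lintegral_mono fun t => lintegral_source_le hφb hf.of_uncurry_left

end Aux

/-! ### The first energy estimate for weak solutions -/

section Estimates

variable {d : ℕ} {Ω : Set (Space d)} {T : ℝ} {N : ℕ} {α : Fin (N + 2) → ℝ}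
  {aLo aHi bHi φLo φHi : ℝ} {a : Fin (N + 2) → ℝ → Space d → ℝ} {φ : Space d → ℝ}
  {f Ψ Ψt : ℝ → Space d → ℝ} {gΨ : ℝ → Space d → Space d} {m : ℝ → Space d → Space d}
  {dm ρ ρt : ℝ → Space d → ℝ}

theorem IsAdmissibleCoeff.coeffBound (h : IsAdmissibleCoeff Ω T aLo aHi bHi a) :
    ∀ᵐ t ∂(volume.restrict (Icc 0 T)), ∀ᵐ x ∂(volume.restrict Ω),
      CoeffBound aLo aHi fun i => a i t x := by
  have h1 := ae_all_iff.2 h.nonneg_le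
  have h2 : ∀ᵐ t ∂(volume.restrict (Icc 0 T)), ∀ i, i = 0 ∨ i = 1 ∨ i = Fin.last (N + 1) →
      ∀ᵐ x ∂(volume.restrict Ω), aLo < a i t x ∧ a i t x < aHi := by
    refine ae_all_iff.2 fun i => ?_
    by_cases hi : i = 0 ∨ i = 1 ∨ i = Fin.last (N + 1)
    · filter_upwards [h.lt_lt i hi] with t ht _ using ht
    · exact ae_of_all _ fun t hi' => absurd hi' hi
  filter_upwards [h1, h2] with t h1t h2t
  have h2t' : ∀ᵐ x ∂(volume.restrict Ω), ∀ i, i = 0 ∨ i = 1 ∨ i = Fin.last (N + 1) →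
      aLo < a i t x ∧ a i t x < aHi := by
    refine ae_all_iff.2 fun i => ?_
    by_cases hi : i = 0 ∨ i = 1 ∨ i = Fin.last (N + 1)
    · filter_upwards [h2t i hi] with x hx _ using hx
    · exact ae_of_all _ fun t hi' => absurd hi' hi
  filter_upwards [ae_all_iff.2 h1t, h2t'] with x hx1 hx2
  exact ⟨fun i => (hx1 i).1, fun i => (hx1 i).2, fun i hi => (hx2 i hi).1.le⟩

/-- Fubini turns the bound on the time derivative into a Lipschitz bound along almost every path,
with one null set of x valid for all pairs of times. -/
theorem IsAdmissibleCoeff.variation (h : IsAdmissibleCoeff Ω T aLo aHi bHi a) :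
    ∀ᵐ x ∂(volume.restrict Ω), ∀ i, ∀ s ∈ Icc 0 T, ∀ t ∈ Icc 0 T, s ≤ t →
      |a i t x - a i s x| ≤ |bHi| * (t - s) := by
  refine ae_all_iff.2 fun i => ?_
  obtain ⟨a', ha', hder, hb⟩ := h.timeDeriv i
  have hms : MeasurableSet {p : ℝ × Space d | |a' p.1 p.2| < bHi} :=
    measurableSet_lt (_root_.continuous_abs.measurable.comp ha') measurable_const
  rw [Measure.ae_ae_comm hms] at hb
  refine HasPathDeriv.norm_sub_le hder ?_
  filter_upwards [hb] with x hx
  filter_upwards [hx] with t ht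
  exact ht.le.trans (le_abs_self _)

theorem IsAdmissiblePorosity.abs_le (hφLo : 0 < φLo) (h : IsAdmissiblePorosity Ω φLo φHi φ) :
    ∀ᵐ x ∂(volume.restrict Ω), |φ x| ≤ |φHi| := by
  filter_upwards [h.bounds] with x hx
  rw [abs_of_pos (hφLo.trans_le hx.1)]
  exact hx.2.trans (le_abs_self _)

theorem dataA_eq (hs : 1 < sExp α) (f Ψt : ℝ → Space d → ℝ) (gΨ : ℝ → Space d → Space d) :
    dataA Ω T α f Ψt gΨ = (∫⁻ t in Icc 0 T, ∫⁻ x in Ω, ‖f t x‖ₑ ^ 2) +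
      (∫⁻ t in Icc 0 T, ∫⁻ x in Ω, ‖Ψt t x‖ₑ ^ 2) +
      ∫⁻ t in Icc 0 T, ∫⁻ x in Ω, ‖gΨ t x‖ₑ ^ sConj α := by
  have hs' : 0 < sConj α := div_pos (by linarith) (by linarith)
  rw [dataA, bochnerNorm_two_sq, bochnerNorm_two_sq, bochnerNorm_rpow hs']

/-- Finiteness of 𝒜 puts almost every slice of f, Ψt and ∇Ψ in the right space; for ρt this follows
from ρt ∈ L¹(I, L²). -/
theorem isSlice_ae (hs : 1 < sExp α) (ha : IsAdmissibleCoeff Ω T aLo aHi bHi a)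
    (hΨ : IsAdmissibleData Ω T f Ψ Ψt gΨ) (hsol : IsWeakSolution Ω T α a φ f Ψt gΨ m dm ρ ρt)
    (hA : dataA Ω T α f Ψt gΨ ≠ ⊤) :
    ∀ᵐ t ∂(volume.restrict (Icc 0 T)), IsSlice Ω α aLo aHi φ (fun i => a i t) (f t) (Ψt t)
      (gΨ t) (m t) (dm t) (ρ t) (ρt t) := by
  have hs' : 0 < sConj α := div_pos (by linarith) (by linarith)
  rw [dataA_eq hs, ENNReal.add_ne_top, ENNReal.add_ne_top] at hA
  obtain ⟨⟨hA1, hA2⟩, hA3⟩ := hA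
  have hρt := hsol.ρt_integrable
  rw [bochnerNorm_one_two] at hρt
  filter_upwards [ha.coeffBound, hsol.m_mem, ae_restrict_mem measurableSet_Icc,
    ae_lt_top ((hsol.measurable_ρt.enorm.pow_const 2).lintegral_prod_right'.pow_const _) hρt.ne,
    ae_lt_top (hΨ.measurable_f.enorm.pow_const 2).lintegral_prod_right' hA1,
    ae_lt_top (hΨ.measurable_Ψt.enorm.pow_const 2).lintegral_prod_right' hA2,
    ae_lt_top (hΨ.measurable_gΨ.enorm.pow_const (sConj α)).lintegral_prod_right' hA3,
    hsol.momentum, hsol.continuity] with t h1 h2 h3 h4 h5 h6 h7 h8 h9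
  have h4' : ∫⁻ x in Ω, ‖ρt t x‖ₑ ^ 2 < ⊤ := by
    rwa [ENNReal.rpow_lt_top_iff_of_pos (by norm_num)] at h4
  exact
    { measurable_b := fun i => (ha.measurable i).of_uncurry_left
      coeff := h1
      measurable_m := hsol.measurable_m.of_uncurry_left
      m_mem := h2.1
      dm_mem := h2.2.1
      weakDiv := h2.2.2
      r_mem := hsol.ρ_mem t h3
      rt_mem := memLp_two_of_lintegral hsol.measurable_ρt.of_uncurry_left h4'
      f_mem := memLp_two_of_lintegral hΨ.measurable_f.of_uncurry_left h5
      ψ_mem := memLp_two_of_lintegral hΨ.measurable_Ψt.of_uncurry_left h6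
      measurable_g := hΨ.measurable_gΨ.of_uncurry_left
      g_integrable := by
        refine ⟨(hΨ.measurable_gΨ.of_uncurry_left.norm.pow_const _).aestronglyMeasurable, ?_⟩
        rw [hasFiniteIntegral_iff_enorm]
        refine lt_of_eq_of_lt (lintegral_congr fun x => ?_) h7
        exact Real.enorm_rpow_of_nonneg (norm_nonneg _) hs'.le |>.trans (by simp)
      momentum := h8
      continuity := h9 }

theorem IsWeakSolution.lintegral_sq_lt_top
    (hsol : IsWeakSolution Ω T α a φ f Ψt gΨ m dm ρ ρt) {t : ℝ} (ht : t ∈ Icc 0 T) :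
    ∫⁻ x in Ω, ‖ρ t x‖ₑ ^ 2 < ⊤ := by
  rw [← eLpNorm_two_sq]
  exact ENNReal.pow_lt_top (hsol.ρ_mem t ht).2

/-- Minkowski's inequality takes L¹(I, L²(Ω)) into L²(Ω, L¹(I)), the form required by
`exists_energy_bound`. -/
theorem IsWeakSolution.lintegral_path_lt_top
    (hsol : IsWeakSolution Ω T α a φ f Ψt gΨ m dm ρ ρt) :
    ∫⁻ x in Ω, (∫⁻ t in Icc 0 T, ‖ρt t x‖ₑ) ^ 2 < ⊤ := by
  refine (lintegral_sq_lintegral_le hsol.measurable_ρt.enorm).trans_lt ?_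
  have := hsol.ρt_integrable
  rw [bochnerNorm_one_two] at this
  exact ENNReal.pow_lt_top this

/-- The energy estimate in the form of iterated integrals. -/
theorem exists_energy_estimate (hΩb : Bornology.IsBounded Ω) (hT : 0 < T) (hN : 1 ≤ N)
    (hα : IsPowerVector N α) (aHi bHi φHi : ℝ) (haLo : 0 < aLo) (hφLo : 0 < φLo) :
    ∃ C : ℝ≥0∞, C ≠ ⊤ ∧ ∀ (a : Fin (N + 2) → ℝ → Space d → ℝ) (φ : Space d → ℝ)
      (f Ψ Ψt : ℝ → Space d → ℝ) (gΨ : ℝ → Space d → Space d) (m : ℝ → Space d → Space d)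
      (dm ρ ρt : ℝ → Space d → ℝ),
      IsAdmissibleCoeff Ω T aLo aHi bHi a → IsAdmissiblePorosity Ω φLo φHi φ →
      IsAdmissibleData Ω T f Ψ Ψt gΨ → IsWeakSolution Ω T α a φ f Ψt gΨ m dm ρ ρt →
      dataA Ω T α f Ψt gΨ ≠ ⊤ →
      (∀ t ∈ Icc 0 T, ∫⁻ x in Ω, ‖ρ t x‖ₑ ^ 2 ≤
        C * ((∫⁻ x in Ω, ‖ρ 0 x‖ₑ ^ 2) + dataA Ω T α f Ψt gΨ)) ∧
      ∫⁻ t in Icc 0 T, ∫⁻ x in Ω, ENNReal.ofReal (energyDensity α ‖m t x‖) ≤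
        C * ((∫⁻ x in Ω, ‖ρ 0 x‖ₑ ^ 2) + dataA Ω T α f Ψt gΨ) := by
  have hs := hα.two_lt_sExp hN
  have hs' : 0 < sConj α := div_pos (by linarith) (by linarith)
  have : IsFiniteMeasure (volume.restrict Ω) :=
    isFiniteMeasure_restrict.2 hΩb.measure_lt_top.ne
  obtain ⟨C₁, hC₁, hY⟩ := exists_young (sExp α) (by linarith) (half_pos haLo)
  obtain ⟨C₂, -, hEn⟩ := exists_energy_bound (μ := volume.restrict Ω) hφLo φHi hT
  set M : ℝ≥0∞ := ENNReal.ofReal C₂ *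
    (1 + 2 + 2 * ENNReal.ofReal (|φHi| ^ 2) + ENNReal.ofReal C₁) with hM
  have hMtop : M ≠ ⊤ := by finiteness
  refine ⟨M + ENNReal.ofReal (aLo / 2)⁻¹ * M, by finiteness, ?_⟩
  intro a φ f Ψ Ψt gΨ m dm ρ ρt ha hφ hΨ hsol hA
  have hφb := hφ.abs_le hφLo
  have hslice := isSlice_ae (by linarith) ha hΨ hsol hA
  rw [dataA_eq (by linarith)] at hA ⊢
  set IF := ∫⁻ t in Icc 0 T, ∫⁻ x in Ω, ‖f t x‖ₑ ^ 2 with hIF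
  set IP := ∫⁻ t in Icc 0 T, ∫⁻ x in Ω, ‖Ψt t x‖ₑ ^ 2 with hIP
  set IG := ∫⁻ t in Icc 0 T, ∫⁻ x in Ω, ‖gΨ t x‖ₑ ^ sConj α with hIG
  set R₀ := ∫⁻ x in Ω, ‖ρ 0 x‖ₑ ^ 2 with hR₀
  obtain ⟨⟨hA1, hA2⟩, hA3⟩ : (IF ≠ ⊤ ∧ IP ≠ ⊤) ∧ IG ≠ ⊤ := by
    rwa [ENNReal.add_ne_top, ENNReal.add_ne_top] at hA
  have hsrc : ∫⁻ t in Icc 0 T, ∫⁻ x in Ω, ‖f t x - φ x * Ψt t x‖ₑ ^ 2 ≤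
      2 * (IF + ENNReal.ofReal (|φHi| ^ 2) * IP) :=
    lintegral_lintegral_source_le hφb hΨ.measurable_f
  have hp : ∫⁻ t in Icc 0 T, ∫⁻ x in Ω, ENNReal.ofReal (C₁ * ‖gΨ t x‖ ^ sConj α) =
      ENNReal.ofReal C₁ * IG := by
    rw [hIG, ← lintegral_const_mul' _ _ (by simp)]
    refine lintegral_congr fun t => ?_
    rw [← lintegral_const_mul' _ _ (by simp)]
    refine lintegral_congr fun x => ?_
    rw [ENNReal.ofReal_mul hC₁.le, ← ENNReal.ofReal_rpow_of_nonneg (norm_nonneg _) hs'.le,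
      ofReal_norm]
  have hp0 : ∀ t x, 0 ≤ C₁ * ‖gΨ t x‖ ^ sConj α := fun t x => by positivity
  have hpfin : ∫⁻ t in Icc 0 T, ∫⁻ x in Ω, ENNReal.ofReal (C₁ * ‖gΨ t x‖ ^ sConj α) < ⊤ := by
    rw [hp]
    exact ENNReal.mul_lt_top (by simp) hA3.lt_top
  -- The source is f - φΨt, the dissipation e is aLo / 2 times the energy density, and p is the
  -- Young remainder of ∇Ψ.
  obtain ⟨hE1, hE2⟩ := hEn φ T ρ ρt (fun t x => f t x - φ x * Ψt t x)
    (fun t => ∫ x in Ω, aLo / 2 * energyDensity α ‖m t x‖)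
    (fun t => ∫ x in Ω, C₁ * ‖gΨ t x‖ ^ sConj α) hT.le le_rfl hφ.measurable hφ.bounds
    hsol.measurable_ρ hsol.measurable_ρt
    (hΨ.measurable_f.sub ((hφ.measurable.comp measurable_snd).mul hΨ.measurable_Ψt))
    hsol.timeDeriv_ρ (hsol.lintegral_sq_lt_top ⟨le_rfl, hT.le⟩) hsol.lintegral_path_lt_top
    (hsrc.trans_lt (by finiteness))
    (fun t => integral_nonneg fun x =>
      mul_nonneg (half_pos haLo).le (energyDensity_nonneg (norm_nonneg _)))
    (fun t => integral_nonneg (hp0 t))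
    (integrable_integral_of_lintegral
      ((hΨ.measurable_gΨ.norm.pow_const (sConj α)).const_mul C₁) hp0 hpfin)
    (by
      filter_upwards [hslice] with t ht
      exact ht.energy_le hα hN hY haLo.le hφ.measurable hφb)
  have hbase : ENNReal.ofReal C₂ * (R₀ + (∫⁻ t in Icc 0 T, ∫⁻ x in Ω,
      ‖f t x - φ x * Ψt t x‖ₑ ^ 2) + ∫⁻ t in Icc 0 T,
        ENNReal.ofReal (∫ x in Ω, C₁ * ‖gΨ t x‖ ^ sConj α)) ≤ M * (R₀ + (IF + IP + IG)) := by
    rw [hM, mul_assoc]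
    gcongr
    calc R₀ + (∫⁻ t in Icc 0 T, ∫⁻ x in Ω, ‖f t x - φ x * Ψt t x‖ₑ ^ 2) +
          ∫⁻ t in Icc 0 T, ENNReal.ofReal (∫ x in Ω, C₁ * ‖gΨ t x‖ ^ sConj α)
        ≤ R₀ + 2 * (IF + ENNReal.ofReal (|φHi| ^ 2) * IP) + ENNReal.ofReal C₁ * IG := by
          gcongr
          rw [← hp]
          exact lintegral_mono fun t => ofReal_integral_le_lintegral (hp0 t)
      _ = 1 * R₀ + 2 * IF + 2 * ENNReal.ofReal (|φHi| ^ 2) * IP + ENNReal.ofReal C₁ * IG := by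
          ring
      _ ≤ 1 * (R₀ + (IF + IP + IG)) + 2 * (R₀ + (IF + IP + IG)) +
            2 * ENNReal.ofReal (|φHi| ^ 2) * (R₀ + (IF + IP + IG)) +
            ENNReal.ofReal C₁ * (R₀ + (IF + IP + IG)) := by
          gcongr
          · exact le_self_add
          · exact (le_self_add.trans le_self_add).trans le_add_self
          · exact (le_add_self.trans le_self_add).trans le_add_self
          · exact le_add_self.trans le_add_self
      _ = _ := by ring
  refine ⟨fun t ht => ((hE1 t ht).trans hbase).trans (by gcongr; exact le_self_add), ?_⟩
  have hlow : ENNReal.ofReal (aLo / 2) *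
      ∫⁻ t in Icc 0 T, ∫⁻ x in Ω, ENNReal.ofReal (energyDensity α ‖m t x‖) =
      ∫⁻ t in Icc 0 T, ENNReal.ofReal (∫ x in Ω, aLo / 2 * energyDensity α ‖m t x‖) := by
    rw [← lintegral_const_mul' _ _ (by simp)]
    refine lintegral_congr_ae ?_
    filter_upwards [hslice] with t ht
    rw [integral_const_mul, ENNReal.ofReal_mul (half_pos haLo).le,
      ofReal_integral_eq_lintegral_ofReal (integrable_energyDensity hα (by linarith) ht.m_mem)
      (ae_of_all _ fun x => energyDensity_nonneg (norm_nonneg _))]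
  have hinv : ENNReal.ofReal (aLo / 2)⁻¹ * ENNReal.ofReal (aLo / 2) = 1 := by
    rw [← ENNReal.ofReal_mul (by positivity), inv_mul_cancel₀ (by positivity),
      ENNReal.ofReal_one]
  calc ∫⁻ t in Icc 0 T, ∫⁻ x in Ω, ENNReal.ofReal (energyDensity α ‖m t x‖)
      = ENNReal.ofReal (aLo / 2)⁻¹ * (ENNReal.ofReal (aLo / 2) *
        ∫⁻ t in Icc 0 T, ∫⁻ x in Ω, ENNReal.ofReal (energyDensity α ‖m t x‖)) := by
        rw [← mul_assoc, hinv, one_mul]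
    _ ≤ ENNReal.ofReal (aLo / 2)⁻¹ * (M * (R₀ + (IF + IP + IG))) := by
        gcongr ENNReal.ofReal (aLo / 2)⁻¹ * ?_
        rw [hlow]
        exact hE2.trans hbase
    _ ≤ _ := by
        rw [← mul_assoc]
        gcongr
        exact le_add_self

end Estimates


/-! ### The estimate of the time derivatives -/

section Higher

variable {d : ℕ} {Ω : Set (Space d)} {T : ℝ} {N : ℕ} {α : Fin (N + 2) → ℝ}
  {aLo aHi bHi φLo φHi : ℝ}

theorem measurable_uncurry_shift {X Y : Type*} [MeasurableSpace X] [MeasurableSpace Y] (k : ℝ)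
    {D : ℝ → X → Y} (hD : Measurable (Function.uncurry D)) :
    Measurable (Function.uncurry fun t => D (t + k)) :=
  hD.comp ((measurable_fst.add_const k).prodMk measurable_snd)

theorem lintegral_increment_path_lt_top {X : Type*} [MeasurableSpace X] {μ : Measure X}
    {ρt : ℝ → X → ℝ} (hρt : Measurable (Function.uncurry ρt))
    (h : ∫⁻ x, (∫⁻ t in Icc 0 T, ‖ρt t x‖ₑ) ^ 2 ∂μ < ⊤) {k : ℝ} (hk : 0 ≤ k) :
    ∫⁻ x, (∫⁻ t in Icc 0 (T - k), ‖timeIncrement k ρt t x‖ₑ) ^ 2 ∂μ < ⊤ := by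
  refine lt_of_le_of_lt (b := ∫⁻ x, 4 * (∫⁻ t in Icc 0 T, ‖ρt t x‖ₑ) ^ 2 ∂μ)
    (lintegral_mono fun x => ?_) ?_
  · have hm : Measurable fun t => ‖ρt (t + k) x‖ₑ :=
      (hρt.of_uncurry_right.comp (measurable_add_const k)).enorm
    have h1 : ∫⁻ t in Icc 0 (T - k), ‖timeIncrement k ρt t x‖ₑ ≤
        2 * ∫⁻ t in Icc 0 T, ‖ρt t x‖ₑ := by
      calc ∫⁻ t in Icc 0 (T - k), ‖timeIncrement k ρt t x‖ₑ
          ≤ ∫⁻ t in Icc 0 (T - k), (‖ρt (t + k) x‖ₑ + ‖ρt t x‖ₑ) :=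
            lintegral_mono fun t => enorm_sub_le
        _ = (∫⁻ t in Icc 0 (T - k), ‖ρt (t + k) x‖ₑ) + ∫⁻ t in Icc 0 (T - k), ‖ρt t x‖ₑ :=
            lintegral_add_left hm _
        _ ≤ (∫⁻ t in Icc 0 T, ‖ρt t x‖ₑ) + ∫⁻ t in Icc 0 T, ‖ρt t x‖ₑ := by
            refine add_le_add ?_ (lintegral_mono_set (Icc_subset_Icc_right (by linarith)))
            exact setLIntegral_Icc_shift_le (fun t => ‖ρt t x‖ₑ) hk (by linarith)
        _ = _ := (two_mul _).symm
    calc (∫⁻ t in Icc 0 (T - k), ‖timeIncrement k ρt t x‖ₑ) ^ 2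
        ≤ (2 * ∫⁻ t in Icc 0 T, ‖ρt t x‖ₑ) ^ 2 := by gcongr
      _ = _ := by rw [mul_pow]; norm_num
  · rw [lintegral_const_mul' _ _ (by simp)]
    exact ENNReal.mul_lt_top (by simp) h

/-- For D the energy density of m: the terms at t and at t + k each integrate to at most the
integral over [0, T], hence the factor 2. -/
theorem lintegral_error_le {X : Type*} [MeasurableSpace X] {μ : Measure X} [SFinite μ]
    {D : ℝ → X → ℝ} {g : ℝ → X → Space d} (hD : Measurable (Function.uncurry D))
    (hD0 : ∀ t x, 0 ≤ D t x) {C c k : ℝ} (hC : 0 ≤ C)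
    (hc : 0 ≤ c) (hk : 0 ≤ k) :
    ∫⁻ t in Icc 0 (T - k), ∫⁻ x, ENNReal.ofReal
        (C * k ^ 2 * (D (t + k) x + D t x) + c * ‖g (t + k) x - g t x‖ ^ 2) ∂μ ≤
      ENNReal.ofReal (C * k ^ 2) * (2 * ∫⁻ t in Icc 0 T, ∫⁻ x, ENNReal.ofReal (D t x) ∂μ) +
      ENNReal.ofReal c * ∫⁻ t in Icc 0 (T - k), ∫⁻ x, ‖timeIncrement k g t x‖ₑ ^ 2 ∂μ := by
  have hDm : Measurable (Function.uncurry fun t x => ENNReal.ofReal (D t x)) := hD.ennreal_ofReal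
  have hDm' : Measurable (Function.uncurry fun t x => ENNReal.ofReal (D (t + k) x)) :=
    measurable_uncurry_shift k hDm
  have e1 : ∀ t x, ENNReal.ofReal
      (C * k ^ 2 * (D (t + k) x + D t x) + c * ‖g (t + k) x - g t x‖ ^ 2) =
        ENNReal.ofReal (C * k ^ 2) * (ENNReal.ofReal (D (t + k) x) + ENNReal.ofReal (D t x)) +
          ENNReal.ofReal c * ‖timeIncrement k g t x‖ₑ ^ 2 := by
    intro t x
    have h1 := hD0 (t + k) x
    have h2 := hD0 t x
    rw [ENNReal.ofReal_add (by positivity) (by positivity), ENNReal.ofReal_mul (by positivity),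
      ENNReal.ofReal_add h1 h2, ENNReal.ofReal_mul hc, ENNReal.ofReal_pow (norm_nonneg _),
      ofReal_norm, timeIncrement]
  have e2 : ∀ t, ∫⁻ x, ENNReal.ofReal
      (C * k ^ 2 * (D (t + k) x + D t x) + c * ‖g (t + k) x - g t x‖ ^ 2) ∂μ =
      ENNReal.ofReal (C * k ^ 2) *
        (∫⁻ x, ENNReal.ofReal (D (t + k) x) ∂μ + ∫⁻ x, ENNReal.ofReal (D t x) ∂μ) +
        ENNReal.ofReal c * ∫⁻ x, ‖timeIncrement k g t x‖ₑ ^ 2 ∂μ := by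
    intro t
    have r1 : Measurable fun x => ENNReal.ofReal (D t x) := hDm.of_uncurry_left
    have r2 : Measurable fun x => ENNReal.ofReal (D (t + k) x) := hDm'.of_uncurry_left
    have r3 : Measurable fun x => ENNReal.ofReal (D (t + k) x) + ENNReal.ofReal (D t x) := r2.add r1
    simp_rw [e1]
    rw [lintegral_add_left (r3.const_mul _), lintegral_const_mul' _ _ (by simp),
      lintegral_const_mul' _ _ (by simp), lintegral_add_left r2]
  have s1 : Measurable fun t => ∫⁻ x, ENNReal.ofReal (D t x) ∂μ := hDm.lintegral_prod_right'
  have s2 : Measurable fun t => ∫⁻ x, ENNReal.ofReal (D (t + k) x) ∂μ :=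
    hDm'.lintegral_prod_right'
  have s3 : Measurable fun t => ∫⁻ x, ENNReal.ofReal (D (t + k) x) ∂μ +
    ∫⁻ x, ENNReal.ofReal (D t x) ∂μ := s2.add s1
  simp_rw [e2]
  rw [lintegral_add_left (s3.const_mul _), lintegral_const_mul' _ _ (by simp),
    lintegral_const_mul' _ _ (by simp), lintegral_add_left s2, two_mul]
  refine add_le_add (mul_le_mul_right (add_le_add ?_ ?_) _) le_rfl
  · exact setLIntegral_Icc_shift_le (fun t => ∫⁻ x, ENNReal.ofReal (D t x) ∂μ) hk (by linarith)
  · exact lintegral_mono_set (Icc_subset_Icc_right (by linarith))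

/-- The estimate of the increments in time. -/
theorem exists_increment_estimate (hΩb : Bornology.IsBounded Ω) (hT : 0 < T) (hN : 1 ≤ N)
    (hα : IsPowerVector N α) (aHi bHi φHi : ℝ) (haLo : 0 < aLo) (hφLo : 0 < φLo) :
    ∃ C : ℝ≥0∞, C ≠ ⊤ ∧ ∀ (a : Fin (N + 2) → ℝ → Space d → ℝ) (φ : Space d → ℝ)
      (f Ψ Ψt : ℝ → Space d → ℝ) (gΨ : ℝ → Space d → Space d) (m : ℝ → Space d → Space d)
      (dm ρ ρt : ℝ → Space d → ℝ) (ft Ψtt : ℝ → Space d → ℝ) (gΨt : ℝ → Space d → Space d),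
      IsAdmissibleCoeff Ω T aLo aHi bHi a → IsAdmissiblePorosity Ω φLo φHi φ →
      IsAdmissibleData Ω T f Ψ Ψt gΨ → IsWeakSolution Ω T α a φ f Ψt gΨ m dm ρ ρt →
      Measurable (Function.uncurry ft) → HasTimeDeriv Ω T f ft →
      Measurable (Function.uncurry Ψtt) → HasTimeDeriv Ω T Ψt Ψtt →
      Measurable (Function.uncurry gΨt) → HasTimeDeriv Ω T gΨ gΨt →
      dataB Ω T α f ft Ψt Ψtt gΨ gΨt ≠ ⊤ → ∀ k, 0 < k → k < T →
      (∀ t ∈ Icc 0 (T - k), ∫⁻ x in Ω, ‖timeIncrement k ρ t x‖ₑ ^ 2 ≤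
        C * ((∫⁻ x in Ω, ‖timeIncrement k ρ 0 x‖ₑ ^ 2) + ENNReal.ofReal (k ^ 2) *
          ((∫⁻ x in Ω, ‖ρ 0 x‖ₑ ^ 2) + dataB Ω T α f ft Ψt Ψtt gΨ gΨt))) ∧
      ∫⁻ t in Icc 0 (T - k), ∫⁻ x in Ω, ‖timeIncrement k m t x‖ₑ ^ 2 ≤
        C * ((∫⁻ x in Ω, ‖timeIncrement k ρ 0 x‖ₑ ^ 2) + ENNReal.ofReal (k ^ 2) *
          ((∫⁻ x in Ω, ‖ρ 0 x‖ₑ ^ 2) + dataB Ω T α f ft Ψt Ψtt gΨ gΨt)) := by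
  have hs := hα.two_lt_sExp hN
  have : IsFiniteMeasure (volume.restrict Ω) :=
    isFiniteMeasure_restrict.2 hΩb.measure_lt_top.ne
  obtain ⟨c, C₁, hc, hC₁, hmono⟩ := exists_flux_mono (E := Space d) (aHi := aHi) hα hN haLo
    (abs_nonneg bHi)
  obtain ⟨C₂, -, hEn⟩ := exists_energy_bound (μ := volume.restrict Ω) hφLo φHi hT
  obtain ⟨C₃, hC₃, hfirst⟩ := exists_energy_estimate (Ω := Ω) hΩb hT hN hα aHi bHi φHi haLo hφLo
  -- The summand with 2 * C₃ comes from the variation of the coefficients: two energy densities,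
  -- each bounded by the first estimate.
  set M : ℝ≥0∞ := ENNReal.ofReal C₂ * (1 + 2 + 2 * ENNReal.ofReal (|φHi| ^ 2) +
    ENNReal.ofReal C₁ * (2 * C₃) + ENNReal.ofReal (2 * c)⁻¹) with hM
  have hMtop : M ≠ ⊤ := by finiteness
  refine ⟨M + ENNReal.ofReal (c / 2)⁻¹ * M, by finiteness, ?_⟩
  intro a φ f Ψ Ψt gΨ m dm ρ ρt ft Ψtt gΨt ha hφ hΨ hsol hft hfd hΨtt hΨd hgΨt hgd hB k hk hkT
  have hφb := hφ.abs_le hφLo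
  have hA : dataA Ω T α f Ψt gΨ ≠ ⊤ := by
    refine ne_top_of_le_ne_top hB ?_
    unfold dataB
    rw [add_assoc, add_assoc]
    exact le_self_add
  have hE := (hfirst a φ f Ψ Ψt gΨ m dm ρ ρt ha hφ hΨ hsol hA).2
  have hslice := isSlice_ae (by linarith) ha hΨ hsol hA
  rw [dataB, bochnerNorm_two_sq, bochnerNorm_two_sq, bochnerNorm_two_sq] at hB ⊢
  set IA := dataA Ω T α f Ψt gΨ with hIA
  set IF := ∫⁻ t in Icc 0 T, ∫⁻ x in Ω, ‖ft t x‖ₑ ^ 2 with hIF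
  set IP := ∫⁻ t in Icc 0 T, ∫⁻ x in Ω, ‖Ψtt t x‖ₑ ^ 2 with hIP
  set IG := ∫⁻ t in Icc 0 T, ∫⁻ x in Ω, ‖gΨt t x‖ₑ ^ 2 with hIG
  set R₀ := ∫⁻ x in Ω, ‖ρ 0 x‖ₑ ^ 2 with hR₀
  set I := ∫⁻ t in Icc 0 T, ∫⁻ x in Ω, ENNReal.ofReal (energyDensity α ‖m t x‖) with hI
  set W₀ := ∫⁻ x in Ω, ‖timeIncrement k ρ 0 x‖ₑ ^ 2 with hW₀
  obtain ⟨⟨⟨-, hB1⟩, hB2⟩, hB3⟩ : ((IA ≠ ⊤ ∧ IF ≠ ⊤) ∧ IP ≠ ⊤) ∧ IG ≠ ⊤ := by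
    rwa [ENNReal.add_ne_top, ENNReal.add_ne_top, ENNReal.add_ne_top] at hB
  have h0T : (0 : ℝ) ∈ Icc 0 T := ⟨le_rfl, hT.le⟩
  have hR₀top : R₀ ≠ ⊤ := (hsol.lintegral_sq_lt_top h0T).ne
  have hItop : I ≠ ⊤ := ne_top_of_le_ne_top (by finiteness) hE
  have hW₀top : W₀ < ⊤ := by
    have hm : MemLp (fun x => ρ (0 + k) x - ρ 0 x) 2 (volume.restrict Ω) :=
      (hsol.ρ_mem (0 + k) ⟨by linarith, by linarith⟩).sub (hsol.ρ_mem 0 h0T)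
    have := ENNReal.pow_lt_top (n := 2) hm.2
    rwa [eLpNorm_two_sq] at this
  have hsrc : ∫⁻ t in Icc 0 (T - k), ∫⁻ x in Ω,
      ‖timeIncrement k f t x - φ x * timeIncrement k Ψt t x‖ₑ ^ 2 ≤
      ENNReal.ofReal (k ^ 2) * (2 * (IF + ENNReal.ofReal (|φHi| ^ 2) * IP)) := by
    refine (lintegral_lintegral_source_le hφb (measurable_timeIncrement k hΨ.measurable_f)).trans ?_
    have e1 := HasPathDeriv.lintegral_increment_sq_le hk.le hfd hΨ.measurable_f hft
    have e2 := HasPathDeriv.lintegral_increment_sq_le hk.le hΨd hΨ.measurable_Ψt hΨtt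
    refine (mul_le_mul_right (add_le_add e1 (mul_le_mul_right e2 _)) _).trans_eq ?_
    ring
  have hgd2 := HasPathDeriv.lintegral_increment_sq_le hk.le hgd hΨ.measurable_gΨ hgΨt
  have hem : Measurable (Function.uncurry fun t x => energyDensity α ‖m t x‖) :=
    measurable_energyDensity.comp hsol.measurable_m.norm
  have hem' : Measurable (Function.uncurry fun t x => energyDensity α ‖m (t + k) x‖) :=
    measurable_uncurry_shift k hem
  have hgm := measurable_timeIncrement k hΨ.measurable_gΨ
  have hen0 : ∀ t x, 0 ≤ energyDensity α ‖m t x‖ := fun t x => energyDensity_nonneg (norm_nonneg _)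
  have herr := lintegral_error_le (T := T) (μ := volume.restrict Ω) hem hen0 (g := gΨ)
    hC₁.le (c := (2 * c)⁻¹) (by positivity) hk.le
  obtain ⟨p, hp⟩ : ∃ p : ℝ → Space d → ℝ, p = fun t x =>
      C₁ * k ^ 2 * (energyDensity α ‖m (t + k) x‖ + energyDensity α ‖m t x‖) +
      (2 * c)⁻¹ * ‖gΨ (t + k) x - gΨ t x‖ ^ 2 := ⟨_, rfl⟩
  have hp0 : ∀ t x, 0 ≤ p t x := fun t x => by
    have := hen0 t x
    have := hen0 (t + k) x
    rw [hp]
    positivity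
  have hpm : Measurable (Function.uncurry p) := by
    rw [hp]
    exact ((hem'.add hem).const_mul _).add ((hgm.norm.pow_const 2).const_mul _)
  have hpint : ∫⁻ t in Icc 0 (T - k), ∫⁻ x in Ω, ENNReal.ofReal (p t x) ≤
      ENNReal.ofReal (k ^ 2) *
        (ENNReal.ofReal C₁ * (2 * I) + ENNReal.ofReal (2 * c)⁻¹ * IG) := by
    have h1 : ∫⁻ t in Icc 0 (T - k), ∫⁻ x in Ω, ENNReal.ofReal (p t x) ≤
        ENNReal.ofReal (C₁ * k ^ 2) * (2 * I) + ENNReal.ofReal (2 * c)⁻¹ *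
          ∫⁻ t in Icc 0 (T - k), ∫⁻ x in Ω, ‖timeIncrement k gΨ t x‖ₑ ^ 2 := by
      rw [hp]
      exact herr
    refine (h1.trans (add_le_add le_rfl (mul_le_mul_right hgd2 _))).trans_eq ?_
    rw [ENNReal.ofReal_mul hC₁.le]
    ring
  have hpfin : ∫⁻ t in Icc 0 (T - k), ∫⁻ x in Ω, ENNReal.ofReal (p t x) < ⊤ :=
    hpint.trans_lt (by finiteness)
  have hgfin : ∀ᵐ t ∂(volume.restrict (Icc 0 (T - k))),
      ∫⁻ x in Ω, ‖timeIncrement k gΨ t x‖ₑ ^ 2 < ⊤ :=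
    ae_lt_top (hgm.enorm.pow_const 2).lintegral_prod_right'
      (hgd2.trans_lt (by finiteness)).ne
  have hvar : ∀ t ∈ Icc 0 (T - k), ∀ᵐ x ∂(volume.restrict Ω), ∀ i,
      |a i (t + k) x - a i t x| ≤ |bHi| * k := by
    intro t ht
    filter_upwards [ha.variation] with x hx i
    have := hx i t ⟨ht.1, by linarith [ht.2]⟩ (t + k) ⟨by linarith [ht.1], by linarith [ht.2]⟩
      (by linarith)
    rwa [add_sub_cancel_left] at this
  -- The same energy bound, now for the increments of ρ; the source and p are of order k² by `hsrc`
  -- and `hpint`.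
  obtain ⟨hE1, hE2⟩ := hEn φ (T - k) (timeIncrement k ρ) (timeIncrement k ρt)
    (fun t x => timeIncrement k f t x - φ x * timeIncrement k Ψt t x)
    (fun t => ∫ x in Ω, c / 2 * ‖m (t + k) x - m t x‖ ^ 2)
    (fun t => ∫ x in Ω, p t x) (by linarith) (by linarith) hφ.measurable hφ.bounds
    (measurable_timeIncrement k hsol.measurable_ρ) (measurable_timeIncrement k hsol.measurable_ρt)
    ((measurable_timeIncrement k hΨ.measurable_f).sub ((hφ.measurable.comp measurable_snd).mul
      (measurable_timeIncrement k hΨ.measurable_Ψt)))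
    (HasPathDeriv.increment hk.le hkT.le hsol.timeDeriv_ρ) hW₀top
    (lintegral_increment_path_lt_top hsol.measurable_ρt hsol.lintegral_path_lt_top hk.le)
    (hsrc.trans_lt (by finiteness))
    (fun t => integral_nonneg fun x => by positivity) (fun t => integral_nonneg (hp0 t))
    (integrable_integral_of_lintegral hpm hp0 hpfin)
    (by
      filter_upwards [ae_restrict_Icc_shift hk.le hslice, ae_restrict_mem measurableSet_Icc, hgfin]
        with t ht htI hg
      rw [hp]
      refine IsSlice.energy_sub_le hα hN hc hmono hk.le (hvar t htI) ht.1 ht.2 hφ.measurable hφb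
        ⟨hgm.of_uncurry_left.aestronglyMeasurable, ?_⟩
      have hg' := hg
      rw [← eLpNorm_two_sq, ENNReal.pow_lt_top_iff] at hg'
      exact hg'.resolve_right (by norm_num))
  set D := W₀ + ENNReal.ofReal (k ^ 2) * (R₀ + (IA + IF + IP + IG)) with hD
  have hbase : ENNReal.ofReal C₂ * (W₀ + (∫⁻ t in Icc 0 (T - k), ∫⁻ x in Ω,
      ‖timeIncrement k f t x - φ x * timeIncrement k Ψt t x‖ₑ ^ 2) +
      ∫⁻ t in Icc 0 (T - k), ENNReal.ofReal (∫ x in Ω, p t x)) ≤ M * D := by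
    rw [hM, mul_assoc]
    gcongr
    set κ := ENNReal.ofReal (k ^ 2) with hκ
    have hIF' : κ * IF ≤ D :=
      (mul_le_mul_right (le_add_self.trans (le_self_add.trans (le_self_add.trans le_add_self))) _).trans
        le_add_self
    have hIP' : κ * IP ≤ D :=
      (mul_le_mul_right (le_add_self.trans (le_self_add.trans le_add_self)) _).trans le_add_self
    have hIG' : κ * IG ≤ D :=
      (mul_le_mul_right (le_add_self.trans le_add_self) _).trans le_add_self
    have hIA' : κ * (R₀ + IA) ≤ D :=
      (mul_le_mul_right (add_le_add le_rfl (le_self_add.trans (le_self_add.trans le_self_add))) _).trans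
        le_add_self
    calc W₀ + (∫⁻ t in Icc 0 (T - k), ∫⁻ x in Ω,
          ‖timeIncrement k f t x - φ x * timeIncrement k Ψt t x‖ₑ ^ 2) +
          ∫⁻ t in Icc 0 (T - k), ENNReal.ofReal (∫ x in Ω, p t x)
        ≤ W₀ + κ * (2 * (IF + ENNReal.ofReal (|φHi| ^ 2) * IP)) +
            κ * (ENNReal.ofReal C₁ * (2 * (C₃ * (R₀ + IA))) + ENNReal.ofReal (2 * c)⁻¹ * IG) := by
          refine add_le_add (add_le_add le_rfl hsrc) ?_
          refine (lintegral_mono fun t => ofReal_integral_le_lintegral (hp0 t)).trans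
            (hpint.trans ?_)
          gcongr
      _ = 1 * W₀ + 2 * (κ * IF) + 2 * ENNReal.ofReal (|φHi| ^ 2) * (κ * IP) +
            ENNReal.ofReal C₁ * (2 * C₃) * (κ * (R₀ + IA)) +
            ENNReal.ofReal (2 * c)⁻¹ * (κ * IG) := by ring
      _ ≤ 1 * D + 2 * D + 2 * ENNReal.ofReal (|φHi| ^ 2) * D +
            ENNReal.ofReal C₁ * (2 * C₃) * D + ENNReal.ofReal (2 * c)⁻¹ * D := by
          gcongr
          exact le_self_add
      _ = _ := by ring
  refine ⟨fun t ht => ((hE1 t ht).trans hbase).trans (by gcongr; exact le_self_add), ?_⟩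
  have hlow : ENNReal.ofReal (c / 2) *
      ∫⁻ t in Icc 0 (T - k), ∫⁻ x in Ω, ‖timeIncrement k m t x‖ₑ ^ 2 =
      ∫⁻ t in Icc 0 (T - k), ENNReal.ofReal (∫ x in Ω, c / 2 * ‖m (t + k) x - m t x‖ ^ 2) := by
    rw [← lintegral_const_mul' _ _ (by simp)]
    refine lintegral_congr_ae ?_
    filter_upwards [ae_restrict_Icc_shift hk.le hslice] with t ht
    have hs2 : (2 : ℝ≥0∞) ≤ ENNReal.ofReal (sExp α) := by
      rw [← ENNReal.ofReal_ofNat]; exact ENNReal.ofReal_le_ofReal hs.le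
    have hi : Integrable (fun x => ‖m (t + k) x - m t x‖ ^ 2) (volume.restrict Ω) :=
      ((ht.2.m_mem.sub ht.1.m_mem).mono_exponent hs2).integrable_norm_pow (by norm_num)
    rw [integral_const_mul, ENNReal.ofReal_mul (half_pos hc).le,
      ofReal_integral_eq_lintegral_ofReal hi (ae_of_all _ fun x => by positivity)]
    congr 1
    refine lintegral_congr fun x => ?_
    rw [ENNReal.ofReal_pow (norm_nonneg _), ofReal_norm]
    rfl
  have hinv : ENNReal.ofReal (c / 2)⁻¹ * ENNReal.ofReal (c / 2) = 1 := by
    rw [← ENNReal.ofReal_mul (by positivity), inv_mul_cancel₀ (by positivity),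
      ENNReal.ofReal_one]
  calc ∫⁻ t in Icc 0 (T - k), ∫⁻ x in Ω, ‖timeIncrement k m t x‖ₑ ^ 2
      = ENNReal.ofReal (c / 2)⁻¹ * (ENNReal.ofReal (c / 2) *
        ∫⁻ t in Icc 0 (T - k), ∫⁻ x in Ω, ‖timeIncrement k m t x‖ₑ ^ 2) := by
        rw [← mul_assoc, hinv, one_mul]
    _ ≤ ENNReal.ofReal (c / 2)⁻¹ * (M * D) := by
        gcongr ENNReal.ofReal (c / 2)⁻¹ * ?_
        rw [hlow]
        exact hE2.trans hbase
    _ ≤ _ := by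
        rw [← mul_assoc]
        gcongr
        exact le_add_self

end Higher


/-! ### From difference quotients to time derivatives -/

section Limit

variable {d : ℕ} {Ω : Set (Space d)} {T : ℝ} {N : ℕ} {α : Fin (N + 2) → ℝ}
  {aLo aHi bHi φLo φHi : ℝ}

theorem enorm_inv_smul_sq {E : Type*} [NormedAddCommGroup E] [NormedSpace ℝ E] (k : ℝ) (v : E) :
    ‖k⁻¹ • v‖ₑ ^ 2 = ENNReal.ofReal ((k ^ 2)⁻¹) * ‖v‖ₑ ^ 2 := by
  rw [enorm_smul, mul_pow, enorm_sq_eq_ofReal, inv_pow]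

theorem ofReal_inv_sq_mul_le {k : ℝ} (hk : 0 < k) {U C A D : ℝ≥0∞}
    (h : U ≤ C * (A + ENNReal.ofReal (k ^ 2) * D)) :
    ENNReal.ofReal ((k ^ 2)⁻¹) * U ≤ C * (ENNReal.ofReal ((k ^ 2)⁻¹) * A + D) := by
  have h1 : ENNReal.ofReal ((k ^ 2)⁻¹) * ENNReal.ofReal (k ^ 2) = 1 := by
    rw [← ENNReal.ofReal_mul (by positivity), inv_mul_cancel₀ (by positivity), ENNReal.ofReal_one]
  calc ENNReal.ofReal ((k ^ 2)⁻¹) * U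
      ≤ ENNReal.ofReal ((k ^ 2)⁻¹) * (C * (A + ENNReal.ofReal (k ^ 2) * D)) := by gcongr
    _ = C * (ENNReal.ofReal ((k ^ 2)⁻¹) * A +
          ENNReal.ofReal ((k ^ 2)⁻¹) * ENNReal.ofReal (k ^ 2) * D) := by ring
    _ = _ := by rw [h1, one_mul]

theorem measurable_uncurry_quotient {X : Type*} [MeasurableSpace X] {E : Type*}
    [NormedAddCommGroup E] [NormedSpace ℝ E] [MeasurableSpace E] [BorelSpace E]
    [SecondCountableTopology E] {u : ℝ → X → E} (hu : Measurable (Function.uncurry u)) (k : ℝ) :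
    Measurable (Function.uncurry fun t x => ‖k⁻¹ • timeIncrement k u t x‖ₑ ^ 2) :=
  ((measurable_timeIncrement k hu).const_smul (k⁻¹)).enorm.pow_const 2

/-- Write the quotient as (quotient - w) + w; the first part tends to 0 in L² when w is the initial
time derivative. -/
theorem lintegral_initial_le {X : Type*} [MeasurableSpace X] {μ : Measure X} {k : ℝ}
    {u w : X → ℝ} (hw : AEMeasurable w μ) :
    ENNReal.ofReal ((k ^ 2)⁻¹) * ∫⁻ x, ‖u x‖ₑ ^ 2 ∂μ ≤
      2 * (eLpNorm (fun x => k⁻¹ * u x - w x) 2 μ ^ 2 + ∫⁻ x, ‖w x‖ₑ ^ 2 ∂μ) := by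
  rw [eLpNorm_two_sq, ← lintegral_add_right' _ (hw.enorm.pow_const 2),
    ← lintegral_const_mul' _ _ (by simp), ← lintegral_const_mul' _ _ (by simp)]
  refine lintegral_mono fun x => ?_
  calc ENNReal.ofReal ((k ^ 2)⁻¹) * ‖u x‖ₑ ^ 2 = ‖(k⁻¹ * u x - w x) + w x‖ₑ ^ 2 := by
        rw [sub_add_cancel, enorm_mul, mul_pow, enorm_sq_eq_ofReal k⁻¹, inv_pow]
    _ ≤ _ := (pow_le_pow_left' (enorm_add_le _ _) 2).trans (add_sq_le_ennreal _ _)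

theorem sq_le_liminf_of_tendsto {E : Type*} [NormedAddCommGroup E] {u : ℕ → E} {v : E}
    (h : Tendsto u atTop (𝓝 v)) : ‖v‖ₑ ^ 2 ≤ liminf (fun n => ‖u n‖ₑ ^ 2) atTop :=
  (ENNReal.Tendsto.pow ((continuous_enorm.tendsto v).comp h)).liminf_eq.ge

/-- The estimate of the time derivatives in the form of iterated integrals. -/
theorem exists_timeDeriv_estimate (hΩb : Bornology.IsBounded Ω) (hT : 0 < T) (hN : 1 ≤ N)
    (hα : IsPowerVector N α) (aHi bHi φHi : ℝ) (haLo : 0 < aLo) (hφLo : 0 < φLo) :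
    ∃ C : ℝ≥0∞, C ≠ ⊤ ∧ ∀ (a : Fin (N + 2) → ℝ → Space d → ℝ) (φ : Space d → ℝ)
      (f Ψ Ψt : ℝ → Space d → ℝ) (gΨ : ℝ → Space d → Space d) (m : ℝ → Space d → Space d)
      (dm ρ ρt : ℝ → Space d → ℝ) (ft Ψtt : ℝ → Space d → ℝ) (gΨt mt : ℝ → Space d → Space d)
      (ρt₀ : Space d → ℝ),
      IsAdmissibleCoeff Ω T aLo aHi bHi a → IsAdmissiblePorosity Ω φLo φHi φ →
      IsAdmissibleData Ω T f Ψ Ψt gΨ → IsWeakSolution Ω T α a φ f Ψt gΨ m dm ρ ρt →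
      Measurable (Function.uncurry ft) → HasTimeDeriv Ω T f ft →
      Measurable (Function.uncurry Ψtt) → HasTimeDeriv Ω T Ψt Ψtt →
      Measurable (Function.uncurry gΨt) → HasTimeDeriv Ω T gΨ gΨt →
      Measurable (Function.uncurry mt) → HasTimeDeriv Ω T m mt →
      IsInitialTimeDeriv Ω ρ ρt₀ → dataB Ω T α f ft Ψt Ψtt gΨ gΨt ≠ ⊤ →
      (∀ᵐ t ∂(volume.restrict (Icc 0 T)), ∫⁻ x in Ω, ‖ρt t x‖ₑ ^ 2 ≤
        C * (dataB₀ Ω (ρ 0) ρt₀ + dataB Ω T α f ft Ψt Ψtt gΨ gΨt)) ∧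
      ∫⁻ t in Icc 0 T, ∫⁻ x in Ω, ‖mt t x‖ₑ ^ 2 ≤
        C * (dataB₀ Ω (ρ 0) ρt₀ + dataB Ω T α f ft Ψt Ψtt gΨ gΨt) := by
  obtain ⟨C, hC, hinc⟩ := exists_increment_estimate (Ω := Ω) hΩb hT hN hα aHi bHi φHi haLo hφLo
  refine ⟨2 * C, by finiteness, ?_⟩
  intro a φ f Ψ Ψt gΨ m dm ρ ρt ft Ψtt gΨt mt ρt₀ ha hφ hΨ hsol hft hfd hΨtt hΨd hgΨt hgd hmt hmd
    hinit hB
  have hest := hinc a φ f Ψ Ψt gΨ m dm ρ ρt ft Ψtt gΨt ha hφ hΨ hsol hft hfd hΨtt hΨd hgΨt hgd hB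
  rw [dataB₀, normL2_sq, normL2_sq]
  set B := dataB Ω T α f ft Ψt Ψtt gΨ gΨt with hBdef
  set R₀ := ∫⁻ x in Ω, ‖ρ 0 x‖ₑ ^ 2 with hR₀
  set R₁ := ∫⁻ x in Ω, ‖ρt₀ x‖ₑ ^ 2 with hR₁
  -- The shift by 2 keeps every step strictly between 0 and T.
  set k : ℕ → ℝ := fun n => T / (n + 2) with hk
  have hkpos : ∀ n, 0 < k n := fun n => by positivity
  have hklt : ∀ n, k n < T := fun n => by
    rw [hk, div_lt_iff₀ (by positivity)]
    nlinarith [(Nat.cast_nonneg n : (0 : ℝ) ≤ n)]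
  have hklim : Tendsto k atTop (𝓝 0) := by
    have h1 : Tendsto (fun n : ℕ => (n : ℝ) + 2) atTop atTop :=
      tendsto_atTop_add_const_right _ _ tendsto_natCast_atTop_atTop
    exact tendsto_const_nhds.div_atTop h1
  have hklim' : Tendsto k atTop (𝓝[>] 0) :=
    tendsto_nhdsWithin_iff.2 ⟨hklim, Eventually.of_forall hkpos⟩
  set δ : ℕ → ℝ≥0∞ := fun n => eLpNorm
    (fun x => (k n)⁻¹ * timeIncrement (k n) ρ 0 x - ρt₀ x) 2 (volume.restrict Ω) with hδ
  have hδlim : Tendsto δ atTop (𝓝 0) := by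
    refine (hinit.2.comp hklim').congr fun n => ?_
    simp only [hδ, Function.comp, normL2, timeIncrement, zero_add]
  set K : ℕ → ℝ≥0∞ := fun n => C * (2 * (δ n ^ 2 + R₁) + (R₀ + B)) with hKdef
  have hKlim : Tendsto K atTop (𝓝 (C * (2 * (0 ^ 2 + R₁) + (R₀ + B)))) :=
    ENNReal.Tendsto.const_mul ((ENNReal.Tendsto.const_mul
      ((ENNReal.Tendsto.pow hδlim).add tendsto_const_nhds) (Or.inr (by simp))).add tendsto_const_nhds)
      (Or.inr hC)
  have hKle : C * (2 * (0 ^ 2 + R₁) + (R₀ + B)) ≤ 2 * C * (R₀ + R₁ + B) := by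
    calc C * (2 * (0 ^ 2 + R₁) + (R₀ + B)) = C * (2 * R₁ + 1 * R₀ + 1 * B) := by ring
      _ ≤ C * (2 * R₁ + 2 * R₀ + 2 * B) := by gcongr <;> norm_num
      _ = _ := by ring
  have hKn : ∀ n, C * (ENNReal.ofReal ((k n ^ 2)⁻¹) *
      (∫⁻ x in Ω, ‖timeIncrement (k n) ρ 0 x‖ₑ ^ 2) + (R₀ + B)) ≤ K n := fun n =>
    mul_le_mul_right (add_le_add (lintegral_initial_le hinit.1.1.aemeasurable) le_rfl) _
  have hltT : ∀ᵐ t ∂(volume.restrict (Icc 0 T)), t < T := by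
    have h1 : ∀ᵐ t : ℝ, t ≠ T := by simp [ae_iff, measure_singleton]
    filter_upwards [ae_restrict_of_ae h1, ae_restrict_mem measurableSet_Icc] with t ht htI
    exact lt_of_le_of_ne htI.2 ht
  have hev : ∀ t, 0 ≤ t → t < T → ∀ᶠ n in atTop, t ∈ Icc 0 (T - k n) := by
    intro t ht0 ht
    filter_upwards [hklim.eventually_lt_const (show (0 : ℝ) < T - t by linarith)] with n hn
    exact ⟨ht0, by linarith⟩
  have hmk : ∀ n, Measurable (Function.uncurry fun t x =>
      ‖(k n)⁻¹ • timeIncrement (k n) m t x‖ₑ ^ 2) := fun n =>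
    measurable_uncurry_quotient hsol.measurable_m (k n)
  constructor
  -- At a fixed t < T the increment bound holds for all large n, and Fatou is needed in x only.
  · filter_upwards [HasPathDeriv.ae_tendsto hT hsol.timeDeriv_ρ hsol.measurable_ρ
      hsol.measurable_ρt hkpos hklim, hltT, ae_restrict_mem measurableSet_Icc] with t ht htT htI
    refine (lintegral_le_of_le_liminf (K := K)
      (G := fun n x => ‖(k n)⁻¹ • timeIncrement (k n) ρ t x‖ₑ ^ 2) (fun n => ?_) ?_ ?_ hKlim).trans
      hKle
    · exact (measurable_uncurry_quotient hsol.measurable_ρ (k n)).of_uncurry_left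
    · filter_upwards [ht] with x hx using sq_le_liminf_of_tendsto hx
    · filter_upwards [hev t htI.1 htT] with n hn
      simp_rw [enorm_inv_smul_sq]
      rw [lintegral_const_mul' _ _ (by simp)]
      exact (ofReal_inv_sq_mul_le (hkpos n) ((hest (k n) (hkpos n) (hklt n)).1 t hn)).trans (hKn n)
  -- The intervals [0, T - k n] vary with n, so the integrands are extended by zero; the indicator
  -- is eventually 1 at each t in [0, T). Fatou is applied in x and then in t.
  · refine (lintegral_le_of_le_liminf (K := K) (G := fun n => (Icc 0 (T - k n)).indicator
      fun t => ∫⁻ x in Ω, ‖(k n)⁻¹ • timeIncrement (k n) m t x‖ₑ ^ 2) (fun n => ?_) ?_ ?_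
      hKlim).trans hKle
    · exact (hmk n).lintegral_prod_right'.indicator measurableSet_Icc
    · filter_upwards [HasPathDeriv.ae_tendsto hT hmd hsol.measurable_m hmt hkpos hklim, hltT,
        ae_restrict_mem measurableSet_Icc] with t ht htT htI
      calc ∫⁻ x in Ω, ‖mt t x‖ₑ ^ 2
          ≤ ∫⁻ x in Ω, liminf (fun n => ‖(k n)⁻¹ • timeIncrement (k n) m t x‖ₑ ^ 2) atTop :=
            lintegral_mono_ae (by filter_upwards [ht] with x hx using sq_le_liminf_of_tendsto hx)
        _ ≤ liminf (fun n => ∫⁻ x in Ω, ‖(k n)⁻¹ • timeIncrement (k n) m t x‖ₑ ^ 2) atTop :=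
            lintegral_liminf_le fun n => (hmk n).of_uncurry_left
        _ = _ := by
            refine liminf_congr ?_
            filter_upwards [hev t htI.1 htT] with n hn
            rw [indicator_of_mem hn]
    · refine Eventually.of_forall fun n => ?_
      rw [lintegral_indicator measurableSet_Icc, Measure.restrict_restrict measurableSet_Icc,
        inter_eq_left.2 (Icc_subset_Icc_right (by linarith [hkpos n]))]
      simp_rw [enorm_inv_smul_sq, lintegral_const_mul' _ _ ENNReal.ofReal_ne_top]
      exact (ofReal_inv_sq_mul_le (hkpos n) (hest (k n) (hkpos n) (hklt n)).2).trans (hKn n)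

end Limit

end MixedRegimeFlow

/-! ### The two a priori bounds -/

open MixedRegimeFlow
theorem mainTheorem7 (d : ℕ) (hd : 2 ≤ d) (Ω : Set (Space d)) (hΩ : IsOpen Ω)
    (hΩb : Bornology.IsBounded Ω) (T : ℝ) (hT : 0 < T) (N : ℕ) (hN : 1 ≤ N)
    (α : Fin (N + 2) → ℝ) (hα : IsPowerVector N α)
    (aLo aHi bHi φLo φHi : ℝ) (haLo : 0 < aLo) (hφLo : 0 < φLo) :
    ∃ C : ℝ, 0 < C ∧
      ∀ (a : Fin (N + 2) → ℝ → Space d → ℝ) (φ : Space d → ℝ) (f Ψ Ψt : ℝ → Space d → ℝ)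
        (gΨ : ℝ → Space d → Space d) (m : ℝ → Space d → Space d) (dm ρ ρt : ℝ → Space d → ℝ),
        IsAdmissibleCoeff Ω T aLo aHi bHi a → IsAdmissiblePorosity Ω φLo φHi φ →
        IsAdmissibleData Ω T f Ψ Ψt gΨ → IsWeakSolution Ω T α a φ f Ψt gΨ m dm ρ ρt →
        -- the energy bound
        (bochnerNorm Ω T ∞ 2 ρ ^ 2 +
            bochnerNorm Ω T (ENNReal.ofReal (sExp α)) (ENNReal.ofReal (sExp α)) m ^ sExp α ≤
          ENNReal.ofReal C * (normL2 Ω (ρ 0) ^ 2 + dataA Ω T α f Ψt gΨ)) ∧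
        -- the higher bound, as soon as the derivatives that occur in it exist
        ∀ (ft Ψtt : ℝ → Space d → ℝ) (gΨt mt : ℝ → Space d → Space d) (ρt₀ : Space d → ℝ),
          Measurable (Function.uncurry ft) → HasTimeDeriv Ω T f ft →
          Measurable (Function.uncurry Ψtt) → HasTimeDeriv Ω T Ψt Ψtt →
          Measurable (Function.uncurry gΨt) → HasTimeDeriv Ω T gΨ gΨt →
          Measurable (Function.uncurry mt) → HasTimeDeriv Ω T m mt →
          IsInitialTimeDeriv Ω ρ ρt₀ →
          bochnerNorm Ω T ∞ 2 ρt ^ 2 + bochnerNorm Ω T 2 2 mt ^ 2 + bochnerNorm Ω T ∞ 2 dm ^ 2 ≤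
            ENNReal.ofReal C *
              (dataB₀ Ω (ρ 0) ρt₀ + dataB Ω T α f ft Ψt Ψtt gΨ gΨt) := by
  have hs := hα.two_lt_sExp hN
  obtain ⟨C₁, hC₁, h1⟩ := exists_energy_estimate (Ω := Ω) hΩb hT hN hα aHi bHi φHi haLo hφLo
  obtain ⟨C₂, hC₂, h2⟩ := exists_timeDeriv_estimate (Ω := Ω) hΩb hT hN hα aHi bHi φHi haLo hφLo
  set κ := ENNReal.ofReal (|φHi| ^ 2) with hκ
  set τ := ENNReal.ofReal (2 / T + 2 * T) with hτ
  -- The summands serve the first bound, then ρt and mt, then the divergence.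
  set M : ℝ≥0∞ := 2 * C₁ + (2 * C₂ + 2 * (2 * (τ + κ * τ) + κ * C₂)) with hM
  have hMtop : M ≠ ⊤ := by finiteness
  have hMC : M ≤ ENNReal.ofReal (M.toReal + 1) := by
    rw [ENNReal.le_ofReal_iff_toReal_le hMtop (by positivity)]
    linarith
  have hpos : 0 < M.toReal + 1 := by positivity
  have hne : ENNReal.ofReal (M.toReal + 1) ≠ 0 := by simpa using hpos
  refine ⟨M.toReal + 1, hpos, ?_⟩
  intro a φ f Ψ Ψt gΨ m dm ρ ρt ha hφ hΨ hsol
  have hφb := hφ.abs_le hφLo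
  constructor
  -- With infinite data the right-hand side is ∞, because the constant is nonzero.
  · rcases eq_or_ne (dataA Ω T α f Ψt gΨ) ⊤ with hA | hA
    · rw [hA, add_top, ENNReal.mul_top hne]
      exact le_top
    obtain ⟨e1, e2⟩ := h1 a φ f Ψ Ψt gΨ m dm ρ ρt ha hφ hΨ hsol hA
    rw [← normL2_sq] at e1 e2
    have e3 : bochnerNorm Ω T ⊤ 2 ρ ^ 2 ≤ C₁ * (normL2 Ω (ρ 0) ^ 2 + dataA Ω T α f Ψt gΨ) := by
      refine bochnerNorm_top_sq_le ?_
      filter_upwards [ae_restrict_mem measurableSet_Icc] with t ht using e1 t ht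
    have e4 : bochnerNorm Ω T (ENNReal.ofReal (sExp α)) (ENNReal.ofReal (sExp α)) m ^ sExp α ≤
        C₁ * (normL2 Ω (ρ 0) ^ 2 + dataA Ω T α f Ψt gΨ) := by
      rw [bochnerNorm_rpow (by linarith)]
      refine (lintegral_mono fun t => lintegral_mono fun x => ?_).trans e2
      rw [← ofReal_norm, ENNReal.ofReal_rpow_of_nonneg (norm_nonneg _) (by linarith)]
      exact ENNReal.ofReal_le_ofReal (rpow_sExp_le_energyDensity (norm_nonneg _))
    refine (add_le_add e3 e4).trans ?_
    rw [← two_mul, ← mul_assoc]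
    gcongr
    exact le_self_add.trans hMC
  · intro ft Ψtt gΨt mt ρt₀ hft hfd hΨtt hΨd hgΨt hgd hmt hmd hinit
    rcases eq_or_ne (dataB Ω T α f ft Ψt Ψtt gΨ gΨt) ⊤ with hB | hB
    · rw [hB, add_top, ENNReal.mul_top hne]
      exact le_top
    have hA : dataA Ω T α f Ψt gΨ ≠ ⊤ := by
      refine ne_top_of_le_ne_top hB ?_
      unfold dataB
      rw [add_assoc, add_assoc]
      exact le_self_add
    obtain ⟨e1, e2⟩ := h2 a φ f Ψ Ψt gΨ m dm ρ ρt ft Ψtt gΨt mt ρt₀ ha hφ hΨ hsol hft hfd hΨtt hΨd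
      hgΨt hgd hmt hmd hinit hB
    set D := dataB₀ Ω (ρ 0) ρt₀ + dataB Ω T α f ft Ψt Ψtt gΨ gΨt with hD
    have hBexp : dataB Ω T α f ft Ψt Ψtt gΨ gΨt ≤ D := le_add_self
    rw [dataB, dataA_eq (by linarith), bochnerNorm_two_sq, bochnerNorm_two_sq,
      bochnerNorm_two_sq] at hBexp
    set IF := ∫⁻ t in Icc 0 T, ∫⁻ x in Ω, ‖f t x‖ₑ ^ 2 with hIF
    set IP := ∫⁻ t in Icc 0 T, ∫⁻ x in Ω, ‖Ψt t x‖ₑ ^ 2 with hIP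
    set JF := ∫⁻ t in Icc 0 T, ∫⁻ x in Ω, ‖ft t x‖ₑ ^ 2 with hJF
    set JP := ∫⁻ t in Icc 0 T, ∫⁻ x in Ω, ‖Ψtt t x‖ₑ ^ 2 with hJP
    have hFD : IF + JF ≤ D := le_trans (by
      refine (add_le_add ?_ le_rfl).trans (le_self_add.trans le_self_add)
      exact le_self_add.trans le_self_add) hBexp
    have hPD : IP + JP ≤ D := le_trans (by
      refine (add_le_add ?_ le_rfl).trans le_self_add
      exact le_add_self.trans (le_self_add.trans le_self_add)) hBexp
    have e3 : bochnerNorm Ω T ⊤ 2 ρt ^ 2 ≤ C₂ * D := bochnerNorm_top_sq_le e1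
    have e4 : bochnerNorm Ω T 2 2 mt ^ 2 ≤ C₂ * D := by
      rw [bochnerNorm_two_sq]
      exact e2
    -- The continuity equation bounds the divergence by f - φΨt - φρt. The factor τ bounds f and Ψt
    -- at each time through their derivatives in L²; ρt is bounded by `e1`.
    have e5 : bochnerNorm Ω T ⊤ 2 dm ^ 2 ≤ 2 * (2 * (τ + κ * τ) + κ * C₂) * D := by
      refine bochnerNorm_top_sq_le ?_
      filter_upwards [isSlice_ae (by linarith) ha hΨ hsol hA, e1,
        ae_restrict_mem measurableSet_Icc] with t hsl ht htI
      have q1 : ∫⁻ x in Ω, ‖f t x‖ₑ ^ 2 ≤ τ * D :=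
        (HasPathDeriv.lintegral_sq_le hT hfd hΨ.measurable_f hft htI).trans (by gcongr)
      have q2 : ∫⁻ x in Ω, ‖Ψt t x‖ₑ ^ 2 ≤ τ * D :=
        (HasPathDeriv.lintegral_sq_le hT hΨd hΨ.measurable_Ψt hΨtt htI).trans (by gcongr)
      have hm : Measurable fun x => f t x - φ x * Ψt t x :=
        hΨ.measurable_f.of_uncurry_left.sub
          (hφ.measurable.mul hΨ.measurable_Ψt.of_uncurry_left)
      calc ∫⁻ x in Ω, ‖dm t x‖ₑ ^ 2
          ≤ ∫⁻ x in Ω, ‖f t x - φ x * Ψt t x - φ x * ρt t x‖ₑ ^ 2 :=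
            hsl.lintegral_div_le hφ.measurable hφb
        _ ≤ 2 * ((∫⁻ x in Ω, ‖f t x - φ x * Ψt t x‖ₑ ^ 2) + κ * ∫⁻ x in Ω, ‖ρt t x‖ₑ ^ 2) :=
            lintegral_source_le hφb hm
        _ ≤ 2 * (2 * (τ * D + κ * (τ * D)) + κ * (C₂ * D)) := by
            gcongr
            refine (lintegral_source_le hφb hΨ.measurable_f.of_uncurry_left).trans ?_
            gcongr
        _ = _ := by ring
    calc bochnerNorm Ω T ⊤ 2 ρt ^ 2 + bochnerNorm Ω T 2 2 mt ^ 2 + bochnerNorm Ω T ⊤ 2 dm ^ 2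
        ≤ C₂ * D + C₂ * D + 2 * (2 * (τ + κ * τ) + κ * C₂) * D := add_le_add (add_le_add e3 e4) e5
      _ = (2 * C₂ + 2 * (2 * (τ + κ * τ) + κ * C₂)) * D := by ring
      _ ≤ ENNReal.ofReal (M.toReal + 1) * D := by
        gcongr
        exact le_add_self.trans hMC
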